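/- Let $N\ge 3$ be an integer, $\alpha\in(0,N)$, $p,q>1$ real, and let $K\in C^1(\mathbb R^N)$, $K\ge 0$. Let $I_\alpha(x)=A_\alpha|x|^{-(N-\alpha)}$ with $A_\alpha=\frac{\Gamma(\frac{N-\alpha}{2})}{\Gamma(\frac{\alpha}{2})\pi^{N/2}2^\alpha}$ be the Riesz potential. Let $u,\phi:\mathbb R^N\to\mathbb R$ form a weak (distributional) solution of $$-\Delta u+u+K(x)\phi|u|^{q-2}u=(I_\alpha*|u|^p)|u|^{p-2}u,\qquad -\Delta\phi=K(x)|u|^q\qquad\text{in }\mathbb R^N,$$ such that $$u\in H^1(\mathbb R^N)\cap L^{\frac{2Np}{N+\alpha}}(\mathbb R^N),\quad \phi\in H^1(\mathbb R^N),$$ $$K|u|^q\in L^{\frac{2N}{N+2}}(\mathbb R^N),\quad \nabla u\in H^1_{loc}(\mathbb R^N)\cap L^{\frac{2Np}{N+\alpha}}_{loc}(\mathbb R^N).$$ Then $|\nabla u|^2$, $|u|^2$, $K\phi|u|^q$ and $(I_\alpha*|u|^p)|u|^p$ are integrable on $\mathbb R^N$. Moreover, whenever the integral $\int_{\mathbb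 R^N}\phi|u|^q\,x\cdot\nabla K$ exists in the extended Lebesgue sense (that is, the positive part or the negative part of its integrand is integrable), its integrand is integrable and $$\int_{\mathbb R^N}\Big(\frac{N-2}{2}|\nabla u|^2+\frac N2|u|^2\Big)+\frac{N+2}{2q}\int_{\mathbb R^N}K\phi|u|^q+\frac1q\int_{\mathbb R^N}\phi|u|^q\,x\cdot\nabla K=\frac{N+\alpha}{2p}\int_{\mathbb R^N}(I_\alpha*|u|^p)|u|^p.$$ -/

import Mathlib

open MeasureTheory
open scoped ContDiff

noncomputable section

/-- Euclidean space `ℝ^N`. -/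
abbrev RN (N : ℕ) : Type := EuclideanSpace ℝ (Fin N)

/-- Smooth compactly supported test functions on `ℝ^N`. -/
def IsTestFunction {N : ℕ} (ψ : RN N → ℝ) : Prop :=
  ContDiff ℝ ∞ ψ ∧ HasCompactSupport ψ

/-- `g` is a weak (distributional) gradient of `f` on `ℝ^N`. It is unique up to null sets. -/
structure IsWeakGradient {N : ℕ} (f : RN N → ℝ) (g : RN N → RN N) : Prop where
  locallyIntegrable_fun : LocallyIntegrable f volume
  locallyIntegrable_grad : LocallyIntegrable g volume
  integral_eq : ∀ ψ : RN N → ℝ, IsTestFunction ψ →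
    ∫ x, f x • gradient ψ x = - ∫ x, ψ x • g x

/-- `f ∈ L^s_loc(ℝ^N)`. -/
def MemLpLoc {N : ℕ} {F : Type*} [NormedAddCommGroup F] (f : RN N → F) (s : ENNReal) : Prop :=
  ∀ S : Set (RN N), IsCompact S → MemLp f s (volume.restrict S)

/-- `f ∈ H^1_loc(ℝ^N)`. -/
def MemH1Loc {N : ℕ} (f : RN N → ℝ) : Prop :=
  MemLpLoc f 2 ∧ ∃ g : RN N → RN N, IsWeakGradient f g ∧ MemLpLoc g 2

/-- The constant `A_α` normalising the Riesz potential on `ℝ^N`. -/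
def rieszConst (N : ℕ) (α : ℝ) : ℝ :=
  Real.Gamma (((N : ℝ) - α) / 2) /
    (Real.Gamma (α / 2) * Real.pi ^ ((N : ℝ) / 2) * (2 : ℝ) ^ α)

/-- The Riesz kernel `I_α(x) = A_α / |x|^(N-α)`. -/
def rieszKernel {N : ℕ} (α : ℝ) (x : RN N) : ℝ :=
  rieszConst N α / ‖x‖ ^ ((N : ℝ) - α)

/-- The convolution `I_α * f`. -/
def rieszPotential {N : ℕ} (α : ℝ) (f : RN N → ℝ) (x : RN N) : ℝ :=
  ∫ y, rieszKernel α (x - y) * f y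

/-- `(u, φ)`, with weak gradients `Du` and `Dφ`, is a weak solution on `ℝ^N` of
`-Δu + u + K φ |u|^(q-2) u = (I_α * |u|^p) |u|^(p-2) u`, `-Δφ = K |u|^q`. -/
structure IsWeakSolution {N : ℕ} (α p q : ℝ) (K u φ : RN N → ℝ) (Du Dφ : RN N → RN N) :
    Prop where
  grad_u : IsWeakGradient u Du
  grad_φ : IsWeakGradient φ Dφ
  eq_u : ∀ ψ : RN N → ℝ, IsTestFunction ψ →
    (∫ x, inner ℝ (Du x) (gradient ψ x)) + (∫ x, u x * ψ x)
        + (∫ x, K x * φ x * (|u x| ^ (q - 2) * u x) * ψ x)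
      = ∫ x, rieszPotential α (fun y => |u y| ^ p) x * (|u x| ^ (p - 2) * u x) * ψ x
  eq_φ : ∀ ψ : RN N → ℝ, IsTestFunction ψ →
    (∫ x, inner ℝ (Dφ x) (gradient ψ x)) = ∫ x, K x * |u x| ^ q * ψ x

/-- The regularity class:
`u ∈ H^1 ∩ L^(2Np/(N+α))`, `φ ∈ H^1`, `K |u|^q ∈ L^(2N/(N+2))`,
`∇u ∈ H^1_loc ∩ L^(2Np/(N+α))_loc`, where `Du`, `Dφ` are the weak gradients of `u`, `φ`. -/
structure HasSolutionRegularity {N : ℕ} (α p q : ℝ) (K u φ : RN N → ℝ)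
    (Du Dφ : RN N → RN N) : Prop where
  u_L2 : MemLp u 2 volume
  Du_L2 : MemLp Du 2 volume
  u_Ls : MemLp u (ENNReal.ofReal (2 * N * p / (N + α))) volume
  φ_L2 : MemLp φ 2 volume
  Dφ_L2 : MemLp Dφ 2 volume
  source_Lr : MemLp (fun x => K x * |u x| ^ q) (ENNReal.ofReal (2 * N / (N + 2))) volume
  Du_H1loc : ∀ i : Fin N, MemH1Loc (fun x => Du x i)
  Du_Lsloc : MemLpLoc Du (ENNReal.ofReal (2 * N * p / (N + α)))

/-- The integrand `φ |u|^q x·∇K`. -/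
def virialDensity {N : ℕ} (q : ℝ) (K u φ : RN N → ℝ) (x : RN N) : ℝ :=
  φ x * |u x| ^ q * inner ℝ x (gradient K x)

end

open Filter Topology Set

/-! This is a Pohozaev identity. The equation for `u` is tested with `X·∇u`, where `X(x) = θ(lx) x`
is the position field cut off at distance about `1/l`, and then `l → 0`. Where `X(x) = x` one has
`DX = id` and `div X = N`, which produces the constants.

Since `X·∇u` is not a test function, `X·∇u_t` is used instead, with `u_t` a mollification. A
Friedrichs commutator argument (`IsMollifierPair.tendsto_integral_mul_fderiv_mollify`) shows that `∫
g X·∇g_t → -½ ∫ div X g²` for every `g ∈ L²`, with no derivative of `g`. Applied to the components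
of the gradient it yields the quadratic form `stressForm`. The right-hand side passes to the limit
because it equals `u - Δu`, which is in `L²_loc` since `∇u ∈ H¹_loc`
(`IsWeakGradient.memLpLoc_of_equation`).

For the Riesz term, one integrates by parts in `x` in the double integral and symmetrises in `(x,
y)`. The kernel's gradient is then paired with `X(x) - X(y)`, and as `X` is Lipschitz the result is
bounded by the kernel itself. The Hardy–Littlewood–Sobolev inequality supplies the dominating
function (`IsWeakGradient.integral_rieszKernel`).

For the coupling term, formally `q ∫ Kφ|u|^(q-2)u X·∇u = -∫ |u|^q div(KφX)`. This contains `∫ K|u|^q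
X·∇φ`, the second equation tested with `X·∇φ`, hence the stress form of `∇φ`. But neither `|u|^q ∇K`
nor `K|u|^q ∇φ` is known to be locally integrable, so `|u|^q` is truncated and `φ` is mollified. As
`φ` is weakly superharmonic, its radial mollifications are nonincreasing in `t`, tend to `0` as `t →
∞` and recover `φ` almost everywhere along a sequence `t → 0`. So `0 ≤ φ_t ≤ φ`, and `Kφ|u|^q`
dominates. Its integrability, and `∫ Kφ|u|^q = ∫ |∇φ|²`, come from testing the second equation with
cut-off mollifications of `φ` (`IsWeakGradient.integral_mul_eq_integral_norm_sq`).

Each approximation of `φ|u|^q x·∇K` multiplies it by a factor in `[0, 1]`, so positive and negative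
parts only shrink. If one part of the full integrand is integrable, Fatou's lemma controls the other
from the convergent integrals (`integrable_of_tendsto_of_one_sided`). This is used three times:
removing the truncation, the mollification and the cutoff. -/

/-! ### Coordinates and the divergence theorem for compactly supported fields. -/

/-- The `i`-th vector of the standard basis. -/
noncomputable abbrev stdVec {N : ℕ} (i : Fin N) : RN N := EuclideanSpace.single i (1 : ℝ)

/-- The divergence of a vector field. -/
noncomputable def divergence {N : ℕ} (Y : RN N → RN N) (x : RN N) : ℝ :=
  ∑ i, fderiv ℝ Y x (stdVec i) i

lemma sum_smul_stdVec {N : ℕ} (v : RN N) : ∑ i, v i • stdVec i = v := by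
  ext j
  simp [Pi.single_apply, Finset.sum_apply]

lemma clm_apply_eq_sum {N : ℕ} {F : Type*} [NormedAddCommGroup F] [NormedSpace ℝ F]
    (L : RN N →L[ℝ] F) (v : RN N) : L v = ∑ i, v i • L (stdVec i) := by
  conv_lhs => rw [← sum_smul_stdVec v]
  simp

lemma fderiv_coord {N : ℕ} {Y : RN N → RN N} {x : RN N} (h : DifferentiableAt ℝ Y x) (i : Fin N)
    (v : RN N) : fderiv ℝ (fun y => Y y i) x v = fderiv ℝ Y x v i := by
  have := ((EuclideanSpace.proj (𝕜 := ℝ) i).hasFDerivAt.comp x h.hasFDerivAt).fderiv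
  have h2 : (fun y => Y y i) = (EuclideanSpace.proj (𝕜 := ℝ) i : RN N →L[ℝ] ℝ) ∘ Y := rfl
  rw [h2, this]; rfl

lemma contDiff_coord {N : ℕ} {n : WithTop ℕ∞} {Y : RN N → RN N} (h : ContDiff ℝ n Y) (i : Fin N) :
    ContDiff ℝ n (fun y => Y y i) :=
  (EuclideanSpace.proj (𝕜 := ℝ) i : RN N →L[ℝ] ℝ).contDiff.comp h

lemma hasCompactSupport_coord {N : ℕ} {Y : RN N → RN N} (h : HasCompactSupport Y) (i : Fin N) :
    HasCompactSupport (fun y => Y y i) :=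
  h.comp_left (g := fun v : RN N => v i) rfl

lemma continuous_divergence {N : ℕ} {Y : RN N → RN N} (h : ContDiff ℝ 1 Y) :
    Continuous (divergence Y) := by
  refine continuous_finsetSum _ fun i _ => ?_
  exact (EuclideanSpace.proj (𝕜 := ℝ) i).continuous.comp
    ((h.continuous_fderiv one_ne_zero).clm_apply continuous_const)

lemma hasCompactSupport_divergence {N : ℕ} {Y : RN N → RN N} (h : HasCompactSupport Y) :
    HasCompactSupport (divergence Y) :=
  (h.fderiv ℝ).comp_left (g := fun L : RN N →L[ℝ] RN N => ∑ i, L (stdVec i) i) (by simp)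

/-- Integration by parts against the constant function `1`. -/
lemma integral_fderiv_eq_zero {N : ℕ} {g : RN N → ℝ} (hg : ContDiff ℝ 1 g)
    (hc : HasCompactSupport g) (v : RN N) : ∫ x, fderiv ℝ g x v = 0 := by
  have hd : Continuous fun x => fderiv ℝ g x v :=
    (hg.continuous_fderiv one_ne_zero).clm_apply continuous_const
  have hdc : HasCompactSupport fun x => fderiv ℝ g x v :=
    (hc.fderiv ℝ).comp_left (g := fun L : RN N →L[ℝ] ℝ => L v) (by simp)
  have h1 : Integrable fun x => fderiv ℝ g x v := hd.integrable_of_hasCompactSupport hdc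
  have h2 : Integrable g := hg.continuous.integrable_of_hasCompactSupport hc
  have := integral_mul_fderiv_eq_neg_fderiv_mul_of_integrable (μ := (volume : Measure (RN N)))
    (f := g) (g := fun _ => (1 : ℝ)) (v := v)
    (by simpa using h1) (by simp) (by simpa using h2)
    (fun x _ => (hg.differentiable one_ne_zero) x) (fun x _ => by fun_prop)
  simp at this
  exact this

lemma integral_divergence_eq_zero {N : ℕ} {Y : RN N → RN N} (hY : ContDiff ℝ 1 Y)
    (hc : HasCompactSupport Y) : ∫ x, divergence Y x = 0 := by
  unfold divergence
  have hd := hY.differentiable one_ne_zero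
  have e : ∀ i x, fderiv ℝ Y x (stdVec i) i = fderiv ℝ (fun y => Y y i) x (stdVec i) :=
    fun i x => (fderiv_coord (hd x) i _).symm
  rw [integral_finsetSum]
  · refine Finset.sum_eq_zero fun i _ => ?_
    simp_rw [e]
    exact integral_fderiv_eq_zero (contDiff_coord hY i) (hasCompactSupport_coord hc i) _
  · intro i _
    refine Continuous.integrable_of_hasCompactSupport ?_ ?_
    · exact (EuclideanSpace.proj (𝕜 := ℝ) i).continuous.comp
        ((hY.continuous_fderiv one_ne_zero).clm_apply continuous_const)
    · exact (hc.fderiv ℝ).comp_left (g := fun L : RN N →L[ℝ] RN N => L (stdVec i) i) (by simp)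

lemma divergence_smul {N : ℕ} {a : RN N → ℝ} {Y : RN N → RN N} {x : RN N}
    (ha : DifferentiableAt ℝ a x) (hY : DifferentiableAt ℝ Y x) :
    divergence (fun y => a y • Y y) x = fderiv ℝ a x (Y x) + a x * divergence Y x := by
  unfold divergence
  rw [fderiv_fun_smul ha hY, clm_apply_eq_sum (fderiv ℝ a x) (Y x), Finset.mul_sum,
    ← Finset.sum_add_distrib]
  refine Finset.sum_congr rfl fun i _ => ?_
  simp
  ring

/-! ### Radial mollifiers and continuity of translations in L². -/

/-- A pair of radial kernels: a mollifier `η` and a potential `ζ` with `∇ζ(x) = -η(x) x`. -/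
structure IsMollifierPair {N : ℕ} (η ζ : RN N → ℝ) : Prop where
  contDiff_ker : ContDiff ℝ ∞ η
  contDiff_pot : ContDiff ℝ ∞ ζ
  ker_nonneg : ∀ x, 0 ≤ η x
  pot_nonneg : ∀ x, 0 ≤ ζ x
  ker_eq_zero : ∀ x, 1 ≤ ‖x‖ → η x = 0
  pot_eq_zero : ∀ x, 1 ≤ ‖x‖ → ζ x = 0
  ker_neg : ∀ x, η (-x) = η x
  integral_ker : ∫ x, η x = 1
  fderiv_pot : ∀ x v, fderiv ℝ ζ x v = - η x * inner ℝ x v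

lemma contDiff_deriv_expNegInvGlue : ContDiff ℝ ∞ (deriv expNegInvGlue) := by
  have h : ContDiff ℝ ∞ expNegInvGlue := expNegInvGlue.contDiff
  exact (contDiff_infty_iff_deriv.1 h).2

lemma deriv_expNegInvGlue_nonpos {s : ℝ} (hs : s ≤ 0) : deriv expNegInvGlue s = 0 := by
  have h := expNegInvGlue.hasDerivAt_polynomial_eval_inv_mul 1 s
  simp only [Polynomial.eval_one, one_mul, expNegInvGlue.zero_of_nonpos hs, mul_zero] at h
  exact h.deriv

lemma deriv_expNegInvGlue_one_pos : 0 < deriv expNegInvGlue 1 := by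
  have h := expNegInvGlue.hasDerivAt_polynomial_eval_inv_mul 1 1
  simp only [Polynomial.eval_one, one_mul] at h
  have h2 : deriv expNegInvGlue 1 = _ := h.deriv
  rw [h2]
  simpa using expNegInvGlue.pos_of_pos one_pos

lemma hasCompactSupport_of_norm_ge {N : ℕ} {F : Type*} [Zero F] {f : RN N → F} {R : ℝ}
    (h : ∀ x, R ≤ ‖x‖ → f x = 0) : HasCompactSupport f := by
  refine HasCompactSupport.intro (isCompact_closedBall (0 : RN N) R) fun x hx => h x ?_
  simp at hx
  exact hx.le

/-- With `E = expNegInvGlue`, take `ζ = c E(1 - |x|²)` and `η = 2c E'(1 - |x|²)`; the chain rule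
gives `∇ζ = -η x`, monotonicity of `E` gives `η ≥ 0`, and `c` normalises the mass of `η`. -/
lemma exists_isMollifierPair (N : ℕ) : ∃ η ζ : RN N → ℝ, IsMollifierPair η ζ := by
  set η₀ : RN N → ℝ := fun x => 2 * deriv expNegInvGlue (1 - ‖x‖ ^ 2) with hη
  set ζ₀ : RN N → ℝ := fun x => expNegInvGlue (1 - ‖x‖ ^ 2) with hζ
  have hsm : ContDiff ℝ ∞ (fun x : RN N => 1 - ‖x‖ ^ 2) :=
    contDiff_const.sub (contDiff_norm_sq ℝ)
  have c1 : ContDiff ℝ ∞ η₀ := contDiff_const.mul (contDiff_deriv_expNegInvGlue.comp hsm)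
  have c2 : ContDiff ℝ ∞ ζ₀ := expNegInvGlue.contDiff.comp hsm
  have n1 : ∀ x, 0 ≤ η₀ x := fun x =>
    mul_nonneg zero_le_two (expNegInvGlue.monotone.deriv_nonneg)
  have z1 : ∀ x : RN N, 1 ≤ ‖x‖ → 1 - ‖x‖ ^ 2 ≤ 0 := fun x hx => sub_nonpos.2 (one_le_pow₀ hx)
  have z2 : ∀ x, 1 ≤ ‖x‖ → η₀ x = 0 := fun x hx => by
    simp [hη, deriv_expNegInvGlue_nonpos (z1 x hx)]
  have hc1 : HasCompactSupport η₀ := hasCompactSupport_of_norm_ge z2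
  have hpos : 0 < ∫ x, η₀ x := by
    refine c1.continuous.integral_pos_of_hasCompactSupport_nonneg_nonzero hc1 n1 (x := 0) ?_
    simp [hη, deriv_expNegInvGlue_one_pos.ne']
  set c := (∫ x, η₀ x)⁻¹ with hc
  have hcpos : 0 < c := inv_pos.2 hpos
  refine ⟨fun x => c * η₀ x, fun x => c * ζ₀ x, ?_⟩
  refine ⟨contDiff_const.mul c1, contDiff_const.mul c2, fun x => mul_nonneg hcpos.le (n1 x),
    fun x => mul_nonneg hcpos.le (expNegInvGlue.nonneg _), fun x hx => by simp [z2 x hx],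
    fun x hx => by simp [hζ, expNegInvGlue.zero_of_nonpos (z1 x hx)], fun x => by simp [hη],
    ?_, ?_⟩
  · rw [integral_const_mul, hc, inv_mul_cancel₀ hpos.ne']
  · intro x v
    have d1 : HasFDerivAt (fun x : RN N => 1 - ‖x‖ ^ 2) (-(2 • innerSL ℝ x)) x := by
      simpa using ((hasStrictFDerivAt_norm_sq x).hasFDerivAt).const_sub 1
    have d2 : HasDerivAt expNegInvGlue (deriv expNegInvGlue (1 - ‖x‖ ^ 2)) (1 - ‖x‖ ^ 2) := by
      have : Differentiable ℝ expNegInvGlue :=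
        (expNegInvGlue.contDiff (n := 1)).differentiable one_ne_zero
      exact (this _).hasDerivAt
    have d3 := (d2.comp_hasFDerivAt x d1).const_mul c
    have : fderiv ℝ (fun x => c * ζ₀ x) x = _ := d3.fderiv
    rw [this]
    simp [hη]
    ring

/-- The rescaled kernel `t^{-N} η(x/t)`. -/
noncomputable def rescale {N : ℕ} (η : RN N → ℝ) (t : ℝ) (x : RN N) : ℝ :=
  (t ^ N)⁻¹ * η (t⁻¹ • x)

lemma contDiff_rescale {N : ℕ} {n : WithTop ℕ∞} {η : RN N → ℝ} (h : ContDiff ℝ n η) (t : ℝ) :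
    ContDiff ℝ n (rescale η t) :=
  contDiff_const.mul (h.comp (contDiff_const_smul _))

lemma rescale_eq_zero {N : ℕ} {η : RN N → ℝ} (h : ∀ x, 1 ≤ ‖x‖ → η x = 0) {t : ℝ} (ht : 0 < t)
    {x : RN N} (hx : t ≤ ‖x‖) : rescale η t x = 0 := by
  rw [rescale, h, mul_zero]
  rw [norm_smul, norm_inv, Real.norm_of_nonneg ht.le, inv_mul_eq_div, one_le_div ht]
  exact hx

lemma integral_rescale {N : ℕ} (η : RN N → ℝ) {t : ℝ} (ht : 0 < t) :
    ∫ x, rescale η t x = ∫ x, η x := by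
  unfold rescale
  rw [integral_const_mul, Measure.integral_comp_inv_smul, finrank_euclideanSpace_fin, smul_eq_mul,
    abs_of_nonneg (by positivity), ← mul_assoc, inv_mul_cancel₀ (by positivity), one_mul]

lemma fderiv_rescale {N : ℕ} {η : RN N → ℝ} (h : Differentiable ℝ η) (t : ℝ) (x v : RN N) :
    fderiv ℝ (rescale η t) x v = (t ^ N)⁻¹ * (t⁻¹ * fderiv ℝ η (t⁻¹ • x) v) := by
  have d1 : HasFDerivAt (fun x : RN N => t⁻¹ • x) (t⁻¹ • ContinuousLinearMap.id ℝ (RN N)) x :=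
    (hasFDerivAt_id x).const_smul t⁻¹
  have d2 := (((h (t⁻¹ • x)).hasFDerivAt.comp x d1).const_mul (t ^ N)⁻¹).fderiv
  have : fderiv ℝ (rescale η t) x = _ := d2
  rw [this]; simp

/-- Mollification: the convolution of `g` with the kernel `η`. -/
noncomputable def mollify {N : ℕ} (η g : RN N → ℝ) (x : RN N) : ℝ := ∫ y, g y * η (x - y)

open scoped Convolution in
lemma mollify_eq_convolution {N : ℕ} (η g : RN N → ℝ) :
    mollify η g = g ⋆[ContinuousLinearMap.mul ℝ ℝ, volume] η := rfl

lemma contDiff_mollify {N : ℕ} {η g : RN N → ℝ} {n : ℕ∞} (hη : ContDiff ℝ n η)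
    (hc : HasCompactSupport η) (hg : LocallyIntegrable g) : ContDiff ℝ n (mollify η g) := by
  rw [mollify_eq_convolution]
  exact hc.contDiff_convolution_right _ hg hη

lemma fderiv_mollify {N : ℕ} {η g : RN N → ℝ} (hη : ContDiff ℝ 1 η)
    (hc : HasCompactSupport η) (hg : LocallyIntegrable g) (x v : RN N) :
    fderiv ℝ (mollify η g) x v = mollify (fun z => fderiv ℝ η z v) g x := by
  rw [mollify_eq_convolution, (hc.hasFDerivAt_convolution_right _ hg hη x).fderiv,
    convolution_precompR_apply _ hg (hc.fderiv ℝ) (hη.continuous_fderiv one_ne_zero)]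
  rfl

lemma integrable_mul_sub {N : ℕ} {η g : RN N → ℝ} (hη : Continuous η)
    (hc : HasCompactSupport η) (hg : LocallyIntegrable g) (x : RN N) :
    Integrable fun y => g y * η (x - y) :=
  hc.convolutionExists_right (ContinuousLinearMap.mul ℝ ℝ) hg hη x

lemma MeasureTheory.MemLp.integral_sq_eq_norm_toLp {X : Type*} [MeasurableSpace X] {μ : Measure X} {f : X → ℝ}
    (hf : MemLp f 2 μ) : ∫ x, f x ^ 2 ∂μ = ‖hf.toLp f‖ ^ 2 := by
  rw [← real_inner_self_eq_norm_sq, L2.inner_def]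
  refine integral_congr_ae ?_
  filter_upwards [hf.coeFn_toLp] with x hx
  simp [hx, sq]

/-- Translations are measure preserving and depend continuously on `z`, so composition with them is
continuous into L². -/
lemma tendsto_integral_sq_translate_sub {N : ℕ} {g : RN N → ℝ} (hg : MemLp g 2 volume) :
    Tendsto (fun z : RN N => ∫ x, (g (x + z) - g x) ^ 2) (𝓝 0) (𝓝 0) := by
  let T : RN N → C(RN N, RN N) := fun z => ⟨fun x => x + z, by fun_prop⟩
  have hT : Continuous T := by
    refine ContinuousMap.continuous_of_continuous_uncurry _ ?_
    change Continuous fun p : RN N × RN N => p.2 + p.1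
    fun_prop
  have hm : ∀ z, MeasurePreserving (T z) (volume : Measure (RN N)) volume := fun z =>
    measurePreserving_add_right volume z
  have hc : Continuous fun z => Lp.compMeasurePreserving (T z) (hm z) (hg.toLp g) :=
    continuous_const.compMeasurePreservingLp hT hm (by simp)
  have h1 : Tendsto (fun z => ‖Lp.compMeasurePreserving (T z) (hm z) (hg.toLp g)
      - Lp.compMeasurePreserving (T 0) (hm 0) (hg.toLp g)‖ ^ 2) (𝓝 0) (𝓝 0) := by
    have := ((hc.tendsto 0).sub_const (Lp.compMeasurePreserving (T 0) (hm 0) (hg.toLp g))).norm.pow 2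
    simpa using this
  refine h1.congr fun z => ?_
  have e : ∀ z, MemLp (fun x => g (x + z)) 2 volume := fun z => hg.comp_measurePreserving (hm z)
  have e1 : MemLp (fun x => g (x + z) - g x) 2 volume := (e z).sub hg
  rw [MemLp.integral_sq_eq_norm_toLp e1]
  congr 2
  have e0 : ∀ z, Lp.compMeasurePreserving (T z) (hm z) (hg.toLp g) = (e z).toLp _ := fun z =>
    Lp.toLp_compMeasurePreserving hg (hm z)
  rw [e0, e0, ← MemLp.toLp_sub]
  congr 1
  ext x
  simp

lemma exists_integral_sq_translate_sub_le {N : ℕ} {g : RN N → ℝ} (hg : MemLp g 2 volume) {ε : ℝ}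
    (hε : 0 < ε) : ∃ δ > 0, ∀ z : RN N, ‖z‖ ≤ δ → ∫ x, (g (x + z) - g x) ^ 2 ≤ ε := by
  have := (tendsto_integral_sq_translate_sub hg).eventually (gt_mem_nhds hε)
  obtain ⟨δ, hδ, h⟩ := Metric.eventually_nhds_iff.1 this
  refine ⟨δ / 2, by positivity, fun z hz => (h ?_).le⟩
  rw [dist_zero_right]
  linarith

/-! ### Double integrals with a convolution kernel. -/

section Kernel

variable {N : ℕ} {g κ : RN N → ℝ}

lemma integrable_mul_kernel_snd {a : RN N → ℝ} (ha : Integrable a) (hκ : Integrable κ) :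
    Integrable (fun p : RN N × RN N => a p.2 * κ (p.1 - p.2)) (volume.prod volume) :=
  ha.convolution_integrand (ContinuousLinearMap.mul ℝ ℝ) hκ

lemma integrable_mul_kernel_fst {a : RN N → ℝ} (ha : Integrable a) (hκ : Integrable κ) :
    Integrable (fun p : RN N × RN N => a p.1 * κ (p.1 - p.2)) (volume.prod volume) := by
  have := (integrable_mul_kernel_snd ha hκ.comp_neg).swap
  refine this.congr (Eventually.of_forall fun p => ?_)
  simp

lemma integrable_of_le_sq_kernel (hg : MemLp g 2 volume) (hκ : Integrable κ)
    {F : RN N × RN N → ℝ} (hF : AEStronglyMeasurable F (volume.prod volume))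
    (h : ∀ p, |F p| ≤ (g p.1 ^ 2 + g p.2 ^ 2) * κ (p.1 - p.2)) :
    Integrable F (volume.prod volume) := by
  refine Integrable.mono' ((integrable_mul_kernel_fst hg.integrable_sq hκ).add
    (integrable_mul_kernel_snd hg.integrable_sq hκ)) hF (Eventually.of_forall fun p => ?_)
  have := h p
  simp only [Pi.add_apply, Real.norm_eq_abs]
  linarith

/-- In the variables `(x, w)` with `y = x + w`, the inner integral is the squared L² distance
between `g` and its translate by `w`, and only `‖w‖ ≤ t` contributes. This converts the L² modulus
of continuity into smallness of the double integral. -/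
lemma integral_sq_sub_mul_kernel_le (hg : MemLp g 2 volume) (hκ : Integrable κ)
    (h0 : ∀ z, 0 ≤ κ z) {t ε : ℝ} (hs : ∀ z, t < ‖z‖ → κ z = 0)
    (hε : ∀ z : RN N, ‖z‖ ≤ t → ∫ x, (g (x + z) - g x) ^ 2 ≤ ε) :
    Integrable (fun p : RN N × RN N => (g p.1 - g p.2) ^ 2 * κ (p.1 - p.2)) (volume.prod volume) ∧
    ∫ p : RN N × RN N, (g p.1 - g p.2) ^ 2 * κ (p.1 - p.2) ∂(volume.prod volume) ≤ ε * ∫ z, κ z := by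
  have hI : Integrable (fun p : RN N × RN N => (g p.1 - g p.2) ^ 2 * κ (p.1 - p.2))
      (volume.prod volume) := by
    refine integrable_of_le_sq_kernel hg (hκ.const_mul 2) ?_ fun p => ?_
    · refine AEStronglyMeasurable.mul ?_ ?_
      · exact ((hg.aestronglyMeasurable.comp_fst).sub (hg.aestronglyMeasurable.comp_snd)).pow 2
      · exact hκ.aestronglyMeasurable.comp_quasiMeasurePreserving
          (quasiMeasurePreserving_sub_of_right_invariant volume volume)
    · rw [abs_of_nonneg (mul_nonneg (sq_nonneg _) (h0 _)), ← mul_assoc]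
      refine mul_le_mul_of_nonneg_right ?_ (h0 _)
      nlinarith [sq_nonneg (g p.1 + g p.2)]
  refine ⟨hI, ?_⟩
  have hΦ : MeasurePreserving (MeasurableEquiv.shearAddRight (RN N))
      ((volume : Measure (RN N)).prod (volume : Measure (RN N))) (volume.prod volume) :=
    measurePreserving_prod_add volume volume
  -- The shear `(x, w) ↦ (x, x + w)` preserves the product measure.
  rw [← hΦ.integral_comp' ]
  have hI2 := hΦ.integrable_comp_emb (MeasurableEquiv.measurableEmbedding _) |>.2 hI
  simp only [Function.comp_def] at hI2
  rw [integral_prod_symm _ hI2]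
  have e : ∀ w : RN N, ∫ x : RN N, (g (MeasurableEquiv.shearAddRight (RN N) (x, w)).1 -
      g (MeasurableEquiv.shearAddRight (RN N) (x, w)).2) ^ 2 *
      κ ((MeasurableEquiv.shearAddRight (RN N) (x, w)).1 -
        (MeasurableEquiv.shearAddRight (RN N) (x, w)).2)
      = (∫ x, (g (x + w) - g x) ^ 2) * κ (-w) := by
    intro w
    rw [← integral_mul_const]
    refine integral_congr_ae (Eventually.of_forall fun x => ?_)
    change (g x - g (x + w)) ^ 2 * κ (x - (x + w)) = _
    simp only [sub_add_cancel_left]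
    ring
  have hI3 := hI2.integral_prod_right
  simp_rw [e] at hI3 ⊢
  calc _ ≤ ∫ w, ε * κ (-w) := by
        refine integral_mono hI3 (hκ.comp_neg.const_mul ε) fun w => ?_
        by_cases hw : ‖w‖ ≤ t
        · exact mul_le_mul_of_nonneg_right (hε w hw) (h0 _)
        · simp [hs (-w) (by simpa using hw)]
    _ = ε * ∫ z, κ z := by
        rw [integral_const_mul, integral_neg_eq_self]

/-- Jensen's inequality for the square: the variance of `a` under the probability density `w` is
nonnegative. -/
lemma sq_integral_mul_le {X : Type*} [MeasurableSpace X] {μ : Measure X} {a w : X → ℝ}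
    (hw0 : ∀ x, 0 ≤ w x) (hw : Integrable w μ) (hw1 : ∫ x, w x ∂μ = 1)
    (h1 : Integrable (fun x => a x * w x) μ) (h2 : Integrable (fun x => a x ^ 2 * w x) μ) :
    (∫ x, a x * w x ∂μ) ^ 2 ≤ ∫ x, a x ^ 2 * w x ∂μ := by
  set m := ∫ x, a x * w x ∂μ with hm
  have h : 0 ≤ ∫ x, (a x - m) ^ 2 * w x ∂μ :=
    integral_nonneg fun x => mul_nonneg (sq_nonneg _) (hw0 x)
  have e : ∫ x, (a x - m) ^ 2 * w x ∂μ
      = ∫ x, ((a x ^ 2 * w x - (2 * m) * (a x * w x)) + m ^ 2 * w x) ∂μ :=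
    integral_congr_ae (Eventually.of_forall fun x => by ring)
  have h3 : Integrable (fun x => a x ^ 2 * w x - (2 * m) * (a x * w x)) μ :=
    h2.sub (h1.const_mul _)
  rw [e, integral_add h3 (hw.const_mul _),
    integral_sub h2 (h1.const_mul _), integral_const_mul, integral_const_mul, hw1, ← hm] at h
  nlinarith

end Kernel

/-! ### Mollification in L². -/

section Mollify

variable {N : ℕ} {η ζ g : RN N → ℝ}

lemma IsMollifierPair.integrable_rescale (hη : IsMollifierPair η ζ) {t : ℝ} (ht : 0 < t) :
    Integrable (rescale η t) :=
  (contDiff_rescale hη.contDiff_ker t).continuous.integrable_of_hasCompactSupport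
    (hasCompactSupport_of_norm_ge fun _ => rescale_eq_zero hη.ker_eq_zero ht)

lemma IsMollifierPair.hasCompactSupport_rescale (hη : IsMollifierPair η ζ) {t : ℝ} (ht : 0 < t) :
    HasCompactSupport (rescale η t) :=
  hasCompactSupport_of_norm_ge fun _ => rescale_eq_zero hη.ker_eq_zero ht

lemma IsMollifierPair.rescale_nonneg (hη : IsMollifierPair η ζ) {t : ℝ} (ht : 0 < t) (x : RN N) :
    0 ≤ rescale η t x :=
  mul_nonneg (by positivity) (hη.ker_nonneg _)

lemma IsMollifierPair.integral_rescale_eq_one (hη : IsMollifierPair η ζ) {t : ℝ} (ht : 0 < t) :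
    ∫ x, rescale η t x = 1 := by
  rw [integral_rescale η ht, hη.integral_ker]

lemma IsMollifierPair.contDiff_mollify (hη : IsMollifierPair η ζ) (hg : LocallyIntegrable g)
    {t : ℝ} (ht : 0 < t) : ContDiff ℝ ∞ (mollify (rescale η t) g) :=
  _root_.contDiff_mollify (contDiff_rescale hη.contDiff_ker t) (hη.hasCompactSupport_rescale ht) hg

lemma MeasureTheory.MemLp.locallyIntegrable_two {F : Type*} [NormedAddCommGroup F] {f : RN N → F}
    (hf : MemLp f 2 volume) : LocallyIntegrable f :=
  hf.locallyIntegrable (by norm_num)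

/-- `g_t(x) - g(x)` is an average of `g(y) - g(x)`, so Jensen's inequality reduces the claim to
`integral_sq_sub_mul_kernel_le`. -/
lemma IsMollifierPair.integral_sq_mollify_sub_le (hη : IsMollifierPair η ζ)
    (hg : MemLp g 2 volume) {t ε : ℝ} (ht : 0 < t)
    (hε : ∀ z : RN N, ‖z‖ ≤ t → ∫ x, (g (x + z) - g x) ^ 2 ≤ ε) :
    MemLp (fun x => mollify (rescale η t) g x - g x) 2 volume ∧
      ∫ x, (mollify (rescale η t) g x - g x) ^ 2 ≤ ε := by
  have hw := hη.integrable_rescale ht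
  obtain ⟨hI, hle⟩ := integral_sq_sub_mul_kernel_le hg hw (hη.rescale_nonneg ht)
    (t := t) (fun z hz => rescale_eq_zero hη.ker_eq_zero ht hz.le) hε
  rw [hη.integral_rescale_eq_one ht, mul_one] at hle
  have hgl := MemLp.locallyIntegrable_two hg
  have hb : ∀ᵐ x, (mollify (rescale η t) g x - g x) ^ 2
      ≤ ∫ y, (g x - g y) ^ 2 * rescale η t (x - y) := by
    filter_upwards [hI.prod_right_ae] with x hx
    have i1 : Integrable fun y => rescale η t (x - y) := hw.comp_sub_left x
    have i2 : Integrable fun y => g y * rescale η t (x - y) :=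
      integrable_mul_sub (contDiff_rescale hη.contDiff_ker t).continuous
        (hη.hasCompactSupport_rescale ht) hgl x
    have w1 : ∫ y, rescale η t (x - y) = 1 := by
      rw [integral_sub_left_eq_self (fun y => rescale η t y), hη.integral_rescale_eq_one ht]
    have i3 : Integrable fun y => (g x - g y) * rescale η t (x - y) := by
      refine ((i1.const_mul (g x)).sub i2).congr (Eventually.of_forall fun y => ?_)
      simp; ring
    have e : ∫ y, (g x - g y) * rescale η t (x - y) = g x - mollify (rescale η t) g x := by
      have : ∀ y, (g x - g y) * rescale η t (x - y)
          = g x * rescale η t (x - y) - g y * rescale η t (x - y) := fun y => by ring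
      simp_rw [this]
      rw [integral_sub (i1.const_mul _) i2, integral_const_mul, w1, mul_one]
      rfl
    have := sq_integral_mul_le (fun y => hη.rescale_nonneg ht (x - y)) i1 w1 i3 hx
    rw [e] at this
    linarith [sub_sq_comm (mollify (rescale η t) g x) (g x)]
  have hmeas : AEStronglyMeasurable (fun x => mollify (rescale η t) g x - g x) volume :=
    (hη.contDiff_mollify hgl ht).continuous.aestronglyMeasurable.sub hg.aestronglyMeasurable
  have hint := hI.integral_prod_left
  have hsq : Integrable (fun x => (mollify (rescale η t) g x - g x) ^ 2) := by
    refine hint.mono' (hmeas.pow 2) ?_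
    filter_upwards [hb] with x hx
    rw [Real.norm_of_nonneg (sq_nonneg _)]
    exact hx
  refine ⟨(memLp_two_iff_integrable_sq hmeas).2 hsq, ?_⟩
  refine le_trans (integral_mono_ae hsq hint hb) ?_
  rw [integral_prod _ hI] at hle
  exact hle

lemma IsMollifierPair.tendsto_integral_sq_mollify_sub (hη : IsMollifierPair η ζ)
    (hg : MemLp g 2 volume) :
    Tendsto (fun t => ∫ x, (mollify (rescale η t) g x - g x) ^ 2) (𝓝[>] 0) (𝓝 0) := by
  rw [Metric.tendsto_nhds]
  intro ε hε
  obtain ⟨δ, hδ, h⟩ := exists_integral_sq_translate_sub_le hg (half_pos hε)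
  filter_upwards [Ioc_mem_nhdsGT hδ] with t ht
  rw [dist_zero_right, Real.norm_of_nonneg (integral_nonneg fun x => sq_nonneg _)]
  have := (hη.integral_sq_mollify_sub_le hg ht.1 fun z hz => h z (hz.trans ht.2)).2
  linarith

/-- A bound valid for all `z`, so that the previous estimate also gives `g_t ∈ L²` for every `t`,
small or not. -/
lemma integral_sq_translate_sub_le_four (hg : MemLp g 2 volume) (z : RN N) :
    ∫ x, (g (x + z) - g x) ^ 2 ≤ 4 * ∫ x, g x ^ 2 := by
  have h1 : MemLp (fun x => g (x + z)) 2 volume :=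
    hg.comp_measurePreserving (measurePreserving_add_right volume z)
  calc _ ≤ ∫ x, (2 * g (x + z) ^ 2 + 2 * g x ^ 2) :=
        integral_mono (h1.sub hg).integrable_sq
          ((h1.integrable_sq.const_mul 2).add (hg.integrable_sq.const_mul 2))
          fun x => by simp only [Pi.sub_apply]; nlinarith [sq_nonneg (g (x + z) + g x)]
    _ = _ := by
        rw [integral_add (h1.integrable_sq.const_mul 2) (hg.integrable_sq.const_mul 2),
          integral_const_mul, integral_const_mul, integral_add_right_eq_self (fun x => g x ^ 2)]
        ring

lemma IsMollifierPair.memLp_mollify (hη : IsMollifierPair η ζ) (hg : MemLp g 2 volume) {t : ℝ}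
    (ht : 0 < t) : MemLp (mollify (rescale η t) g) 2 volume := by
  have := (hη.integral_sq_mollify_sub_le hg ht
    fun z _ => integral_sq_translate_sub_le_four hg z).1.add hg
  simpa [Pi.add_def] using this

end Mollify

/-! ### The Friedrichs commutator. -/

section Mollify

variable {N : ℕ} {η ζ g : RN N → ℝ}

lemma rescale_neg {η : RN N → ℝ} (h : ∀ x, η (-x) = η x) (t : ℝ) (x : RN N) :
    rescale η t (-x) = rescale η t x := by
  simp [rescale, h]

lemma fderiv_neg_of_even {f : RN N → ℝ} (hf : Differentiable ℝ f) (h : ∀ x, f (-x) = f x)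
    (x : RN N) : fderiv ℝ f (-x) = - fderiv ℝ f x := by
  have h1 : (fun y => f (-y)) = f := funext h
  have h2 : HasFDerivAt (fun y : RN N => -y) (-ContinuousLinearMap.id ℝ (RN N)) x :=
    (hasFDerivAt_id x).neg
  have h3 := ((hf (-x)).hasFDerivAt.comp x h2).fderiv
  simp only [Function.comp_def, h1] at h3
  rw [h3]
  simp

lemma fderiv_rescale_eq {η : RN N → ℝ} (h : Differentiable ℝ η) (t : ℝ) (x : RN N) :
    fderiv ℝ (rescale η t) x = ((t ^ N)⁻¹ * t⁻¹) • fderiv ℝ η (t⁻¹ • x) := by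
  ext v
  rw [fderiv_rescale h]
  simp [mul_assoc]

/-- The factor `‖x‖` offsets the `t⁻¹` lost in the derivative, so the integral of this function does
not depend on `t`. -/
lemma norm_mul_norm_fderiv_rescale {η : RN N → ℝ} (h : Differentiable ℝ η) {t : ℝ} (ht : 0 < t)
    (x : RN N) : ‖x‖ * ‖fderiv ℝ (rescale η t) x‖
      = rescale (fun z => ‖z‖ * ‖fderiv ℝ η z‖) t x := by
  rw [fderiv_rescale_eq h, norm_smul, rescale, norm_smul, Real.norm_of_nonneg (by positivity),
    Real.norm_of_nonneg (by positivity)]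
  ring

lemma fderiv_eq_zero_of_norm_gt {f : RN N → ℝ} {t : ℝ} (h : ∀ x, t ≤ ‖x‖ → f x = 0) {x : RN N}
    (hx : t < ‖x‖) : fderiv ℝ f x = 0 := by
  have : f =ᶠ[𝓝 x] fun _ => 0 := by
    filter_upwards [(isOpen_lt continuous_const continuous_norm).mem_nhds hx] with y hy
    exact h y (le_of_lt hy)
  rw [this.fderiv_eq]
  simp

lemma exists_bound_of_hasCompactSupport {F : Type*} [NormedAddCommGroup F] {f : RN N → F}
    (hf : Continuous f) (hc : HasCompactSupport f) : ∃ C, 0 ≤ C ∧ ∀ x, ‖f x‖ ≤ C := by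
  obtain ⟨C, hC⟩ := hf.bounded_above_of_compact_support hc
  exact ⟨C, (norm_nonneg _).trans (hC 0), hC⟩

lemma exists_lipschitz_bound {X : RN N → RN N} (hX : ContDiff ℝ 1 X) (hc : HasCompactSupport X) :
    ∃ L : ℝ, 0 ≤ L ∧ ∀ x y, ‖X x - X y‖ ≤ L * ‖x - y‖ := by
  obtain ⟨L, hL⟩ := hX.lipschitzWith_of_hasCompactSupport hc one_ne_zero
  exact ⟨L, L.2, fun x y => by simpa [dist_eq_norm] using hL.dist_le_mul x y⟩

/-- The commutator kernel integrates to minus the mollified divergence. -/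
lemma integral_fderiv_kernel_sub {κ : RN N → ℝ} {X : RN N → RN N} (hκ : ContDiff ℝ 1 κ)
    (hκc : HasCompactSupport κ) (hX : ContDiff ℝ 1 X) (x : RN N) :
    ∫ y, fderiv ℝ κ (x - y) (X x - X y) = - mollify κ (divergence X) x := by
  set a : RN N → ℝ := fun y => κ (x - y) with ha
  set Z : RN N → RN N := fun y => X x - X y with hZ
  have hac : ContDiff ℝ 1 a := hκ.comp (contDiff_const.sub contDiff_id)
  have hZc : ContDiff ℝ 1 Z := contDiff_const.sub hX
  have hacs : HasCompactSupport a := hκc.comp_homeomorph (Homeomorph.subLeft x)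
  -- Divergence theorem in `y` for the field `κ(x - y)(X(x) - X(y))`.
  have h0 : ∫ y, divergence (fun y => a y • Z y) y = 0 :=
    integral_divergence_eq_zero (hac.smul hZc) hacs.smul_right
  have hd : ∀ y, divergence (fun y => a y • Z y) y
      = - fderiv ℝ κ (x - y) (X x - X y) - divergence X y * κ (x - y) := by
    intro y
    rw [divergence_smul (hac.differentiable one_ne_zero y) (hZc.differentiable one_ne_zero y)]
    have e1 : fderiv ℝ a y (Z y) = - fderiv ℝ κ (x - y) (X x - X y) := by
      have h1 : HasFDerivAt (fun y => x - y) (-ContinuousLinearMap.id ℝ (RN N)) y := by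
        simpa using (hasFDerivAt_id y).const_sub x
      have := (((hκ.differentiable one_ne_zero) (x - y)).hasFDerivAt.comp y h1).fderiv
      have h2 : fderiv ℝ a y = _ := this
      rw [h2]; simp [hZ]
    have e2 : divergence Z y = - divergence X y := by
      have : fderiv ℝ Z y = - fderiv ℝ X y := by
        rw [hZ, fderiv_const_sub]
      simp [divergence, this]
    rw [e1, e2, ha]
    ring
  simp_rw [hd] at h0
  have i2 : Integrable fun y => divergence X y * κ (x - y) :=
    integrable_mul_sub hκ.continuous hκc (continuous_divergence hX).locallyIntegrable x
  have i1 : Integrable fun y => fderiv ℝ κ (x - y) (X x - X y) := by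
    refine Continuous.integrable_of_hasCompactSupport ?_ ?_
    · exact ((hκ.continuous_fderiv one_ne_zero).comp (continuous_const.sub continuous_id)).clm_apply
        (continuous_const.sub hX.continuous)
    · have h3 : HasCompactSupport fun y => fderiv ℝ κ (x - y) :=
        (hκc.fderiv ℝ).comp_homeomorph (Homeomorph.subLeft x)
      refine h3.mono fun y hy => ?_
      contrapose! hy
      simp only [Function.mem_support, not_not] at hy ⊢
      simp [hy]
  have i3 : Integrable fun y => -fderiv ℝ κ (x - y) (X x - X y) := i1.neg
  rw [integral_sub i3 i2, integral_neg] at h0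
  have : mollify κ (divergence X) x = ∫ y, divergence X y * κ (x - y) := rfl
  rw [this]
  linarith

lemma IsMollifierPair.tendsto_mollify_of_continuous (hη : IsMollifierPair η ζ) {f : RN N → ℝ}
    (hf : Continuous f) (x : RN N) :
    Tendsto (fun t => mollify (rescale η t) f x) (𝓝[>] 0) (𝓝 (f x)) := by
  have hfl : LocallyIntegrable f := hf.locallyIntegrable
  rw [Metric.tendsto_nhds]
  intro ε hε
  obtain ⟨δ, hδ, h⟩ := Metric.continuous_iff.1 hf x (ε / 2) (half_pos hε)
  filter_upwards [Ioo_mem_nhdsGT hδ] with t ht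
  have hw := hη.integrable_rescale ht.1
  have i1 : Integrable fun y => rescale η t (x - y) := hw.comp_sub_left x
  have i2 : Integrable fun y => f y * rescale η t (x - y) :=
      integrable_mul_sub (contDiff_rescale hη.contDiff_ker t).continuous
        (hη.hasCompactSupport_rescale ht.1) hfl x
  have w1 : ∫ y, rescale η t (x - y) = 1 := by
    rw [integral_sub_left_eq_self (fun y => rescale η t y), hη.integral_rescale_eq_one ht.1]
  have e : mollify (rescale η t) f x - f x = ∫ y, (f y - f x) * rescale η t (x - y) := by
    have : ∀ y, (f y - f x) * rescale η t (x - y)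
        = f y * rescale η t (x - y) - f x * rescale η t (x - y) := fun y => by ring
    simp_rw [this]
    rw [integral_sub i2 (i1.const_mul _), integral_const_mul, w1, mul_one]
    rfl
  rw [Real.dist_eq, e]
  refine lt_of_le_of_lt (b := ε / 2) ?_ (by linarith)
  rw [← Real.norm_eq_abs]
  calc ‖∫ y, (f y - f x) * rescale η t (x - y)‖ ≤ ∫ y, ε / 2 * rescale η t (x - y) := by
        refine norm_integral_le_of_norm_le (i1.const_mul _) (Eventually.of_forall fun y => ?_)
        rw [norm_mul, Real.norm_of_nonneg (hη.rescale_nonneg ht.1 _)]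
        by_cases hy : t ≤ ‖x - y‖
        · simp [rescale_eq_zero hη.ker_eq_zero ht.1 hy]
        · refine mul_le_mul_of_nonneg_right ?_ (hη.rescale_nonneg ht.1 _)
          rw [← dist_eq_norm]
          refine (h y ?_).le
          rw [dist_comm, dist_eq_norm]
          exact (not_le.1 hy).trans ht.2
    _ = ε / 2 := by rw [integral_const_mul, w1, mul_one]

lemma IsMollifierPair.abs_mollify_le (hη : IsMollifierPair η ζ) {f : RN N → ℝ} {C : ℝ}
    (hC : ∀ x, |f x| ≤ C) {t : ℝ} (ht : 0 < t) (x : RN N) :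
    |mollify (rescale η t) f x| ≤ C := by
  have hw := hη.integrable_rescale ht
  have i1 : Integrable fun y => rescale η t (x - y) := hw.comp_sub_left x
  have w1 : ∫ y, rescale η t (x - y) = 1 := by
    rw [integral_sub_left_eq_self (fun y => rescale η t y), hη.integral_rescale_eq_one ht]
  rw [← Real.norm_eq_abs, mollify]
  calc ‖∫ y, f y * rescale η t (x - y)‖ ≤ ∫ y, C * rescale η t (x - y) := by
        refine norm_integral_le_of_norm_le (i1.const_mul _) (Eventually.of_forall fun y => ?_)
        rw [norm_mul, Real.norm_of_nonneg (hη.rescale_nonneg ht _)]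
        exact mul_le_mul_of_nonneg_right (hC y) (hη.rescale_nonneg ht _)
    _ = C := by rw [integral_const_mul, w1, mul_one]

/-- The quadratic form of `X·∇` against a mollification, symmetrised. -/
lemma IsMollifierPair.integral_mul_fderiv_mollify_eq (hη : IsMollifierPair η ζ)
    (hg : MemLp g 2 volume) {X : RN N → RN N} (hX : ContDiff ℝ 1 X) (hXc : HasCompactSupport X)
    {t : ℝ} (ht : 0 < t) :
    ∫ x, g x * fderiv ℝ (mollify (rescale η t) g) x (X x)
      = -(1 / 2) * (∫ x, g x ^ 2 * mollify (rescale η t) (divergence X) x)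
        - 1 / 4 * ∫ p : RN N × RN N, (g p.1 - g p.2) ^ 2 *
            fderiv ℝ (rescale η t) (p.1 - p.2) (X p.1 - X p.2) ∂(volume.prod volume) := by
  have hgl := MemLp.locallyIntegrable_two hg
  set κ := rescale η t with hκ
  have cκ : ContDiff ℝ ∞ κ := contDiff_rescale hη.contDiff_ker t
  have cκ1 : ContDiff ℝ 1 κ := cκ.of_le (by exact_mod_cast le_top)
  have hκc : HasCompactSupport κ := hη.hasCompactSupport_rescale ht
  have cd : Continuous (fderiv ℝ κ) := cκ1.continuous_fderiv one_ne_zero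
  obtain ⟨B, hB0, hB⟩ := exists_bound_of_hasCompactSupport hX.continuous hXc
  have ik : Integrable fun z => ‖fderiv ℝ κ z‖ :=
    (cd.integrable_of_hasCompactSupport (hκc.fderiv ℝ)).norm
  have mk : ∀ V : RN N × RN N → RN N, Continuous V → AEStronglyMeasurable
      (fun p : RN N × RN N => fderiv ℝ κ (p.1 - p.2) (V p)) (volume.prod volume) := fun V hV =>
    ((cd.comp (continuous_fst.sub continuous_snd)).clm_apply hV).aestronglyMeasurable
  have mg1 : AEStronglyMeasurable (fun p : RN N × RN N => g p.1) (volume.prod volume) :=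
    hg.aestronglyMeasurable.comp_fst
  have mg2 : AEStronglyMeasurable (fun p : RN N × RN N => g p.2) (volume.prod volume) :=
    hg.aestronglyMeasurable.comp_snd
  have cX1 : Continuous fun p : RN N × RN N => X p.1 := hX.continuous.comp continuous_fst
  have cX2 : Continuous fun p : RN N × RN N => X p.2 := hX.continuous.comp continuous_snd
  have bd : ∀ (p : RN N × RN N) (v : RN N) (C : ℝ), ‖v‖ ≤ C →
      |fderiv ℝ κ (p.1 - p.2) v| ≤ C * ‖fderiv ℝ κ (p.1 - p.2)‖ := fun p v C hv => by
    rw [mul_comm C]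
    exact (ContinuousLinearMap.le_opNorm (fderiv ℝ κ (p.1 - p.2)) v).trans
      (mul_le_mul_of_nonneg_left hv (norm_nonneg _))
  have bX : ∀ x y, ‖X x - X y‖ ≤ 2 * B := fun x y => (norm_sub_le _ _).trans (by linarith [hB x, hB y])
  have b1 : ∀ p : RN N × RN N, |g p.1 * g p.2| ≤ g p.1 ^ 2 + g p.2 ^ 2 := fun p => by
    rw [abs_le]; constructor <;> nlinarith [sq_nonneg (g p.1 + g p.2), sq_nonneg (g p.1 - g p.2)]
  -- integrability of the kernels
  have I1 : Integrable (fun p : RN N × RN N => g p.1 * g p.2 * fderiv ℝ κ (p.1 - p.2) (X p.1))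
      (volume.prod volume) := by
    refine integrable_of_le_sq_kernel hg (ik.const_mul B) ((mg1.mul mg2).mul (mk _ cX1)) fun p => ?_
    rw [abs_mul]
    exact mul_le_mul (b1 p) (bd p _ B (hB _)) (abs_nonneg _) (by positivity)
  have I2 : Integrable (fun p : RN N × RN N => g p.1 ^ 2 * fderiv ℝ κ (p.1 - p.2) (X p.1 - X p.2))
      (volume.prod volume) := by
    refine integrable_of_le_sq_kernel hg (ik.const_mul (2 * B))
      ((mg1.pow 2).mul (mk _ (cX1.sub cX2))) fun p => ?_
    rw [abs_mul, abs_of_nonneg (sq_nonneg (g p.1))]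
    exact mul_le_mul (by nlinarith [sq_nonneg (g p.2)]) (bd p _ _ (bX _ _)) (abs_nonneg _)
      (by positivity)
  have odd : ∀ x y v, fderiv ℝ κ (y - x) v = - fderiv ℝ κ (x - y) v := fun x y v => by
    rw [← neg_sub, fderiv_neg_of_even (cκ1.differentiable one_ne_zero) (rescale_neg hη.ker_neg t)]; rfl
  have I3 : Integrable (fun p : RN N × RN N => g p.2 ^ 2 * fderiv ℝ κ (p.1 - p.2) (X p.1 - X p.2))
      (volume.prod volume) := by
    refine I2.swap.congr (Eventually.of_forall fun p => ?_)
    simp only [Function.comp_apply, Prod.fst_swap, Prod.snd_swap]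
    rw [odd, ← neg_sub (X p.1), map_neg, neg_neg]
  have S2 : ∫ p : RN N × RN N, g p.2 ^ 2 * fderiv ℝ κ (p.1 - p.2) (X p.1 - X p.2)
        ∂(volume.prod volume)
      = ∫ p : RN N × RN N, g p.1 ^ 2 * fderiv ℝ κ (p.1 - p.2) (X p.1 - X p.2)
        ∂(volume.prod volume) := by
    rw [← integral_prod_swap]
    refine integral_congr_ae (Eventually.of_forall fun p => ?_)
    simp only [Prod.fst_swap, Prod.snd_swap]
    rw [odd, ← neg_sub (X p.1), map_neg, neg_neg]
  -- Exchanging the variables and using that `∇κ` is odd trades `X(x)` for `-X(y)`; averaging the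
  -- two forms brings in the difference `X(x) - X(y)`.
  have S1 : ∫ p : RN N × RN N, g p.1 * g p.2 * fderiv ℝ κ (p.1 - p.2) (X p.1) ∂(volume.prod volume)
      = ∫ p : RN N × RN N, -(g p.1 * g p.2 * fderiv ℝ κ (p.1 - p.2) (X p.2))
        ∂(volume.prod volume) := by
    rw [← integral_prod_swap]
    refine integral_congr_ae (Eventually.of_forall fun p => ?_)
    simp only [Prod.fst_swap, Prod.snd_swap]
    rw [odd]; ring
  have I1' : Integrable (fun p : RN N × RN N => -(g p.1 * g p.2 * fderiv ℝ κ (p.1 - p.2) (X p.2)))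
      (volume.prod volume) := by
    refine I1.swap.congr (Eventually.of_forall fun p => ?_)
    simp only [Function.comp_apply, Prod.fst_swap, Prod.snd_swap]
    rw [odd]; ring
  have I4 : Integrable (fun p : RN N × RN N => (g p.1 - g p.2) ^ 2 *
      fderiv ℝ κ (p.1 - p.2) (X p.1 - X p.2)) (volume.prod volume) := by
    refine ((I2.add I3).sub ((I1.add I1').const_mul 2)).congr (Eventually.of_forall fun p => ?_)
    simp only [Pi.add_apply, Pi.sub_apply, map_sub]
    ring
  have A : ∫ x, g x * fderiv ℝ (mollify κ g) x (X x)
      = ∫ p : RN N × RN N, g p.1 * g p.2 * fderiv ℝ κ (p.1 - p.2) (X p.1) ∂(volume.prod volume) := by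
    rw [integral_prod _ I1]
    refine integral_congr_ae (Eventually.of_forall fun x => ?_)
    simp only
    rw [fderiv_mollify cκ1 hκc hgl, mollify, ← integral_const_mul]
    simp_rw [mul_assoc]
  have Bq : ∫ p : RN N × RN N, g p.1 ^ 2 * fderiv ℝ κ (p.1 - p.2) (X p.1 - X p.2)
      ∂(volume.prod volume) = - ∫ x, g x ^ 2 * mollify κ (divergence X) x := by
    rw [integral_prod _ I2, ← integral_neg]
    refine integral_congr_ae (Eventually.of_forall fun x => ?_)
    simp only
    rw [integral_const_mul, integral_fderiv_kernel_sub cκ1 hκc hX]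
    ring
  -- Polarisation: `2 g(x)g(y) = g(x)² + g(y)² - (g(x) - g(y))²`. The squares reproduce `div X`; the
  -- last term is the commutator error.
  have E : ∫ p : RN N × RN N, (g p.1 - g p.2) ^ 2 *
        fderiv ℝ κ (p.1 - p.2) (X p.1 - X p.2) ∂(volume.prod volume)
      = ∫ p : RN N × RN N, (((g p.1 ^ 2 * fderiv ℝ κ (p.1 - p.2) (X p.1 - X p.2))
        + (g p.2 ^ 2 * fderiv ℝ κ (p.1 - p.2) (X p.1 - X p.2)))
        - 2 * ((g p.1 * g p.2 * fderiv ℝ κ (p.1 - p.2) (X p.1))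
        + -(g p.1 * g p.2 * fderiv ℝ κ (p.1 - p.2) (X p.2)))) ∂(volume.prod volume) := by
    refine integral_congr_ae (Eventually.of_forall fun p => ?_)
    simp only [map_sub]
    ring
  have I23 : Integrable (fun p : RN N × RN N => (g p.1 ^ 2 * fderiv ℝ κ (p.1 - p.2) (X p.1 - X p.2))
        + (g p.2 ^ 2 * fderiv ℝ κ (p.1 - p.2) (X p.1 - X p.2))) (volume.prod volume) := I2.add I3
  have I11 : Integrable (fun p : RN N × RN N => 2 * ((g p.1 * g p.2 * fderiv ℝ κ (p.1 - p.2) (X p.1))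
        + -(g p.1 * g p.2 * fderiv ℝ κ (p.1 - p.2) (X p.2)))) (volume.prod volume) :=
    (I1.add I1').const_mul 2
  rw [integral_sub I23 I11, integral_add I2 I3, integral_const_mul, integral_add I1 I1', S2, ← S1, Bq]
    at E
  rw [A]
  linarith

/-- The commutator error is at most `L ∬ (g(x) - g(y))² |z||∇η_t(z)|` with `z = x - y` and `L` a
Lipschitz constant of `X`. That kernel has mass independent of `t` and vanishes for `‖z‖ > t`, so
the L² modulus of continuity of `g` sends the error to zero. -/
lemma IsMollifierPair.tendsto_integral_mul_fderiv_mollify (hη : IsMollifierPair η ζ)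
    (hg : MemLp g 2 volume) {X : RN N → RN N} (hX : ContDiff ℝ 1 X) (hXc : HasCompactSupport X) :
    Tendsto (fun t => ∫ x, g x * fderiv ℝ (mollify (rescale η t) g) x (X x)) (𝓝[>] 0)
      (𝓝 (-(1 / 2) * ∫ x, divergence X x * g x ^ 2)) := by
  have cdiv := continuous_divergence hX
  obtain ⟨D, hD0, hD⟩ := exists_bound_of_hasCompactSupport cdiv (hasCompactSupport_divergence hXc)
  obtain ⟨L, hL0, hL⟩ := exists_lipschitz_bound hX hXc
  have dη : Differentiable ℝ η := hη.contDiff_ker.differentiable (by simp)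
  -- first term
  have T1 : Tendsto (fun t => ∫ x, g x ^ 2 * mollify (rescale η t) (divergence X) x) (𝓝[>] 0)
      (𝓝 (∫ x, g x ^ 2 * divergence X x)) := by
    refine tendsto_integral_filter_of_dominated_convergence (fun x => g x ^ 2 * D) ?_ ?_
      (hg.integrable_sq.mul_const D) ?_
    · filter_upwards [self_mem_nhdsWithin] with t ht
      exact (hg.aestronglyMeasurable.pow 2).mul
        (hη.contDiff_mollify cdiv.locallyIntegrable ht).continuous.aestronglyMeasurable
    · filter_upwards [self_mem_nhdsWithin] with t ht
      refine Eventually.of_forall fun x => ?_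
      rw [norm_mul, Real.norm_of_nonneg (sq_nonneg _)]
      exact mul_le_mul_of_nonneg_left (hη.abs_mollify_le hD ht x) (sq_nonneg _)
    · exact Eventually.of_forall fun x => (hη.tendsto_mollify_of_continuous cdiv x).const_mul _
  -- second term
  set κ₁ : RN N → ℝ := fun z => ‖z‖ * ‖fderiv ℝ η z‖ with hκ₁
  have T2 : Tendsto (fun t => ∫ p : RN N × RN N, (g p.1 - g p.2) ^ 2 *
            fderiv ℝ (rescale η t) (p.1 - p.2) (X p.1 - X p.2) ∂(volume.prod volume)) (𝓝[>] 0)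
      (𝓝 0) := by
    set M := ∫ z, κ₁ z with hM
    have hM0 : 0 ≤ M := integral_nonneg fun z => by positivity
    rw [Metric.tendsto_nhds]
    intro ε hε
    have hden : 0 < L * M + 1 := by positivity
    -- The `+ 1` in the denominator covers the case `L * M = 0`.
    obtain ⟨δ, hδ, h⟩ := exists_integral_sq_translate_sub_le hg
      (show 0 < ε / (2 * (L * M + 1)) by positivity)
    filter_upwards [Ioc_mem_nhdsGT hδ] with t ht
    have cκ : ContDiff ℝ ∞ (rescale η t) := contDiff_rescale hη.contDiff_ker t
    have cd : Continuous (fderiv ℝ (rescale η t)) := cκ.continuous_fderiv (by simp)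
    have hκc : HasCompactSupport (rescale η t) := hη.hasCompactSupport_rescale ht.1
    have ik : Integrable fun z => L * (‖z‖ * ‖fderiv ℝ (rescale η t) z‖) := by
      refine (Continuous.integrable_of_hasCompactSupport (continuous_norm.mul cd.norm) ?_).const_mul L
      exact (hκc.fderiv ℝ).norm.mul_left
    have hk : ∫ z, L * (‖z‖ * ‖fderiv ℝ (rescale η t) z‖) = L * M := by
      simp_rw [norm_mul_norm_fderiv_rescale dη ht.1]
      rw [integral_const_mul, integral_rescale _ ht.1]
    obtain ⟨hI, hle⟩ := integral_sq_sub_mul_kernel_le hg ik (fun z => by positivity) (t := t)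
      (fun z hz => by
        rw [fderiv_eq_zero_of_norm_gt (fun x => rescale_eq_zero hη.ker_eq_zero ht.1) hz]; simp)
      (fun z hz => h z (hz.trans ht.2))
    rw [hk] at hle
    rw [dist_zero_right]
    refine lt_of_le_of_lt ((norm_integral_le_of_norm_le hI (Eventually.of_forall fun p => ?_)).trans
      hle) ?_
    · rw [norm_mul, Real.norm_of_nonneg (sq_nonneg _)]
      refine mul_le_mul_of_nonneg_left ?_ (sq_nonneg _)
      refine (ContinuousLinearMap.le_opNorm _ _).trans ?_
      rw [← mul_assoc, mul_comm]
      exact mul_le_mul_of_nonneg_right (hL _ _) (norm_nonneg _)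
    · rw [div_mul_eq_mul_div, div_lt_iff₀ (by positivity)]
      nlinarith [mul_nonneg hL0 hM0]
  have := (T1.const_mul (-(1 / 2) : ℝ)).sub (T2.const_mul (1 / 4 : ℝ))
  rw [mul_zero, sub_zero] at this
  simp_rw [mul_comm (divergence X _)]
  refine this.congr' ?_
  filter_upwards [self_mem_nhdsWithin] with t ht
  exact (hη.integral_mul_fderiv_mollify_eq hg hX hXc ht).symm

end Mollify

/-! ### Passing to the limit in products of L² functions. -/

section L2

variable {X : Type*} [MeasurableSpace X] {μ : Measure X} {a b : X → ℝ}

lemma MeasureTheory.MemLp.abs_integral_mul_le (ha : MemLp a 2 μ) (hb : MemLp b 2 μ) :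
    |∫ x, a x * b x ∂μ| ≤ √(∫ x, a x ^ 2 ∂μ) * √(∫ x, b x ^ 2 ∂μ) := by
  have h : ∫ x, a x * b x ∂μ = inner ℝ (ha.toLp a) (hb.toLp b) := by
    rw [L2.inner_def]
    refine integral_congr_ae ?_
    filter_upwards [ha.coeFn_toLp, hb.coeFn_toLp] with x h1 h2
    simp [h1, h2, mul_comm]
  rw [h, MemLp.integral_sq_eq_norm_toLp ha, MemLp.integral_sq_eq_norm_toLp hb,
    Real.sqrt_sq (norm_nonneg _), Real.sqrt_sq (norm_nonneg _)]
  exact abs_real_inner_le_norm _ _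

lemma MeasureTheory.MemLp.integrable_mul_two (ha : MemLp a 2 μ) (hb : MemLp b 2 μ) :
    Integrable (fun x => a x * b x) μ :=
  ha.integrable_mul hb

lemma MeasureTheory.MemLp.tendsto_integral_mul {ι : Type*} {l : Filter ι} {g : ι → X → ℝ} (ha : MemLp a 2 μ)
    (hb : MemLp b 2 μ) (hg : ∀ᶠ i in l, MemLp (g i) 2 μ)
    (h : Tendsto (fun i => ∫ x, (g i x - b x) ^ 2 ∂μ) l (𝓝 0)) :
    Tendsto (fun i => ∫ x, a x * g i x ∂μ) l (𝓝 (∫ x, a x * b x ∂μ)) := by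
  rw [tendsto_iff_norm_sub_tendsto_zero]
  have h1 : Tendsto (fun i => √(∫ x, a x ^ 2 ∂μ) * √(∫ x, (g i x - b x) ^ 2 ∂μ)) l (𝓝 0) := by
    simpa using (h.sqrt).const_mul (√(∫ x, a x ^ 2 ∂μ))
  refine squeeze_zero' (Eventually.of_forall fun _ => norm_nonneg _) ?_ h1
  filter_upwards [hg] with i hi
  rw [← integral_sub (ha.integrable_mul_two hi) (ha.integrable_mul_two hb)]
  simp_rw [← mul_sub]
  exact ha.abs_integral_mul_le (hi.sub hb)

/-- Split `c g = c b + c (g - b)`: the first part converges by domination, the second vanishes by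
Cauchy–Schwarz because `c` is bounded by `A` in L². -/
lemma MeasureTheory.MemLp.tendsto_integral_mul_of_dominated {g c : ℕ → X → ℝ} {A d : X → ℝ}
    (hA : MemLp A 2 μ) (hb : MemLp b 2 μ) (hg : ∀ i, MemLp (g i) 2 μ)
    (hc : ∀ i, AEStronglyMeasurable (c i) μ) (hcA : ∀ i, ∀ᵐ x ∂μ, |c i x| ≤ A x)
    (hcd : ∀ᵐ x ∂μ, Tendsto (fun i => c i x) atTop (𝓝 (d x)))
    (h : Tendsto (fun i => ∫ x, (g i x - b x) ^ 2 ∂μ) atTop (𝓝 0)) :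
    Tendsto (fun i => ∫ x, c i x * g i x ∂μ) atTop (𝓝 (∫ x, d x * b x ∂μ)) := by
  have hc2 : ∀ i, MemLp (c i) 2 μ := fun i => hA.mono (hc i) <| by
    filter_upwards [hcA i] with x hx
    exact hx.trans (le_abs_self _)
  have T1 : Tendsto (fun i => ∫ x, c i x * b x ∂μ) atTop (𝓝 (∫ x, d x * b x ∂μ)) := by
    refine tendsto_integral_of_dominated_convergence (fun x => A x * |b x|)
      (fun i => (hc i).mul hb.aestronglyMeasurable) (hA.integrable_mul_two hb.abs) (fun i => ?_) ?_
    · filter_upwards [hcA i] with x hx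
      rw [norm_mul]
      exact mul_le_mul_of_nonneg_right hx (abs_nonneg _)
    · filter_upwards [hcd] with x hx using hx.mul_const _
  have T2 : Tendsto (fun i => ∫ x, c i x * (g i x - b x) ∂μ) atTop (𝓝 0) := by
    have h1 : Tendsto (fun i => √(∫ x, A x ^ 2 ∂μ) * √(∫ x, (g i x - b x) ^ 2 ∂μ)) atTop
        (𝓝 0) := by
      simpa using (h.sqrt).const_mul (√(∫ x, A x ^ 2 ∂μ))
    refine squeeze_zero_norm (fun i => ?_) h1
    refine ((hc2 i).abs_integral_mul_le ((hg i).sub hb)).trans ?_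
    refine mul_le_mul_of_nonneg_right (Real.sqrt_le_sqrt ?_) (Real.sqrt_nonneg _)
    refine integral_mono_ae (hc2 i).integrable_sq hA.integrable_sq ?_
    filter_upwards [hcA i] with x hx
    exact sq_le_sq.2 (hx.trans (le_abs_self _))
  have := T1.add T2
  rw [add_zero] at this
  refine this.congr fun i => ?_
  have hs : Integrable (fun x => c i x * (g i x - b x)) μ :=
    (hc2 i).integrable_mul_two ((hg i).sub hb)
  rw [← integral_add ((hc2 i).integrable_mul_two hb) hs]
  refine integral_congr_ae (Eventually.of_forall fun x => ?_)
  simp only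
  ring

lemma exists_seq_tendsto_ae_of_integral_sq {g : ℕ → X → ℝ} (hg : ∀ i, MemLp (g i) 2 μ)
    (hb : MemLp b 2 μ) (h : Tendsto (fun i => ∫ x, (g i x - b x) ^ 2 ∂μ) atTop (𝓝 0)) :
    ∃ ns : ℕ → ℕ, StrictMono ns ∧
      ∀ᵐ x ∂μ, Tendsto (fun i => g (ns i) x) atTop (𝓝 (b x)) := by
  refine TendstoInMeasure.exists_seq_tendsto_ae (tendstoInMeasure_of_tendsto_eLpNorm (p := 2)
    (by simp) (fun i => (hg i).aestronglyMeasurable) hb.aestronglyMeasurable ?_)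
  have e : ∀ i, eLpNorm (g i - b) 2 μ = ENNReal.ofReal √(∫ x, (g i x - b x) ^ 2 ∂μ) := fun i => by
    have := MemLp.integral_sq_eq_norm_toLp ((hg i).sub hb)
    simp only [Pi.sub_apply] at this
    rw [this, Real.sqrt_sq (norm_nonneg _), Lp.norm_toLp,
      ENNReal.ofReal_toReal ((hg i).sub hb).eLpNorm_ne_top]
  simp_rw [e]
  simpa using ENNReal.tendsto_ofReal h.sqrt

end L2

/-! ### Weak gradients, mollified test functions and the stress form. -/

section WeakGradient

variable {N : ℕ} {η ζ u : RN N → ℝ} {D : RN N → RN N}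

lemma gradient_apply (ψ : RN N → ℝ) (x : RN N) (i : Fin N) :
    gradient ψ x i = fderiv ℝ ψ x (stdVec i) := by
  rw [← inner_gradient_left, EuclideanSpace.inner_single_right]
  simp

lemma inner_gradient_right_real (ψ : RN N → ℝ) (x v : RN N) :
    inner ℝ v (gradient ψ x) = fderiv ℝ ψ x v := by
  rw [real_inner_comm, inner_gradient_left]

lemma continuous_gradient {ψ : RN N → ℝ} (h : ContDiff ℝ 1 ψ) : Continuous (gradient ψ) :=
  (InnerProductSpace.toDual ℝ (RN N)).symm.continuous.comp (h.continuous_fderiv one_ne_zero)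

lemma hasCompactSupport_gradient {ψ : RN N → ℝ} (h : HasCompactSupport ψ) :
    HasCompactSupport (gradient ψ) :=
  (h.fderiv ℝ).comp_left (g := (InnerProductSpace.toDual ℝ (RN N)).symm) (by simp)

lemma IsTestFunction.contDiff_one {ψ : RN N → ℝ} (h : IsTestFunction ψ) : ContDiff ℝ 1 ψ :=
  h.1.of_le (by exact_mod_cast le_top)

lemma integral_coord {F : RN N → RN N} (hF : Integrable F) (i : Fin N) :
    (∫ x, F x) i = ∫ x, F x i :=
  ((EuclideanSpace.proj (𝕜 := ℝ) i : RN N →L[ℝ] ℝ).integral_comp_comm hF).symm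

lemma MeasureTheory.LocallyIntegrable.coord {F : RN N → RN N} (hF : LocallyIntegrable F) (i : Fin N) :
    LocallyIntegrable fun x => F x i := fun x => by
  obtain ⟨s, hs, h⟩ := hF x
  exact ⟨s, hs, (EuclideanSpace.proj (𝕜 := ℝ) i : RN N →L[ℝ] ℝ).integrable_comp h⟩

lemma IsWeakGradient.integral_mul_fderiv (h : IsWeakGradient u D) {ψ : RN N → ℝ}
    (hψ : IsTestFunction ψ) (i : Fin N) :
    ∫ x, u x * fderiv ℝ ψ x (stdVec i) = - ∫ x, ψ x * D x i := by
  have h1 := congrArg (fun v : RN N => v i) (h.integral_eq ψ hψ)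
  simp only [PiLp.neg_apply] at h1
  rw [integral_coord, integral_coord] at h1
  · simpa [gradient_apply] using h1
  · exact h.locallyIntegrable_grad.integrable_smul_left_of_hasCompactSupport hψ.1.continuous hψ.2
  · exact h.locallyIntegrable_fun.integrable_smul_right_of_hasCompactSupport
      (continuous_gradient hψ.contDiff_one) (hasCompactSupport_gradient hψ.2)

lemma inner_eq_sum_coord (v w : RN N) : inner ℝ v w = ∑ i, v i * w i := by
  simp [PiLp.inner_apply, mul_comm]

lemma IsWeakGradient.integral_mul_divergence (h : IsWeakGradient u D) {V : RN N → RN N}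
    (hV : ContDiff ℝ ∞ V) (hc : HasCompactSupport V) :
    ∫ x, u x * divergence V x = - ∫ x, inner ℝ (D x) (V x) := by
  have hV1 : ContDiff ℝ 1 V := hV.of_le (by exact_mod_cast le_top)
  have hd := hV1.differentiable one_ne_zero
  have t : ∀ i, IsTestFunction fun x => V x i := fun i =>
    ⟨contDiff_coord hV i, hasCompactSupport_coord hc i⟩
  have e : ∀ i x, fderiv ℝ V x (stdVec i) i = fderiv ℝ (fun y => V y i) x (stdVec i) :=
    fun i x => (fderiv_coord (hd x) i _).symm
  simp_rw [divergence, inner_eq_sum_coord, Finset.mul_sum, e]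
  rw [integral_finsetSum, integral_finsetSum, ← Finset.sum_neg_distrib]
  · refine Finset.sum_congr rfl fun i _ => ?_
    rw [h.integral_mul_fderiv (t i)]
    simp_rw [mul_comm (V _ _)]
  · intro i _
    exact (h.locallyIntegrable_grad.coord i).integrable_smul_right_of_hasCompactSupport
      (t i).1.continuous (t i).2
  · intro i _
    refine h.locallyIntegrable_fun.integrable_smul_right_of_hasCompactSupport
      (((t i).contDiff_one.continuous_fderiv one_ne_zero).clm_apply continuous_const) ?_
    exact ((t i).2.fderiv ℝ).comp_left (g := fun L : RN N →L[ℝ] ℝ => L (stdVec i)) (by simp)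

lemma fderiv_comp_const_sub {κ : RN N → ℝ} (hκ : Differentiable ℝ κ) (x y v : RN N) :
    fderiv ℝ (fun y => κ (x - y)) y v = - fderiv ℝ κ (x - y) v := by
  have h1 : HasFDerivAt (fun y => x - y) (-ContinuousLinearMap.id ℝ (RN N)) y := by
    simpa using (hasFDerivAt_id y).const_sub x
  have h2 : fderiv ℝ (fun y => κ (x - y)) y = _ := ((hκ (x - y)).hasFDerivAt.comp y h1).fderiv
  rw [h2]; simp

lemma isTestFunction_comp_const_sub {κ : RN N → ℝ} (hκ : IsTestFunction κ) (x : RN N) :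
    IsTestFunction fun y => κ (x - y) :=
  ⟨hκ.1.comp (contDiff_const.sub contDiff_id), hκ.2.comp_homeomorph (Homeomorph.subLeft x)⟩

/-- The definition of the weak gradient, tested with `y ↦ κ(x - y)`. -/
lemma IsWeakGradient.fderiv_mollify_stdVec (h : IsWeakGradient u D) {κ : RN N → ℝ}
    (hκ : IsTestFunction κ) (x : RN N) (i : Fin N) :
    fderiv ℝ (mollify κ u) x (stdVec i) = mollify κ (fun y => D y i) x := by
  have h1 := h.integral_mul_fderiv (isTestFunction_comp_const_sub hκ x) i
  simp_rw [fderiv_comp_const_sub (hκ.contDiff_one.differentiable one_ne_zero)] at h1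
  rw [fderiv_mollify hκ.contDiff_one hκ.2 h.locallyIntegrable_fun, mollify, mollify]
  simp_rw [mul_neg, integral_neg, neg_inj] at h1
  rw [h1]
  simp_rw [mul_comm]

lemma IsWeakGradient.fderiv_mollify_apply (h : IsWeakGradient u D) {κ : RN N → ℝ}
    (hκ : IsTestFunction κ) (x v : RN N) :
    fderiv ℝ (mollify κ u) x v = ∑ i, v i * mollify κ (fun y => D y i) x := by
  rw [clm_apply_eq_sum]
  simp [h.fderiv_mollify_stdVec hκ]

lemma isTestFunction_fderiv_apply {w : RN N → ℝ} {X : RN N → RN N} (hw : ContDiff ℝ ∞ w)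
    (hX : ContDiff ℝ ∞ X) (hc : HasCompactSupport X) :
    IsTestFunction fun x => fderiv ℝ w x (X x) := by
  refine ⟨(hw.fderiv_right (m := ∞) (by simp)).clm_apply hX, hc.mono fun x hx => ?_⟩
  contrapose! hx
  simp only [Function.mem_support, not_not] at hx ⊢
  simp [hx]

/-- Differentiating the test function `X·∇u_κ`. -/
lemma IsWeakGradient.fderiv_fderiv_mollify (h : IsWeakGradient u D) {κ : RN N → ℝ}
    (hκ : IsTestFunction κ) {X : RN N → RN N} (hX : ContDiff ℝ ∞ X) (x v : RN N) :
    fderiv ℝ (fun y => fderiv ℝ (mollify κ u) y (X y)) x v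
      = ∑ i, v i * fderiv ℝ (mollify κ fun y => D y i) x (X x)
        + ∑ i, fderiv ℝ X x v i * mollify κ (fun y => D y i) x := by
  set w := mollify κ u with hw
  have cw : ContDiff ℝ ∞ w := _root_.contDiff_mollify hκ.1 hκ.2 h.locallyIntegrable_fun
  have cdw : ContDiff ℝ ∞ (fderiv ℝ w) := cw.fderiv_right (m := ∞) (by simp)
  have d1 : DifferentiableAt ℝ (fderiv ℝ w) x := cdw.differentiable (by simp) x
  have d2 : DifferentiableAt ℝ X x := hX.differentiable (by simp) x
  have d3 : HasFDerivAt (fun y => fderiv ℝ w y (X y)) _ x := d1.hasFDerivAt.clm_apply d2.hasFDerivAt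
  rw [d3.fderiv]
  -- Symmetry of the Hessian moves the derivative along `X` onto the mollified components of `D`,
  -- the form that the commutator lemma requires.
  have sym : fderiv ℝ (fderiv ℝ w) x v (X x) = fderiv ℝ (fderiv ℝ w) x (X x) v :=
    (cw.contDiffAt.isSymmSndFDerivAt (by simpa [minSmoothness_of_isRCLikeNormedField] using
      (show ((2 : ℕ∞) : WithTop ℕ∞) ≤ ((⊤ : ℕ∞) : WithTop ℕ∞) from WithTop.coe_le_coe.2 le_top))) v (X x)
  have e1 : ∀ i, fderiv ℝ (mollify κ fun y => D y i) x (X x)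
      = fderiv ℝ (fderiv ℝ w) x (X x) (stdVec i) := fun i => by
    have : (mollify κ fun y => D y i) = fun z => fderiv ℝ w z (stdVec i) := by
      ext z; exact (h.fderiv_mollify_stdVec hκ z i).symm
    have d4 : HasFDerivAt (fun z => fderiv ℝ w z (stdVec i)) _ x :=
      d1.hasFDerivAt.clm_apply (hasFDerivAt_const (stdVec i) x)
    rw [this, d4.fderiv]
    simp
  simp only [_root_.add_apply, ContinuousLinearMap.comp_apply,
    ContinuousLinearMap.flip_apply]
  rw [sym, clm_apply_eq_sum (fderiv ℝ (fderiv ℝ w) x (X x)) v, h.fderiv_mollify_apply hκ, add_comm]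
  simp_rw [e1]
  simp

/-- The stress form `∫ ⟨D, DX D⟩ - ½ div X |D|²`. -/
noncomputable def stressForm (X D : RN N → RN N) : ℝ :=
  ∫ x, (inner ℝ (D x) (fderiv ℝ X x (D x)) - 1 / 2 * (divergence X x * ‖D x‖ ^ 2))

lemma MeasureTheory.MemLp.coord {q : ENNReal} (hD : MemLp D q volume) (i : Fin N) :
    MemLp (fun x => D x i) q volume :=
  (EuclideanSpace.proj (𝕜 := ℝ) i : RN N →L[ℝ] ℝ).comp_memLp' hD

lemma norm_sq_eq_sum (v : RN N) : ‖v‖ ^ 2 = ∑ i, v i ^ 2 := by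
  rw [EuclideanSpace.norm_sq_eq]; simp

lemma IsMollifierPair.isTestFunction_rescale (hη : IsMollifierPair η ζ) {t : ℝ} (ht : 0 < t) :
    IsTestFunction (rescale η t) :=
  ⟨contDiff_rescale hη.contDiff_ker t, hη.hasCompactSupport_rescale ht⟩

lemma memLp_fderiv_apply_coord {X : RN N → RN N} (hX : ContDiff ℝ 1 X) (hXc : HasCompactSupport X)
    (hD : MemLp D 2 volume) (i : Fin N) : MemLp (fun x => fderiv ℝ X x (D x) i) 2 volume := by
  have cd : Continuous (fderiv ℝ X) := hX.continuous_fderiv one_ne_zero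
  obtain ⟨B, hB0, hB⟩ := exists_bound_of_hasCompactSupport cd (hXc.fderiv ℝ)
  refine MemLp.coord (D := fun x => fderiv ℝ X x (D x)) ?_ i
  refine hD.of_le_mul (c := B) ?_ (Eventually.of_forall fun x => ?_)
  · exact (isBoundedBilinearMap_apply (𝕜 := ℝ) (E := RN N) (F := RN N)).continuous.comp_aestronglyMeasurable
      (cd.aestronglyMeasurable.prodMk hD.aestronglyMeasurable)
  · exact (ContinuousLinearMap.le_opNorm _ _).trans
      (mul_le_mul_of_nonneg_right (hB x) (norm_nonneg _))

/-- Differentiating `X·∇u_t` gives `∑ ∫ D_i X·∇(D_i)_t`, handled by the commutator lemma with `g =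
D_i`, plus `∑ ∫ (DX D)_i (D_i)_t`, which converges by L² convergence of mollifications. Only `D ∈
L²` is needed. -/
lemma IsWeakGradient.tendsto_integral_inner_gradient (h : IsWeakGradient u D)
    (hη : IsMollifierPair η ζ) (hD : MemLp D 2 volume) {X : RN N → RN N} (hX : ContDiff ℝ ∞ X)
    (hXc : HasCompactSupport X) :
    Tendsto (fun t => ∫ x, inner ℝ (D x)
        (gradient (fun y => fderiv ℝ (mollify (rescale η t) u) y (X y)) x)) (𝓝[>] 0)
      (𝓝 (stressForm X D)) := by
  have hX1 : ContDiff ℝ 1 X := hX.of_le (by exact_mod_cast le_top)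
  have cdiv := continuous_divergence hX1
  obtain ⟨B, hB0, hB⟩ := exists_bound_of_hasCompactSupport cdiv (hasCompactSupport_divergence hXc)
  obtain ⟨B', hB0', hB'⟩ := exists_bound_of_hasCompactSupport hX.continuous hXc
  have hDi := fun i => MemLp.coord hD i
  have hDX := fun i => memLp_fderiv_apply_coord hX1 hXc hD i
  have T : Tendsto (fun t =>
      (∑ i, ∫ x, D x i * fderiv ℝ (mollify (rescale η t) fun y => D y i) x (X x)) + ∑ i, ∫ x, fderiv ℝ X x (D x) i * mollify (rescale η t) (fun y => D y i) x) (𝓝[>] 0)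
      (𝓝 (∑ i, (-(1 / 2) * ∫ x, divergence X x * D x i ^ 2)
        + ∑ i, ∫ x, fderiv ℝ X x (D x) i * D x i)) := by
    refine (tendsto_finsetSum _ fun i _ =>
      hη.tendsto_integral_mul_fderiv_mollify (hDi i) hX1 hXc).add
      (tendsto_finsetSum _ fun i _ => (hDX i).tendsto_integral_mul (hDi i) ?_
        (hη.tendsto_integral_sq_mollify_sub (hDi i)))
    filter_upwards [self_mem_nhdsWithin] with t ht using hη.memLp_mollify (hDi i) ht
  have i3 : ∀ i, Integrable fun x => divergence X x * D x i ^ 2 := fun i =>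
    (hDi i).integrable_sq.bdd_mul cdiv.aestronglyMeasurable (Eventually.of_forall hB)
  have e : ∑ i, (-(1 / 2) * ∫ x, divergence X x * D x i ^ 2)
        + ∑ i, ∫ x, fderiv ℝ X x (D x) i * D x i = stressForm X D := by
    rw [stressForm]
    simp_rw [inner_eq_sum_coord, norm_sq_eq_sum, Finset.mul_sum]
    rw [integral_sub, integral_finsetSum, integral_finsetSum]
    · simp_rw [integral_const_mul, neg_mul, Finset.sum_neg_distrib]
      simp_rw [mul_comm (D _ _)]
      ring
    · exact fun i _ => (i3 i).const_mul _
    · exact fun i _ => (hDi i).integrable_mul_two (hDX i)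
    · exact integrable_finsetSum _ fun i _ => (hDi i).integrable_mul_two (hDX i)
    · exact integrable_finsetSum _ fun i _ => (i3 i).const_mul _
  rw [e] at T
  refine T.congr' ?_
  filter_upwards [self_mem_nhdsWithin] with t ht
  have hκ := hη.isTestFunction_rescale ht
  simp_rw [inner_gradient_right_real, h.fderiv_fderiv_mollify hκ hX]
  have i1 : ∀ i, Integrable fun x => D x i * fderiv ℝ (mollify (rescale η t) fun y => D y i) x (X x) :=
    fun i => by
    have c := isTestFunction_fderiv_apply
      (hη.contDiff_mollify (MemLp.locallyIntegrable_two (hDi i)) ht) hX hXc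
    exact (MemLp.locallyIntegrable_two (hDi i)).integrable_smul_right_of_hasCompactSupport
      c.1.continuous c.2
  have i2 : ∀ i, Integrable fun x => fderiv ℝ X x (D x) i * mollify (rescale η t) (fun y => D y i) x :=
    fun i => (hDX i).integrable_mul_two (hη.memLp_mollify (hDi i) ht)
  rw [integral_add (integrable_finsetSum _ fun i _ => i1 i)
    (integrable_finsetSum _ fun i _ => i2 i), integral_finsetSum _ fun i _ => i1 i,
    integral_finsetSum _ fun i _ => i2 i]

end WeakGradient

/-! ### Convergence of integrals under one-sided integrability. -/

section OneSided

variable {X : Type*} [MeasurableSpace X] {μ : Measure X}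

/-- Dominated convergence handles the negative parts; since `∫ v_n` converges, so does `∫ v_n⁺`, and
Fatou's lemma makes `w⁺` integrable. Then `|w|` dominates the whole sequence. -/
lemma integrable_of_tendsto_of_neg_part {w : X → ℝ} {v : ℕ → X → ℝ} {L : ℝ}
    (hw : AEStronglyMeasurable w μ) (hv : ∀ n, Integrable (v n) μ)
    (hpos : ∀ n, ∀ᵐ x ∂μ, max (v n x) 0 ≤ max (w x) 0)
    (hneg : ∀ n, ∀ᵐ x ∂μ, max (-v n x) 0 ≤ max (-w x) 0)
    (hlim : ∀ᵐ x ∂μ, Tendsto (fun n => v n x) atTop (𝓝 (w x)))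
    (hL : Tendsto (fun n => ∫ x, v n x ∂μ) atTop (𝓝 L))
    (h : Integrable (fun x => max (-w x) 0) μ) : Integrable w μ ∧ ∫ x, w x ∂μ = L := by
  have hv1 : ∀ n, Integrable (fun x => max (v n x) 0) μ := fun n => (hv n).pos_part
  have hv2 : ∀ n, Integrable (fun x => max (-v n x) 0) μ := fun n => (hv n).neg.pos_part
  have T : Tendsto (fun n => ∫ x, max (-v n x) 0 ∂μ) atTop (𝓝 (∫ x, max (-w x) 0 ∂μ)) := by
    refine tendsto_integral_of_dominated_convergence _ (fun n => (hv2 n).aestronglyMeasurable) h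
      (fun n => ?_) ?_
    · filter_upwards [hneg n] with x hx
      rwa [Real.norm_of_nonneg (le_max_right _ _)]
    · filter_upwards [hlim] with x hx using hx.neg.max tendsto_const_nhds
  have T2 : Tendsto (fun n => ∫ x, max (v n x) 0 ∂μ) atTop (𝓝 (L + ∫ x, max (-w x) 0 ∂μ)) := by
    refine (hL.add T).congr fun n => ?_
    rw [← integral_add (hv n) (hv2 n)]
    refine integral_congr_ae (Eventually.of_forall fun x => ?_)
    simp only
    rcases le_total (v n x) 0 with hx | hx
    · rw [max_eq_right hx, max_eq_left (by linarith)]; ring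
    · rw [max_eq_left hx, max_eq_right (by linarith)]; ring
  have hfin : ∫⁻ x, ENNReal.ofReal (max (w x) 0) ∂μ < ⊤ := by
    have h1 : ∫⁻ x, ENNReal.ofReal (max (w x) 0) ∂μ
        = ∫⁻ x, liminf (fun n => ENNReal.ofReal (max (v n x) 0)) atTop ∂μ := by
      refine lintegral_congr_ae ?_
      filter_upwards [hlim] with x hx
      exact ((ENNReal.tendsto_ofReal (hx.max tendsto_const_nhds)).liminf_eq).symm
    rw [h1]
    refine (lintegral_liminf_le' fun n =>
      (hv1 n).aestronglyMeasurable.aemeasurable.ennreal_ofReal).trans_lt ?_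
    have h2 : ∀ n, ∫⁻ x, ENNReal.ofReal (max (v n x) 0) ∂μ
        = ENNReal.ofReal (∫ x, max (v n x) 0 ∂μ) := fun n =>
      (ofReal_integral_eq_lintegral_ofReal (hv1 n)
        (Eventually.of_forall fun x => le_max_right _ _)).symm
    simp_rw [h2]
    rw [(ENNReal.tendsto_ofReal T2).liminf_eq]
    exact ENNReal.ofReal_lt_top
  have hp : Integrable (fun x => max (w x) 0) μ := by
    refine ⟨(hw.aemeasurable.max aemeasurable_const).aestronglyMeasurable, ?_⟩
    exact (hasFiniteIntegral_iff_ofReal (f := fun x => max (w x) 0)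
      (Eventually.of_forall fun x => le_max_right _ _)).2 hfin
  have hwi : Integrable w μ := by
    refine (hp.sub h).congr (Eventually.of_forall fun x => ?_)
    simp only [Pi.sub_apply]
    rcases le_total (w x) 0 with hx | hx
    · rw [max_eq_right hx, max_eq_left (by linarith)]; ring
    · rw [max_eq_left hx, max_eq_right (by linarith)]; ring
  refine ⟨hwi, tendsto_nhds_unique (tendsto_integral_of_dominated_convergence (fun x => |w x|)
    (fun n => (hv n).aestronglyMeasurable) hwi.abs (fun n => ?_) hlim) hL⟩
  filter_upwards [hpos n, hneg n] with x h1 h2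
  rw [Real.norm_eq_abs, abs_le]
  rcases le_total (w x) 0 with hx | hx
  · rw [max_eq_right hx] at h1
    rw [max_eq_left (by linarith : 0 ≤ -w x)] at h2
    rw [abs_of_nonpos hx]
    constructor <;> linarith [le_max_left (v n x) 0, le_max_left (-v n x) 0]
  · rw [max_eq_left hx] at h1
    rw [max_eq_right (by linarith : -w x ≤ 0)] at h2
    rw [abs_of_nonneg hx]
    constructor <;> linarith [le_max_left (v n x) 0, le_max_left (-v n x) 0]

lemma integrable_of_tendsto_of_one_sided {w : X → ℝ} {v : ℕ → X → ℝ} {L : ℝ}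
    (hw : AEStronglyMeasurable w μ) (hv : ∀ n, Integrable (v n) μ)
    (hpos : ∀ n, ∀ᵐ x ∂μ, max (v n x) 0 ≤ max (w x) 0)
    (hneg : ∀ n, ∀ᵐ x ∂μ, max (-v n x) 0 ≤ max (-w x) 0)
    (hlim : ∀ᵐ x ∂μ, Tendsto (fun n => v n x) atTop (𝓝 (w x)))
    (hL : Tendsto (fun n => ∫ x, v n x ∂μ) atTop (𝓝 L))
    (h : Integrable (fun x => max (w x) 0) μ ∨ Integrable (fun x => max (-w x) 0) μ) :
    Integrable w μ ∧ ∫ x, w x ∂μ = L := by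
  rcases h with h | h
  · have := integrable_of_tendsto_of_neg_part (w := fun x => -w x) (v := fun n x => -v n x)
      (L := -L) hw.neg (fun n => (hv n).neg) hneg (by simpa using hpos)
      (by filter_upwards [hlim] with x hx using hx.neg) (by simpa [integral_neg] using hL.neg)
      (by simpa using h)
    refine ⟨by simpa using this.1.neg, ?_⟩
    have h2 := this.2
    rw [integral_neg] at h2
    linarith
  · exact integrable_of_tendsto_of_neg_part hw hv hpos hneg hlim hL h

end OneSided

/-! ### Smooth cutoffs and dilations. -/

section Cutoff

/-- A smooth cutoff function equal to one on the unit ball. -/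
structure IsCutoff {N : ℕ} (θ : RN N → ℝ) : Prop where
  contDiff : ContDiff ℝ ∞ θ
  compact : HasCompactSupport θ
  nonneg : ∀ x, 0 ≤ θ x
  le_one : ∀ x, θ x ≤ 1
  eq_one : ∀ x, ‖x‖ ≤ 1 → θ x = 1

lemma exists_isCutoff (N : ℕ) : ∃ θ : RN N → ℝ, IsCutoff θ := by
  let b : ContDiffBump (0 : RN N) := ⟨1, 2, one_pos, one_lt_two⟩
  exact ⟨b, b.contDiff, b.hasCompactSupport, fun x => b.nonneg, fun x => b.le_one,
    fun x hx => b.one_of_mem_closedBall (by simpa [b] using hx)⟩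

variable {N : ℕ} {θ : RN N → ℝ}

lemma IsCutoff.tendsto (hθ : IsCutoff θ) {l : ℕ → ℝ} (hl : Tendsto l atTop (𝓝 0)) (x : RN N) :
    Tendsto (fun n => θ (l n • x)) atTop (𝓝 1) := by
  have h : Tendsto (fun n => l n • x) atTop (𝓝 0) := by simpa using hl.smul_const x
  simpa [hθ.eq_one 0 (by simp), Function.comp_def] using (hθ.contDiff.continuous.tendsto 0).comp h

lemma fderiv_comp_smul_apply {F : Type*} [NormedAddCommGroup F] [NormedSpace ℝ F] {f : RN N → F}
    (hf : Differentiable ℝ f) (l : ℝ) (x v : RN N) :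
    fderiv ℝ (fun y => f (l • y)) x v = l • fderiv ℝ f (l • x) v := by
  have d1 : HasFDerivAt (fun x : RN N => l • x) (l • ContinuousLinearMap.id ℝ (RN N)) x :=
    (hasFDerivAt_id x).const_smul l
  have d2 : fderiv ℝ (fun y => f (l • y)) x = _ := ((hf (l • x)).hasFDerivAt.comp x d1).fderiv
  rw [d2]; simp

lemma HasCompactSupport.comp_smul_ne_zero {F : Type*} [Zero F] {f : RN N → F}
    (hf : HasCompactSupport f) {l : ℝ} (hl : l ≠ 0) : HasCompactSupport fun x => f (l • x) :=
  hf.comp_homeomorph (Homeomorph.smulOfNeZero l hl)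

end Cutoff

/-! ### The chain rule for weak gradients. -/

section ChainRule

variable {N : ℕ} {u : RN N → ℝ} {D : RN N → RN N}

lemma integral_comp_deriv_mul_fderiv {w : RN N → ℝ} (hw : ContDiff ℝ 1 w) {G : ℝ → ℝ}
    (hG : ContDiff ℝ 1 G) {Y : RN N → RN N} (hY : ContDiff ℝ 1 Y) (hc : HasCompactSupport Y) :
    ∫ x, deriv G (w x) * fderiv ℝ w x (Y x) = - ∫ x, G (w x) * divergence Y x := by
  have hGw : ContDiff ℝ 1 fun x => G (w x) := hG.comp hw
  have h0 := integral_divergence_eq_zero (hGw.smul hY) hc.smul_left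
  have hd : ∀ x, divergence (fun y => G (w y) • Y y) x
      = deriv G (w x) * fderiv ℝ w x (Y x) + G (w x) * divergence Y x := fun x => by
    rw [divergence_smul (hGw.differentiable one_ne_zero x) (hY.differentiable one_ne_zero x)]
    have : fderiv ℝ (fun x => G (w x)) x = _ :=
      (((hG.differentiable one_ne_zero) (w x)).hasDerivAt.comp_hasFDerivAt x
        ((hw.differentiable one_ne_zero) x).hasFDerivAt).fderiv
    rw [this]; simp
  have h0' : ∫ x, divergence (fun y => G (w y) • Y y) x = 0 := h0
  simp_rw [hd] at h0'
  rw [integral_add] at h0'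
  · linarith
  · refine Continuous.integrable_of_hasCompactSupport ?_ ?_
    · exact ((hG.continuous_deriv le_rfl).comp hw.continuous).mul
        ((hw.continuous_fderiv one_ne_zero).clm_apply hY.continuous)
    · refine HasCompactSupport.mul_left (hc.mono fun x hx => ?_)
      contrapose! hx
      simp only [Function.mem_support, not_not] at hx ⊢
      simp [hx]
  · exact (hGw.continuous.mul (continuous_divergence hY)).integrable_of_hasCompactSupport
      (hasCompactSupport_divergence hc).mul_left

/-- The positive sequence `1/(n+1)` used for mollification. -/
lemma tendsto_inv_succ_nhdsGT : Tendsto (fun n : ℕ => 1 / ((n : ℝ) + 1)) atTop (𝓝[>] 0) :=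
  tendsto_nhdsWithin_iff.2 ⟨tendsto_one_div_add_atTop_nhds_zero_nat,
    Eventually.of_forall fun n => by simp only [mem_Ioi]; positivity⟩

/-- L² convergence gives almost everywhere convergence only along a subsequence, hence a sequence of
scales. -/
lemma IsMollifierPair.exists_seq {η ζ g : RN N → ℝ} (hη : IsMollifierPair η ζ)
    (hg : MemLp g 2 volume) : ∃ t : ℕ → ℝ, (∀ n, 0 < t n) ∧ Tendsto t atTop (𝓝[>] 0) ∧
      ∀ᵐ x, Tendsto (fun n => mollify (rescale η (t n)) g x) atTop (𝓝 (g x)) := by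
  obtain ⟨ns, hns, h⟩ := exists_seq_tendsto_ae_of_integral_sq
    (fun n : ℕ => hη.memLp_mollify hg (t := 1 / ((n : ℝ) + 1)) (by positivity)) hg
    ((hη.tendsto_integral_sq_mollify_sub hg).comp tendsto_inv_succ_nhdsGT)
  exact ⟨fun n => 1 / ((ns n : ℝ) + 1), fun n => by positivity,
    tendsto_inv_succ_nhdsGT.comp hns.tendsto_atTop, h⟩

/-- Chain rule for weak gradients, integrated against a `C¹` vector field. -/
lemma IsWeakGradient.integral_deriv_comp_mul_inner (h : IsWeakGradient u D)
    (hu : MemLp u 2 volume) (hD : MemLp D 2 volume) {G : ℝ → ℝ} (hG : ContDiff ℝ 1 G) {C : ℝ}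
    (hGC : ∀ s, |G s| ≤ C) (hGC' : ∀ s, |deriv G s| ≤ C) {Y : RN N → RN N} (hY : ContDiff ℝ 1 Y)
    (hc : HasCompactSupport Y) :
    ∫ x, deriv G (u x) * inner ℝ (D x) (Y x) = - ∫ x, G (u x) * divergence Y x := by
  obtain ⟨η, ζ, hη⟩ := exists_isMollifierPair N
  obtain ⟨t, ht0, ht, hae⟩ := hη.exists_seq hu
  have hDi := fun i => MemLp.coord hD i
  have cG' : Continuous (deriv G) := hG.continuous_deriv le_rfl
  have cY : ∀ i, Continuous fun x => Y x i := fun i => (contDiff_coord hY i).continuous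
  have sm : ∀ n, ContDiff ℝ 1 (mollify (rescale η (t n)) u) := fun n =>
    (hη.contDiff_mollify h.locallyIntegrable_fun (ht0 n)).of_le (by exact_mod_cast le_top)
  have hA : ∀ i, MemLp (fun x => C * |Y x i|) 2 volume := fun i =>
    (continuous_const.mul (cY i).abs).memLp_of_hasCompactSupport
      (HasCompactSupport.mul_left (hasCompactSupport_coord hc i).norm)
  have cm : ∀ i n, AEStronglyMeasurable
      (fun x => deriv G (mollify (rescale η (t n)) u x) * Y x i) volume := fun i n =>
    ((cG'.comp (sm n).continuous).mul (cY i)).aestronglyMeasurable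
  have bd : ∀ i s x, |deriv G s * Y x i| ≤ C * |Y x i| := fun i s x => by
    rw [abs_mul]; exact mul_le_mul_of_nonneg_right (hGC' s) (abs_nonneg _)
  -- `G'(u_t) Y` converges boundedly almost everywhere and `D_t` converges in L²; boundedness of
  -- `G'` and compact support of `Y` give the dominating function.
  have L1 : Tendsto (fun n => ∑ i, ∫ x, (deriv G (mollify (rescale η (t n)) u x) * Y x i) *
      mollify (rescale η (t n)) (fun y => D y i) x) atTop
      (𝓝 (∑ i, ∫ x, (deriv G (u x) * Y x i) * D x i)) := by
    refine tendsto_finsetSum _ fun i _ => ?_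
    refine MemLp.tendsto_integral_mul_of_dominated (hA i) (hDi i)
      (fun n => hη.memLp_mollify (hDi i) (ht0 n)) (cm i)
      (fun n => Eventually.of_forall fun x => bd i _ x) ?_
      ((hη.tendsto_integral_sq_mollify_sub (hDi i)).comp ht)
    filter_upwards [hae] with x hx
    exact ((cG'.tendsto _).comp hx).mul_const _
  have L2 : Tendsto (fun n => - ∫ x, G (mollify (rescale η (t n)) u x) * divergence Y x) atTop
      (𝓝 (- ∫ x, G (u x) * divergence Y x)) := by
    have cd := continuous_divergence hY
    refine (tendsto_integral_of_dominated_convergence (fun x => C * |divergence Y x|) (fun n => ?_)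
      ?_ (fun n => Eventually.of_forall fun x => ?_) ?_).neg
    · exact ((hG.continuous.comp (sm n).continuous).mul cd).aestronglyMeasurable
    · exact (cd.integrable_of_hasCompactSupport (hasCompactSupport_divergence hc)).abs.const_mul C
    · rw [norm_mul]
      exact mul_le_mul_of_nonneg_right (hGC _) (abs_nonneg _)
    · filter_upwards [hae] with x hx
      exact ((hG.continuous.tendsto _).comp hx).mul_const _
  have e : ∫ x, deriv G (u x) * inner ℝ (D x) (Y x)
      = ∑ i, ∫ x, (deriv G (u x) * Y x i) * D x i := by
    rw [← integral_finsetSum]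
    · refine integral_congr_ae (Eventually.of_forall fun x => ?_)
      simp only [inner_eq_sum_coord, Finset.mul_sum]
      exact Finset.sum_congr rfl fun i _ => by ring
    · intro i _
      refine MemLp.integrable_mul_two ((hA i).mono ?_ (Eventually.of_forall fun x =>
        (bd i (u x) x).trans (le_abs_self _))) (hDi i)
      exact (cG'.comp_aestronglyMeasurable hu.aestronglyMeasurable).mul (cY i).aestronglyMeasurable
  rw [e]
  refine tendsto_nhds_unique L1 (L2.congr fun n => ?_)
  rw [← integral_comp_deriv_mul_fderiv (sm n) hG hY hc, ← integral_finsetSum]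
  · refine integral_congr_ae (Eventually.of_forall fun x => ?_)
    simp only
    rw [h.fderiv_mollify_apply (hη.isTestFunction_rescale (ht0 n)), Finset.mul_sum]
    exact Finset.sum_congr rfl fun i _ => by ring
  · intro i _
    refine MemLp.integrable_mul_two ((hA i).mono (cm i n) (Eventually.of_forall fun x =>
      (bd i _ x).trans (le_abs_self _))) (hη.memLp_mollify (hDi i) (ht0 n))

end ChainRule

/-! ### Weakly superharmonic functions: monotone mollification and the energy identity. -/

section Superharmonic

variable {N : ℕ} {η ζ φ : RN N → ℝ} {D : RN N → RN N}

/-- Weak superharmonicity of a function with weak gradient `D`. -/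
def IsWeaklySuperharmonic {N : ℕ} (D : RN N → RN N) : Prop :=
  ∀ ψ : RN N → ℝ, IsTestFunction ψ → (∀ x, 0 ≤ ψ x) → 0 ≤ ∫ x, inner ℝ (D x) (gradient ψ x)

/-- The generator `N η(w) + w·∇η(w)` of the rescaling of `η`. -/
noncomputable def scaleGen {N : ℕ} (η : RN N → ℝ) (w : RN N) : ℝ := N * η w + fderiv ℝ η w w

lemma hasDerivAt_rescale {η : RN N → ℝ} (h : Differentiable ℝ η) {t : ℝ} (ht : 0 < t)
    (x : RN N) : HasDerivAt (fun s => rescale η s x) (-(t⁻¹ * rescale (scaleGen η) t x)) t := by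
  have d1 : HasDerivAt (fun s : ℝ => s⁻¹ • x) ((-(t ^ 2)⁻¹) • x) t :=
    (hasDerivAt_inv ht.ne').smul_const x
  have d2 : HasDerivAt (fun s : ℝ => η (s⁻¹ • x)) _ t :=
    (h (t⁻¹ • x)).hasFDerivAt.comp_hasDerivAt t d1
  have d3 : HasDerivAt (fun s : ℝ => (s ^ N)⁻¹) (-(N * t ^ (N - 1)) / (t ^ N) ^ 2) t :=
    (hasDerivAt_pow N t).fun_inv (by positivity)
  -- The subtraction in `N - 1` is truncated, but at `N = 0` the factor `N` kills both sides.
  have e : (N : ℝ) * t ^ (N - 1) = N * (t ^ N * t⁻¹) := by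
    rcases N with _ | n
    · simp
    · rw [Nat.add_sub_cancel, pow_succ, mul_assoc, mul_inv_cancel₀ ht.ne', mul_one]
  refine (d3.mul d2).congr_deriv ?_
  rw [e]
  simp only [rescale, scaleGen, map_smul, smul_eq_mul]
  have : t ^ N ≠ 0 := by positivity
  field_simp
  ring

lemma continuous_scaleGen {η : RN N → ℝ} (h : ContDiff ℝ 1 η) : Continuous (scaleGen η) :=
  (continuous_const.mul h.continuous).add
    ((h.continuous_fderiv one_ne_zero).clm_apply continuous_id)

lemma scaleGen_eq_zero {η : RN N → ℝ} (h : ∀ x, 1 ≤ ‖x‖ → η x = 0) {x : RN N} (hx : 1 < ‖x‖) :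
    scaleGen η x = 0 := by
  simp [scaleGen, h x hx.le, fderiv_eq_zero_of_norm_gt h hx]

lemma hasCompactSupport_scaleGen {η : RN N → ℝ} (h : HasCompactSupport η) :
    HasCompactSupport (scaleGen η) := by
  have h2 : HasCompactSupport fun w => fderiv ℝ η w w := (h.fderiv ℝ).mono fun x hx => by
    contrapose! hx
    simp only [Function.mem_support, not_not] at hx ⊢
    simp [hx]
  exact (HasCompactSupport.mul_left (f := fun _ => (N : ℝ)) h).add h2

lemma IsMollifierPair.hasDerivAt_mollify (hη : IsMollifierPair η ζ) (hφ : LocallyIntegrable φ)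
    {t : ℝ} (ht : 0 < t) (x : RN N) :
    HasDerivAt (fun s => mollify (rescale η s) φ x)
      (-(t⁻¹ * mollify (rescale (scaleGen η) t) φ x)) t := by
  have hη1 : ContDiff ℝ 1 η := hη.contDiff_ker.of_le (by exact_mod_cast le_top)
  have hηc : HasCompactSupport η := hasCompactSupport_of_norm_ge hη.ker_eq_zero
  have cρ := continuous_scaleGen hη1
  obtain ⟨C, hC0, hC⟩ := exists_bound_of_hasCompactSupport cρ (hasCompactSupport_scaleGen hηc)
  have meas : ∀ (f : RN N → ℝ), Continuous f → AEStronglyMeasurable (fun y => φ y * f y) volume :=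
    fun f hf => hφ.aestronglyMeasurable.mul hf.aestronglyMeasurable
  have cr : ∀ {f : RN N → ℝ}, Continuous f → ∀ s, Continuous fun y => rescale f s (x - y) :=
    fun {f} hf s => continuous_const.mul (hf.comp (by fun_prop))
  -- For scales in `(t/2, 2t)` the kernel's `t`-derivative is bounded by `B` and supported in the
  -- ball of radius `2t`.
  set B : ℝ := (t / 2)⁻¹ * (((t / 2) ^ N)⁻¹ * C) with hB
  have hK : IsCompact (Metric.closedBall x (2 * t)) := isCompact_closedBall _ _
  have key := hasDerivAt_integral_of_dominated_loc_of_deriv_le (μ := volume)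
    (F := fun s y => φ y * rescale η s (x - y))
    (F' := fun s y => φ y * -(s⁻¹ * rescale (scaleGen η) s (x - y)))
    (x₀ := t) (s := Ioo (t / 2) (2 * t))
    (bound := (Metric.closedBall x (2 * t)).indicator fun y => ‖φ y‖ * B)
    (Ioo_mem_nhds (by linarith) (by linarith))
    (Eventually.of_forall fun s => meas _ (cr hη1.continuous s))
    (integrable_mul_sub (contDiff_rescale hη1 t).continuous (hη.hasCompactSupport_rescale ht) hφ x)
    (meas _ (continuous_const.mul (cr cρ t)).neg) ?_ ?_ ?_
  · refine key.2.congr_deriv ?_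
    rw [mollify, ← integral_const_mul, ← integral_neg]
    exact integral_congr_ae (Eventually.of_forall fun y => by simp only; ring)
  · refine Eventually.of_forall fun y s hs => ?_
    have hs0 : 0 < s := by linarith [hs.1]
    by_cases hy : y ∈ Metric.closedBall x (2 * t)
    · rw [indicator_of_mem hy, norm_mul]
      refine mul_le_mul_of_nonneg_left ?_ (norm_nonneg _)
      rw [norm_neg, rescale, norm_mul, norm_mul, Real.norm_of_nonneg (inv_nonneg.2 hs0.le),
        Real.norm_of_nonneg (inv_nonneg.2 (pow_nonneg hs0.le N))]
      have h1 : s⁻¹ ≤ (t / 2)⁻¹ := inv_anti₀ (by positivity) hs.1.le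
      have h2 : (s ^ N)⁻¹ ≤ ((t / 2) ^ N)⁻¹ :=
        inv_anti₀ (by positivity) (pow_le_pow_left₀ (by positivity) hs.1.le N)
      exact mul_le_mul h1 (mul_le_mul h2 (hC _) (norm_nonneg _) (by positivity)) (by positivity)
        (by positivity)
    · rw [indicator_of_notMem hy, rescale, scaleGen_eq_zero hη.ker_eq_zero]
      · simp
      · rw [Metric.mem_closedBall, not_le, dist_comm, dist_eq_norm] at hy
        rw [norm_smul, norm_inv, Real.norm_of_nonneg hs0.le, inv_mul_eq_div, one_lt_div hs0]
        linarith [hs.2]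
  · exact (integrable_indicator_iff hK.measurableSet).2
      ((hφ.integrableOn_isCompact hK).norm.mul_const B)
  · refine Eventually.of_forall fun y s hs => ?_
    exact (hasDerivAt_rescale (hη1.differentiable one_ne_zero) (by linarith [hs.1]) _).const_mul _

/-- `scaleGen η` is the divergence of `w ↦ η(w) w`, and this field is `-∇ζ`. So, up to a positive
factor, the quantity is `D` paired with the gradient of the nonnegative test function `y ↦ ζ((x -
y)/t)`. -/
lemma IsMollifierPair.mollify_scaleGen_nonneg (hη : IsMollifierPair η ζ) (h : IsWeakGradient φ D)
    (hs : IsWeaklySuperharmonic D) {t : ℝ} (ht : 0 < t) (x : RN N) :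
    0 ≤ mollify (rescale (scaleGen η) t) φ x := by
  have hη1 : ContDiff ℝ 1 η := hη.contDiff_ker.of_le (by exact_mod_cast le_top)
  have cκ : ContDiff ℝ ∞ (rescale η t) := contDiff_rescale hη.contDiff_ker t
  have dκ : Differentiable ℝ (rescale η t) := cκ.differentiable (by simp)
  set a : RN N → ℝ := fun y => rescale η t (x - y) with ha
  have hta : IsTestFunction a := isTestFunction_comp_const_sub (hη.isTestFunction_rescale ht) x
  set V : RN N → RN N := fun y => a y • (x - y) with hV
  have cV : ContDiff ℝ ∞ V := hta.1.smul (contDiff_const.sub contDiff_id)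
  have hVc : HasCompactSupport V := hta.2.smul_right
  have e1 : ∀ y, divergence V y = - rescale (scaleGen η) t (x - y) := fun y => by
    have hd : DifferentiableAt ℝ (fun y : RN N => x - y) y := by fun_prop
    rw [hV, divergence_smul (hta.1.differentiable (by simp) y) hd, ha,
      fderiv_comp_const_sub dκ, fderiv_rescale (hη1.differentiable one_ne_zero)]
    have : divergence (fun y : RN N => x - y) y = -N := by
      have h1 : fderiv ℝ (fun y : RN N => x - y) y = -ContinuousLinearMap.id ℝ (RN N) := by
        rw [fderiv_const_sub]; simp
      simp [divergence, h1]
    rw [this]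
    simp only [rescale, scaleGen, map_smul, smul_eq_mul]
    ring
  have h1 := h.integral_mul_divergence cV hVc
  simp_rw [e1, mul_neg, integral_neg, neg_inj] at h1
  set ψ : RN N → ℝ := fun y => ζ (t⁻¹ • (x - y)) with hψ
  have dζ : Differentiable ℝ ζ := hη.contDiff_pot.differentiable (by simp)
  have htψ : IsTestFunction ψ := by
    have hz : IsTestFunction fun z => ζ (t⁻¹ • z) :=
      ⟨hη.contDiff_pot.comp (contDiff_const_smul _),
        HasCompactSupport.comp_smul_ne_zero (hasCompactSupport_of_norm_ge hη.pot_eq_zero)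
          (inv_ne_zero ht.ne')⟩
    exact isTestFunction_comp_const_sub hz x
  have e2 : ∀ y, inner ℝ (D y) (V y) = ((t ^ N)⁻¹ * t ^ 2) * inner ℝ (D y) (gradient ψ y) := by
    intro y
    rw [inner_gradient_right_real, hψ]
    have h3 : Differentiable ℝ fun z => ζ (t⁻¹ • z) := dζ.comp (by fun_prop)
    rw [fderiv_comp_const_sub h3, fderiv_comp_smul_apply dζ, hη.fderiv_pot, hV, ha]
    simp only [rescale, inner_smul_left, inner_smul_right, smul_eq_mul]
    rw [real_inner_comm]
    simp
    field_simp
  have h2 := hs ψ htψ fun y => hη.pot_nonneg _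
  simp_rw [e2, integral_const_mul] at h1
  change 0 ≤ ∫ y, φ y * rescale (scaleGen η) t (x - y)
  rw [h1]
  positivity

lemma IsMollifierPair.antitoneOn_mollify (hη : IsMollifierPair η ζ) (h : IsWeakGradient φ D)
    (hs : IsWeaklySuperharmonic D) (x : RN N) :
    AntitoneOn (fun t => mollify (rescale η t) φ x) (Ioi 0) := by
  refine antitoneOn_of_deriv_nonpos (convex_Ioi 0) ?_ ?_ ?_
  · exact fun t ht => (hη.hasDerivAt_mollify h.locallyIntegrable_fun ht x).continuousAt.continuousWithinAt
  · rw [interior_Ioi]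
    exact fun t ht =>
      (hη.hasDerivAt_mollify h.locallyIntegrable_fun ht x).differentiableAt.differentiableWithinAt
  · rw [interior_Ioi]
    intro t ht
    rw [(hη.hasDerivAt_mollify h.locallyIntegrable_fun ht x).deriv, neg_nonpos]
    exact mul_nonneg (inv_nonneg.2 (le_of_lt ht)) (hη.mollify_scaleGen_nonneg h hs ht x)

/-- By monotonicity in `t`, every mollification lies below the limit along a sequence `t → 0`, which
is `φ` almost everywhere. -/
lemma IsMollifierPair.mollify_le (hη : IsMollifierPair η ζ) (h : IsWeakGradient φ D)
    (hs : IsWeaklySuperharmonic D) (hφ : MemLp φ 2 volume) :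
    ∀ᵐ x, ∀ t, 0 < t → mollify (rescale η t) φ x ≤ φ x := by
  obtain ⟨t, ht0, ht, hae⟩ := hη.exists_seq hφ
  filter_upwards [hae] with x hx s hs0
  refine ge_of_tendsto hx ?_
  have : ∀ᶠ n in atTop, t n < s :=
    (tendsto_nhdsWithin_iff.1 ht).1.eventually (gt_mem_nhds hs0)
  filter_upwards [this] with n hn
  exact hη.antitoneOn_mollify h hs x (ht0 n) hs0 hn.le

/-- Cauchy–Schwarz: the squared L² norm of the rescaled kernel is `t^(-N) ∫ η²`. -/
lemma IsMollifierPair.tendsto_mollify_atTop (hN : 0 < N) (hη : IsMollifierPair η ζ)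
    (hφ : MemLp φ 2 volume) (x : RN N) :
    Tendsto (fun n : ℕ => mollify (rescale η ((n : ℝ) + 1)) φ x) atTop (𝓝 0) := by
  have hηc : HasCompactSupport η := hasCompactSupport_of_norm_ge hη.ker_eq_zero
  set M := ∫ z, η z ^ 2 with hM
  have e : ∀ t : ℝ, 0 < t → ∫ y, rescale η t (x - y) ^ 2 = (t ^ N)⁻¹ * M := fun t ht => by
    rw [integral_sub_left_eq_self (fun z => rescale η t z ^ 2), hM,
      ← integral_rescale (fun z => η z ^ 2) ht, ← integral_const_mul]
    refine integral_congr_ae (Eventually.of_forall fun z => ?_)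
    simp only [rescale]
    ring
  have hb : ∀ n : ℕ, ‖mollify (rescale η ((n : ℝ) + 1)) φ x‖
      ≤ √(∫ y, φ y ^ 2) * √((((n : ℝ) + 1) ^ N)⁻¹ * M) := fun n => by
    have hn : (0 : ℝ) < (n : ℝ) + 1 := by positivity
    rw [← e _ hn]
    have ht := isTestFunction_comp_const_sub (hη.isTestFunction_rescale hn) x
    exact hφ.abs_integral_mul_le (ht.1.continuous.memLp_of_hasCompactSupport ht.2)
  refine squeeze_zero_norm hb ?_
  have h1 : Tendsto (fun n : ℕ => (((n : ℝ) + 1) ^ N)⁻¹) atTop (𝓝 0) := by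
    refine tendsto_inv_atTop_zero.comp ((tendsto_pow_atTop hN.ne').comp ?_)
    exact tendsto_atTop_add_const_right _ _ tendsto_natCast_atTop_atTop
  simpa using ((h1.mul_const M).sqrt).const_mul (√(∫ y, φ y ^ 2))

lemma IsMollifierPair.mollify_nonneg (hN : 0 < N) (hη : IsMollifierPair η ζ)
    (h : IsWeakGradient φ D) (hs : IsWeaklySuperharmonic D) (hφ : MemLp φ 2 volume) {t : ℝ}
    (ht : 0 < t) (x : RN N) : 0 ≤ mollify (rescale η t) φ x := by
  refine le_of_tendsto (hη.tendsto_mollify_atTop hN hφ x) ?_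
  obtain ⟨m, hm⟩ := exists_nat_ge t
  filter_upwards [eventually_ge_atTop m] with n hn
  have hn' : t ≤ (n : ℝ) + 1 := by
    have : (m : ℝ) ≤ n := by exact_mod_cast hn
    linarith
  exact hη.antitoneOn_mollify h hs x ht (show (0 : ℝ) < (n : ℝ) + 1 by positivity) hn'

/-- The equation is tested with `θ(l x) φ_t(x)`, sending `l` and `t` to zero together. On the source
side `0 ≤ θ φ_t ≤ φ` and everything is nonnegative, so the limit also yields integrability of `f φ`.
-/
lemma IsWeakGradient.integral_mul_eq_integral_norm_sq (hN : 0 < N) (h : IsWeakGradient φ D)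
    (hφ : MemLp φ 2 volume) (hD : MemLp D 2 volume) {f : RN N → ℝ} (hf : LocallyIntegrable f)
    (hf0 : ∀ x, 0 ≤ f x)
    (heq : ∀ ψ, IsTestFunction ψ → ∫ x, inner ℝ (D x) (gradient ψ x) = ∫ x, f x * ψ x) :
    Integrable (fun x => f x * φ x) ∧ ∫ x, f x * φ x = ∫ x, ‖D x‖ ^ 2 := by
  have hs : IsWeaklySuperharmonic D := fun ψ hψ hψ0 => by
    rw [heq ψ hψ]
    exact integral_nonneg fun x => mul_nonneg (hf0 x) (hψ0 x)
  obtain ⟨η, ζ, hη⟩ := exists_isMollifierPair N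
  obtain ⟨θ, hθ⟩ := exists_isCutoff N
  obtain ⟨t, ht0, ht, hae⟩ := hη.exists_seq hφ
  have hDi := fun i => MemLp.coord hD i
  have hle := hη.mollify_le h hs hφ
  set l : ℕ → ℝ := fun n => 1 / ((n : ℝ) + 1) with hl
  have hl0 : ∀ n, 0 < l n := fun n => by rw [hl]; positivity
  have hlt : Tendsto l atTop (𝓝 0) := tendsto_one_div_add_atTop_nhds_zero_nat
  have hl1 : ∀ n, l n ≤ 1 := fun n => by
    rw [hl]; simp only; rw [div_le_one (by positivity)]; linarith [(Nat.cast_nonneg n : (0:ℝ) ≤ n)]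
  have dθ : Differentiable ℝ θ := hθ.contDiff.differentiable (by simp)
  have cdθ : Continuous (fderiv ℝ θ) := hθ.contDiff.continuous_fderiv (by simp)
  obtain ⟨C, hC0, hC⟩ := exists_bound_of_hasCompactSupport cdθ (hθ.compact.fderiv ℝ)
  set φt : ℕ → RN N → ℝ := fun n => mollify (rescale η (t n)) φ with hφt
  have cφ : ∀ n, ContDiff ℝ ∞ (φt n) := fun n =>
    hη.contDiff_mollify h.locallyIntegrable_fun (ht0 n)
  set χ : ℕ → RN N → ℝ := fun n x => θ (l n • x) with hχ
  have cχ : ∀ n, ContDiff ℝ ∞ (χ n) := fun n => hθ.contDiff.comp (contDiff_const_smul _)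
  have hψ : ∀ n, IsTestFunction fun x => χ n x * φt n x := fun n =>
    ⟨(cχ n).mul (cφ n), HasCompactSupport.mul_right
      (HasCompactSupport.comp_smul_ne_zero hθ.compact (hl0 n).ne')⟩
  have hc1 : ∀ i n, AEStronglyMeasurable (fun x => χ n x * D x i) volume := fun i n =>
    (cχ n).continuous.aestronglyMeasurable.mul (hDi i).aestronglyMeasurable
  have hb1 : ∀ i n x, |χ n x * D x i| ≤ |D x i| := fun i n x => by
    rw [abs_mul, abs_of_nonneg (hθ.nonneg _)]
    exact mul_le_of_le_one_left (abs_nonneg _) (hθ.le_one _)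
  have hm2 : ∀ n, MemLp (φt n) 2 volume := fun n => hη.memLp_mollify hφ (ht0 n)
  have hc2 : ∀ n, AEStronglyMeasurable (fun x => fderiv ℝ (χ n) x (D x)) volume := fun n =>
    (isBoundedBilinearMap_apply (𝕜 := ℝ) (E := RN N) (F := ℝ)).continuous.comp_aestronglyMeasurable
      (((cχ n).continuous_fderiv (by simp)).aestronglyMeasurable.prodMk hD.aestronglyMeasurable)
  have hb2' : ∀ n x, |fderiv ℝ (χ n) x (D x)| ≤ l n * (C * ‖D x‖) := fun n x => by
    rw [hχ, fderiv_comp_smul_apply dθ, smul_eq_mul, abs_mul, abs_of_pos (hl0 n)]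
    refine mul_le_mul_of_nonneg_left ?_ (hl0 n).le
    exact (ContinuousLinearMap.le_opNorm (fderiv ℝ θ (l n • x)) (D x)).trans
      (mul_le_mul_of_nonneg_right (hC _) (norm_nonneg _))
  have hb2 : ∀ n x, |fderiv ℝ (χ n) x (D x)| ≤ C * ‖D x‖ := fun n x =>
    (hb2' n x).trans (mul_le_of_le_one_left (by positivity) (hl1 n))
  have hAC : MemLp (fun x => C * ‖D x‖) 2 volume := hD.norm.const_mul C
  have L1 : Tendsto (fun n => ∑ i, ∫ x, (χ n x * D x i) * mollify (rescale η (t n)) (fun y => D y i) x)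
      atTop (𝓝 (∑ i, ∫ x, D x i * D x i)) := by
    refine tendsto_finsetSum _ fun i _ => ?_
    refine MemLp.tendsto_integral_mul_of_dominated (hDi i).abs (hDi i)
      (fun n => hη.memLp_mollify (hDi i) (ht0 n)) (hc1 i)
      (fun n => Eventually.of_forall fun x => hb1 i n x) ?_
      ((hη.tendsto_integral_sq_mollify_sub (hDi i)).comp ht)
    exact Eventually.of_forall fun x => by simpa using (hθ.tendsto hlt x).mul_const (D x i)
  -- The gradient of the cutoff is `O(l n)`, so this term vanishes.
  have L2 : Tendsto (fun n => ∫ x, fderiv ℝ (χ n) x (D x) * φt n x) atTop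
      (𝓝 (∫ x, 0 * φ x)) := by
    refine MemLp.tendsto_integral_mul_of_dominated hAC hφ hm2 hc2
      (fun n => Eventually.of_forall fun x => hb2 n x) (Eventually.of_forall fun x => ?_)
      ((hη.tendsto_integral_sq_mollify_sub hφ).comp ht)
    refine squeeze_zero_norm (hb2' · x) ?_
    simpa using hlt.mul_const (C * ‖D x‖)
  have e0 : ∑ i, ∫ x, D x i * D x i = ∫ x, ‖D x‖ ^ 2 := by
    rw [← integral_finsetSum _ fun i _ => (hDi i).integrable_mul_two (hDi i)]
    simp_rw [norm_sq_eq_sum, sq]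
  have L : Tendsto (fun n => ∫ x, f x * (χ n x * φt n x)) atTop (𝓝 (∫ x, ‖D x‖ ^ 2)) := by
    have := L1.add L2
    simp only [zero_mul, integral_zero, add_zero, e0] at this
    refine this.congr fun n => ?_
    rw [← heq _ (hψ n)]
    have i1 : ∀ i, Integrable fun x => (χ n x * D x i) * mollify (rescale η (t n)) (fun y => D y i) x :=
      fun i => MemLp.integrable_mul_two ((hDi i).abs.mono (hc1 i n) (Eventually.of_forall fun x =>
        (hb1 i n x).trans (le_abs_self _))) (hη.memLp_mollify (hDi i) (ht0 n))
    have i2 : Integrable fun x => fderiv ℝ (χ n) x (D x) * φt n x :=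
      MemLp.integrable_mul_two (hAC.mono (hc2 n) (Eventually.of_forall fun x =>
        (hb2 n x).trans (le_abs_self _))) (hm2 n)
    rw [← integral_finsetSum _ fun i _ => i1 i, ← integral_add (integrable_finsetSum _ fun i _ => i1 i) i2]
    refine integral_congr_ae (Eventually.of_forall fun x => ?_)
    simp only
    rw [inner_gradient_right_real, fderiv_fun_mul ((cχ n).differentiable (by simp) x)
      ((cφ n).differentiable (by simp) x)]
    simp only [_root_.add_apply, _root_.smul_apply, smul_eq_mul]
    rw [hφt, h.fderiv_mollify_apply (hη.isTestFunction_rescale (ht0 n)), Finset.mul_sum]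
    congr 1
    · exact Finset.sum_congr rfl fun i _ => by ring
    · ring
  have hpos : ∀ n x, 0 ≤ φt n x := fun n x => hη.mollify_nonneg hN h hs hφ (ht0 n) x
  have hφ0 : ∀ᵐ x, 0 ≤ φ x := by
    filter_upwards [hle] with x hx using (hpos 0 x).trans (hx _ (ht0 0))
  have hv0 : ∀ n x, 0 ≤ f x * (χ n x * φt n x) := fun n x =>
    mul_nonneg (hf0 x) (mul_nonneg (hθ.nonneg _) (hpos n x))
  refine integrable_of_tendsto_of_one_sided (v := fun n x => f x * (χ n x * φt n x))
    (hf.aestronglyMeasurable.mul hφ.aestronglyMeasurable) (fun n => ?_) (fun n => ?_) (fun n => ?_)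
    ?_ L (Or.inr ?_)
  · exact hf.integrable_smul_right_of_hasCompactSupport (hψ n).1.continuous (hψ n).2
  · filter_upwards [hle] with x hx
    refine max_le_max_right _ (mul_le_mul_of_nonneg_left ?_ (hf0 x))
    exact (mul_le_of_le_one_left (hpos n x) (hθ.le_one _)).trans (hx _ (ht0 n))
  · filter_upwards [hφ0] with x hx
    rw [max_eq_right (by linarith [hv0 n x])]
    exact le_max_right _ _
  · filter_upwards [hae] with x hx
    simpa using ((hθ.tendsto hlt x).mul hx).const_mul (f x)
  · refine (integrable_zero (RN N) ℝ volume).congr ?_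
    filter_upwards [hφ0] with x hx
    rw [max_eq_right (by linarith [mul_nonneg (hf0 x) hx])]
    rfl

end Superharmonic

/-! ### The Hardy–Littlewood–Sobolev inequality on the diagonal. -/

section HLS

variable {N : ℕ}

/-- The profile `|w|^{-λ}` inside and `|w|^{-2N}` outside the unit ball. -/
noncomputable def hlsProfile (lam : ℝ) (w : RN N) : ℝ :=
  if ‖w‖ < 1 then ‖w‖ ^ (-lam) else ‖w‖ ^ (-(2 * N : ℝ))

lemma hlsProfile_nonneg (lam : ℝ) (w : RN N) : 0 ≤ hlsProfile lam w := by
  unfold hlsProfile; split_ifs <;> positivity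

lemma measurable_hlsProfile (lam : ℝ) : Measurable (hlsProfile (N := N) lam) :=
  Measurable.ite (measurableSet_lt measurable_norm measurable_const)
    (measurable_norm.pow_const _) (measurable_norm.pow_const _)

lemma integrable_hlsProfile (hN : 0 < N) {lam : ℝ} (hlam : lam < N) :
    Integrable (hlsProfile (N := N) lam) := by
  have hm := (measurable_hlsProfile (N := N) lam).aestronglyMeasurable (μ := volume)
  rw [← integrableOn_univ, ← union_compl_self (Metric.ball (0 : RN N) 1)]
  refine IntegrableOn.union ?_ ?_
  · refine integrableOn_ball_of_norm_le_rpow (C := 1) (α := lam) (by simpa using Nat.one_le_iff_ne_zero.2 hN.ne')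
      (by simpa using hlam) ?_ hm
    refine (ae_restrict_iff' measurableSet_ball).2 (Eventually.of_forall fun x hx => ?_)
    rw [Real.norm_of_nonneg (hlsProfile_nonneg _ _), hlsProfile, if_pos (by simpa using hx), one_mul]
  · have h2 : Integrable fun x : RN N => (2 : ℝ) ^ (2 * N : ℝ) * (1 + ‖x‖) ^ (-(2 * N : ℝ)) := by
      refine (integrable_one_add_norm ?_).const_mul _
      have : (0 : ℝ) < N := by exact_mod_cast hN
      simp only [finrank_euclideanSpace_fin]
      linarith
    refine Integrable.mono' h2.integrableOn hm.restrict ?_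
    refine (ae_restrict_iff' measurableSet_ball.compl).2 (Eventually.of_forall fun x hx => ?_)
    have hx1 : 1 ≤ ‖x‖ := by simpa using hx
    rw [Real.norm_of_nonneg (hlsProfile_nonneg _ _), hlsProfile, if_neg (not_lt.2 hx1),
      Real.rpow_neg (by positivity), Real.rpow_neg (by positivity), ← div_eq_mul_inv,
      ← Real.div_rpow (by positivity) (by positivity), ← Real.inv_rpow (by positivity)]
    refine Real.rpow_le_rpow (by positivity) ?_ (by positivity)
    rw [inv_eq_one_div, div_le_div_iff₀ (by positivity) (by positivity)]
    linarith

/-- The larger value `t` sets the length scale `t^(-r/N)`. Closer than that, replace `s` by `t`;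
farther away, apply Young's inequality. Both bounds become integrable after the rescaling `w =
t^(r/N) z`. -/
lemma hls_pointwise_aux (hN : 0 < N) {α r : ℝ} (hα : 0 < α) (hαN : α < N)
    (hr : r = 2 * N / (N + α)) {s t : ℝ} (hs : 0 ≤ s) (hst : s ≤ t) (z : RN N) :
    t * s * (‖z‖ ^ ((N : ℝ) - α))⁻¹
      ≤ t ^ r * s ^ r + t ^ (2 * r) * hlsProfile ((N : ℝ) - α) (t ^ (r / N) • z) := by
  have hN' : (0 : ℝ) < N := by exact_mod_cast hN
  have hrpos : 0 < r := by rw [hr]; positivity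
  have hnn : 0 ≤ t ^ r * s ^ r + t ^ (2 * r) * hlsProfile ((N : ℝ) - α) (t ^ (r / N) • z) := by
    have := hlsProfile_nonneg ((N : ℝ) - α) (t ^ (r / N) • z)
    have ht : 0 ≤ t := hs.trans hst
    positivity
  rcases (hs.trans hst).eq_or_lt with ht | ht
  · simp only [← ht, zero_mul] at hnn ⊢
    exact hnn
  rcases (norm_nonneg z).eq_or_lt with hz | hz
  · rw [← hz, Real.zero_rpow (by linarith), inv_zero, mul_zero]
    exact hnn
  have hnorm : ‖t ^ (r / N) • z‖ = t ^ (r / N) * ‖z‖ := by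
    rw [norm_smul, Real.norm_of_nonneg (by positivity)]
  have htr : 0 ≤ t ^ r * s ^ r := by positivity
  rw [hlsProfile, hnorm]
  split_ifs with hw
  · have e : t ^ (2 * r) * (t ^ (r / N) * ‖z‖) ^ (-((N : ℝ) - α))
        = t * t * (‖z‖ ^ ((N : ℝ) - α))⁻¹ := by
      rw [Real.mul_rpow (by positivity) hz.le, ← Real.rpow_mul ht.le, ← mul_assoc,
        ← Real.rpow_add ht, Real.rpow_neg hz.le]
      congr 1
      -- This balance of exponents forces `r = 2N/(N + α)`.
      have : 2 * r + r / N * -((N : ℝ) - α) = 2 := by rw [hr]; field_simp; ring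
      rw [this, Real.rpow_two, sq]
    rw [e]
    have : t * s * (‖z‖ ^ ((N : ℝ) - α))⁻¹ ≤ t * t * (‖z‖ ^ ((N : ℝ) - α))⁻¹ := by gcongr
    linarith
  · have e : t ^ (2 * r) * (t ^ (r / N) * ‖z‖) ^ (-(2 * N : ℝ)) = ‖z‖ ^ (-(2 * N : ℝ)) := by
      rw [Real.mul_rpow (by positivity) hz.le, ← Real.rpow_mul ht.le, ← mul_assoc,
        ← Real.rpow_add ht]
      have : 2 * r + r / N * -(2 * N : ℝ) = 0 := by field_simp; ring
      rw [this, Real.rpow_zero, one_mul]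
    rw [e]
    have hr1 : 1 < r := by rw [hr, lt_div_iff₀ (by positivity)]; linarith
    -- The conjugate exponent turns the kernel `|z|^(-(N-α))` into `|z|^(-2N)`, the decay chosen in
    -- `hlsProfile`.
    have hconj : r.HolderConjugate (2 * N / (N - α)) := by
      rw [Real.holderConjugate_iff]
      refine ⟨hr1, ?_⟩
      rw [hr]
      have : (N : ℝ) - α ≠ 0 := by linarith
      field_simp
      ring
    have hy := Real.young_inequality_of_nonneg (a := t * s) (b := (‖z‖ ^ ((N : ℝ) - α))⁻¹)
      (by positivity) (by positivity) hconj
    have e2 : ((‖z‖ ^ ((N : ℝ) - α))⁻¹) ^ (2 * N / (N - α) : ℝ) = ‖z‖ ^ (-(2 * N : ℝ)) := by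
      rw [← Real.rpow_neg hz.le, ← Real.rpow_mul hz.le]
      congr 1
      have : (N : ℝ) - α ≠ 0 := by linarith
      field_simp
    rw [e2, Real.mul_rpow ht.le hs] at hy
    have h1 : t ^ r * s ^ r / r ≤ t ^ r * s ^ r := div_le_self htr hr1.le
    have h2 : ‖z‖ ^ (-(2 * N : ℝ)) / (2 * N / (N - α)) ≤ ‖z‖ ^ (-(2 * N : ℝ)) :=
      div_le_self (by positivity) hconj.symm.lt.le
    linarith

/-- The diagonal Hardy–Littlewood–Sobolev inequality, in qualitative form. -/
lemma integrable_mul_mul_rieszKernel (hN : 0 < N) {α r : ℝ} (hα : 0 < α) (hαN : α < N)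
    (hr : r = 2 * N / (N + α)) {f : RN N → ℝ} (hf : AEStronglyMeasurable f volume)
    (hf0 : ∀ x, 0 ≤ f x) (hfr : Integrable fun x => f x ^ r) :
    Integrable (fun p : RN N × RN N => f p.1 * f p.2 * (‖p.1 - p.2‖ ^ ((N : ℝ) - α))⁻¹)
      (volume.prod volume) := by
  have hN' : (0 : ℝ) < N := by exact_mod_cast hN
  have hrpos : 0 < r := by rw [hr]; positivity
  have hH := integrable_hlsProfile hN (lam := (N : ℝ) - α) (by linarith)
  set H := hlsProfile (N := N) ((N : ℝ) - α) with hHdef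
  have mH : Measurable H := measurable_hlsProfile _
  have mf1 : AEMeasurable (fun p : RN N × RN N => f p.1) (volume.prod volume) :=
    hf.comp_fst.aemeasurable
  have mf2 : AEMeasurable (fun p : RN N × RN N => f p.2) (volume.prod volume) :=
    hf.comp_snd.aemeasurable
  have ms : AEMeasurable (fun p : RN N × RN N => p.1 - p.2) (volume.prod volume) :=
    (measurable_fst.sub measurable_snd).aemeasurable
  have I1 : Integrable (fun p : RN N × RN N =>
      f p.1 ^ (2 * r) * H (f p.1 ^ (r / N) • (p.1 - p.2))) (volume.prod volume) := by
    have hm : AEStronglyMeasurable (fun p : RN N × RN N =>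
        f p.1 ^ (2 * r) * H (f p.1 ^ (r / N) • (p.1 - p.2))) (volume.prod volume) :=
      ((mf1.pow_const _).mul (mH.comp_aemeasurable ((mf1.pow_const _).smul ms))).aestronglyMeasurable
    have hcalc : ∀ x, Integrable (fun y => f x ^ (2 * r) * H (f x ^ (r / N) • (x - y))) ∧
        ∫ y, f x ^ (2 * r) * H (f x ^ (r / N) • (x - y)) = f x ^ r * ∫ w, H w := fun x => by
      -- At `f x = 0` the dilation degenerates, but both sides vanish. Otherwise the change of
      -- variables produces a factor `f(x)^(-r)`.
      rcases (hf0 x).eq_or_lt with h0 | h0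
      · simp [← h0, Real.zero_rpow hrpos.ne', Real.zero_rpow (by positivity : 2 * r ≠ 0)]
      · have hc : f x ^ (r / N) ≠ 0 := by positivity
        refine ⟨(((hH.comp_smul hc).comp_sub_left x).const_mul _), ?_⟩
        rw [integral_const_mul, integral_sub_left_eq_self (fun z => H (f x ^ (r / N) • z)),
          Measure.integral_comp_smul, finrank_euclideanSpace_fin, smul_eq_mul, ← mul_assoc]
        congr 1
        rw [abs_of_nonneg (by positivity), ← Real.rpow_natCast, ← Real.rpow_mul h0.le,
          div_mul_cancel₀ _ hN'.ne', ← Real.rpow_neg h0.le, ← Real.rpow_add h0]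
        congr 1; ring
    refine (integrable_prod_iff hm).2 ⟨Eventually.of_forall fun x => (hcalc x).1, ?_⟩
    refine (hfr.mul_const (∫ w, H w)).congr (Eventually.of_forall fun x => ?_)
    simp only
    rw [← (hcalc x).2]
    refine integral_congr_ae (Eventually.of_forall fun y => ?_)
    simp only
    rw [Real.norm_of_nonneg (mul_nonneg (Real.rpow_nonneg (hf0 x) _) (hlsProfile_nonneg _ _))]
  have I2 := I1.swap
  have I3 : Integrable (fun p : RN N × RN N => f p.1 ^ r * f p.2 ^ r) (volume.prod volume) :=
    hfr.mul_prod hfr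
  refine Integrable.mono' ((I3.add I1).add I2) ?_ (Eventually.of_forall fun p => ?_)
  · exact ((mf1.mul mf2).mul ((ms.norm.pow_const _).inv)).aestronglyMeasurable
  · have h1 := hf0 p.1
    have h2 := hf0 p.2
    have n1 : 0 ≤ f p.1 ^ (2 * r) * H (f p.1 ^ (r / N) • (p.1 - p.2)) :=
      mul_nonneg (Real.rpow_nonneg h1 _) (hlsProfile_nonneg _ _)
    have n2 : 0 ≤ f p.2 ^ (2 * r) * H (f p.2 ^ (r / N) • (p.2 - p.1)) :=
      mul_nonneg (Real.rpow_nonneg h2 _) (hlsProfile_nonneg _ _)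
    rw [Real.norm_of_nonneg (by positivity)]
    simp only [Pi.add_apply, Function.comp_apply, Prod.fst_swap, Prod.snd_swap]
    -- The pointwise bound is used with the larger value first, so `I1` and its swap are both
    -- needed.
    rcases le_total (f p.2) (f p.1) with h | h
    · have := hls_pointwise_aux hN hα hαN hr h2 h (p.1 - p.2)
      linarith
    · have := hls_pointwise_aux hN hα hαN hr h1 h (p.2 - p.1)
      rw [norm_sub_rev p.1 p.2]
      linarith

end HLS

/-! ### Bounded approximations of powers. -/

section TruncatedPower

/-- The bounded `C¹` approximation `|s|^q / (1 + |s|^q / k)` of `|s|^q`. -/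
noncomputable def truncPow (q k s : ℝ) : ℝ := |s| ^ q / (1 + |s| ^ q / k)

variable {q k : ℝ}

lemma truncPow_den_pos (hk : 0 < k) (s : ℝ) : 0 < 1 + |s| ^ q / k := by positivity

lemma truncPow_nonneg (hk : 0 < k) (s : ℝ) : 0 ≤ truncPow q k s :=
  div_nonneg (by positivity) (truncPow_den_pos hk s).le

lemma truncPow_le (hk : 0 < k) (s : ℝ) : truncPow q k s ≤ |s| ^ q :=
  div_le_self (by positivity) (by linarith [show 0 ≤ |s| ^ q / k by positivity])

lemma truncPow_le_const (hk : 0 < k) (s : ℝ) : truncPow q k s ≤ k := by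
  rw [truncPow, div_le_iff₀ (truncPow_den_pos hk s), mul_add, mul_div_cancel₀ _ hk.ne']
  linarith

lemma hasDerivAt_truncPow (hq : 1 < q) (hk : 0 < k) (s : ℝ) :
    HasDerivAt (truncPow q k) (q * |s| ^ (q - 2) * s / (1 + |s| ^ q / k) ^ 2) s := by
  have d1 := hasDerivAt_abs_rpow s hq
  have d2 : HasDerivAt (fun s => 1 + |s| ^ q / k) (q * |s| ^ (q - 2) * s / k) s :=
    (d1.div_const k).const_add 1
  refine (d1.div d2 (truncPow_den_pos hk s).ne').congr_deriv ?_
  have := (truncPow_den_pos (q := q) hk s).ne'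
  field_simp
  ring

lemma abs_rpow_sub_two_mul_abs (hq : 1 < q) (s : ℝ) : |s| ^ (q - 2) * |s| = |s| ^ (q - 1) := by
  rcases (abs_nonneg s).eq_or_lt with h | h
  · rw [← h, mul_zero, Real.zero_rpow (by linarith)]
  · rw [← Real.rpow_add_one h.ne']; congr 1; ring

lemma rpow_sub_one_le (hq : 1 < q) {s : ℝ} (hs : 0 ≤ s) : s ^ (q - 1) ≤ 1 + s ^ q := by
  rcases le_total s 1 with h | h
  · have := Real.rpow_le_one hs h (by linarith : 0 ≤ q - 1)
    linarith [Real.rpow_nonneg hs q]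
  · have := Real.rpow_le_rpow_of_exponent_le h (by linarith : q - 1 ≤ q)
    linarith

lemma abs_deriv_truncPow_le (hq : 1 < q) (hk : 0 < k) (s : ℝ) :
    |deriv (truncPow q k) s| ≤ q * |s| ^ (q - 1) := by
  rw [(hasDerivAt_truncPow hq hk s).deriv, abs_div, abs_mul, abs_mul,
    abs_of_pos (by linarith : 0 < q), abs_of_nonneg (Real.rpow_nonneg (abs_nonneg s) _), mul_assoc,
    abs_rpow_sub_two_mul_abs hq]
  refine div_le_self (by positivity) ?_
  rw [abs_of_nonneg (sq_nonneg _)]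
  exact one_le_pow₀ (by linarith [show 0 ≤ |s| ^ q / k by positivity])

lemma abs_deriv_truncPow_le_const (hq : 1 < q) (hk : 0 < k) (s : ℝ) :
    |deriv (truncPow q k) s| ≤ q * (1 + k) := by
  rw [(hasDerivAt_truncPow hq hk s).deriv, abs_div, abs_mul, abs_mul,
    abs_of_pos (by linarith : 0 < q), abs_of_nonneg (Real.rpow_nonneg (abs_nonneg s) _), mul_assoc,
    abs_rpow_sub_two_mul_abs hq, abs_of_nonneg (sq_nonneg (1 + |s| ^ q / k)), div_le_iff₀ (by positivity), mul_assoc]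
  refine mul_le_mul_of_nonneg_left ?_ (by linarith)
  have h1 := rpow_sub_one_le hq (abs_nonneg s)
  have h2 : 1 + |s| ^ q / k ≤ (1 + |s| ^ q / k) ^ 2 :=
    le_self_pow₀ (by linarith [show 0 ≤ |s| ^ q / k by positivity]) two_ne_zero
  -- One factor of the squared denominator absorbs the growth of `|s|^(q-1)`, at the price of `1 +
  -- k`.
  have h3 : 1 + |s| ^ q ≤ (1 + k) * (1 + |s| ^ q / k) := by
    have : (1 + k) * (1 + |s| ^ q / k) = 1 + |s| ^ q + k + |s| ^ q / k := by field_simp; ring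
    rw [this]
    linarith [show 0 ≤ |s| ^ q / k by positivity]
  calc _ ≤ (1 + k) * (1 + |s| ^ q / k) := h1.trans h3
    _ ≤ _ := mul_le_mul_of_nonneg_left h2 (by linarith)

/-- As `q - 2` may be negative, continuity at `0` is read off from the derivative of the `C¹`
function `|s|^q`. -/
lemma continuous_abs_rpow_sub_two_mul (hq : 1 < q) : Continuous fun s : ℝ => |s| ^ (q - 2) * s := by
  have h : (fun s : ℝ => |s| ^ (q - 2) * s) = fun s => q⁻¹ * deriv (fun s : ℝ => |s| ^ q) s := by
    ext s
    rw [(hasDerivAt_abs_rpow s hq).deriv]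
    have : q ≠ 0 := by linarith
    field_simp
  have hc : ContDiff ℝ 1 fun s : ℝ => |s| ^ q := by
    simpa using contDiff_norm_rpow (E := ℝ) hq
  rw [h]
  exact continuous_const.mul (hc.continuous_deriv le_rfl)

lemma continuous_abs_rpow (hq : 1 < q) : Continuous fun s : ℝ => |s| ^ q :=
  continuous_abs.rpow_const fun _ => Or.inr (by linarith)

lemma contDiff_truncPow (hq : 1 < q) (hk : 0 < k) : ContDiff ℝ 1 (truncPow q k) := by
  rw [contDiff_one_iff_deriv]
  refine ⟨fun s => (hasDerivAt_truncPow hq hk s).differentiableAt, ?_⟩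
  have : deriv (truncPow q k) = fun s => q * (|s| ^ (q - 2) * s) / (1 + |s| ^ q / k) ^ 2 := by
    ext s
    rw [(hasDerivAt_truncPow hq hk s).deriv, mul_assoc]
  rw [this]
  exact (continuous_const.mul (continuous_abs_rpow_sub_two_mul hq)).div
    ((continuous_const.add ((continuous_abs_rpow hq).div_const k)).pow 2)
    fun s => (pow_pos (truncPow_den_pos hk s) 2).ne'

lemma tendsto_truncPow_den (s : ℝ) :
    Tendsto (fun n : ℕ => 1 + |s| ^ q / ((n : ℝ) + 1)) atTop (𝓝 1) := by
  have h : Tendsto (fun n : ℕ => (n : ℝ) + 1) atTop atTop :=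
    tendsto_atTop_add_const_right _ _ tendsto_natCast_atTop_atTop
  simpa using (tendsto_const_nhds (x := (1 : ℝ))).add (h.const_div_atTop (|s| ^ q))

lemma tendsto_truncPow (s : ℝ) :
    Tendsto (fun n : ℕ => truncPow q ((n : ℝ) + 1) s) atTop (𝓝 (|s| ^ q)) := by
  simpa [truncPow, Pi.div_def] using (tendsto_const_nhds (x := |s| ^ q)).div (tendsto_truncPow_den s) one_ne_zero

lemma tendsto_deriv_truncPow (hq : 1 < q) (s : ℝ) :
    Tendsto (fun n : ℕ => deriv (truncPow q ((n : ℝ) + 1)) s) atTop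
      (𝓝 (q * (|s| ^ (q - 2) * s))) := by
  have h := (tendsto_const_nhds (x := q * |s| ^ (q - 2) * s)).div
    ((tendsto_truncPow_den (q := q) s).pow 2) (by norm_num)
  simp only [one_pow, div_one] at h
  rw [← mul_assoc]
  refine h.congr fun n => ?_
  rw [(hasDerivAt_truncPow hq (by positivity) s).deriv]
  rfl

end TruncatedPower

/-! ### Integration by parts for powers of a Sobolev function. -/

section PowerIBP

variable {N : ℕ} {u : RN N → ℝ} {D : RN N → RN N}

/-- The bounded chain rule applies to `truncPow`; its values and derivatives are dominated by those
of `|s|^q`, so the truncation is removed by dominated convergence. -/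
lemma IsWeakGradient.integral_rpow_mul_inner (h : IsWeakGradient u D) (hu : MemLp u 2 volume)
    (hD : MemLp D 2 volume) {q : ℝ} (hq : 1 < q) {Y : RN N → RN N} (hY : ContDiff ℝ 1 Y)
    (hc : HasCompactSupport Y)
    (h1 : Integrable fun x => q * (|u x| ^ (q - 2) * u x) * inner ℝ (D x) (Y x))
    (h2 : Integrable fun x => |u x| ^ q * divergence Y x) :
    ∫ x, q * (|u x| ^ (q - 2) * u x) * inner ℝ (D x) (Y x)
      = - ∫ x, |u x| ^ q * divergence Y x := by
  have mD : AEStronglyMeasurable (fun x => inner ℝ (D x) (Y x)) volume :=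
    hD.aestronglyMeasurable.inner hY.continuous.aestronglyMeasurable
  have L1 : Tendsto (fun n : ℕ => ∫ x, deriv (truncPow q ((n : ℝ) + 1)) (u x) * inner ℝ (D x) (Y x))
      atTop (𝓝 (∫ x, q * (|u x| ^ (q - 2) * u x) * inner ℝ (D x) (Y x))) := by
    refine tendsto_integral_of_dominated_convergence _ (fun n => ?_) h1.norm
      (fun n => Eventually.of_forall fun x => ?_) (Eventually.of_forall fun x => ?_)
    · exact (((contDiff_truncPow hq (by positivity)).continuous_deriv le_rfl).comp_aestronglyMeasurable
        hu.aestronglyMeasurable).mul mD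
    · rw [norm_mul, norm_mul]
      refine mul_le_mul_of_nonneg_right ?_ (norm_nonneg _)
      have := abs_deriv_truncPow_le hq (show (0 : ℝ) < n + 1 by positivity) (u x)
      rw [Real.norm_eq_abs, Real.norm_eq_abs, abs_mul, abs_mul, abs_of_pos (by linarith : 0 < q),
        abs_of_nonneg (Real.rpow_nonneg (abs_nonneg (u x)) _), abs_rpow_sub_two_mul_abs hq]
      exact this
    · exact (tendsto_deriv_truncPow hq (u x)).mul_const _
  have L2 : Tendsto (fun n : ℕ => - ∫ x, truncPow q ((n : ℝ) + 1) (u x) * divergence Y x)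
      atTop (𝓝 (- ∫ x, |u x| ^ q * divergence Y x)) := by
    refine (tendsto_integral_of_dominated_convergence _ (fun n => ?_) h2.norm
      (fun n => Eventually.of_forall fun x => ?_) (Eventually.of_forall fun x => ?_)).neg
    · exact ((contDiff_truncPow hq (by positivity)).continuous.comp_aestronglyMeasurable
        hu.aestronglyMeasurable).mul (continuous_divergence hY).aestronglyMeasurable
    · rw [norm_mul, norm_mul, Real.norm_of_nonneg (truncPow_nonneg (by positivity) _),
        Real.norm_of_nonneg (Real.rpow_nonneg (abs_nonneg (u x)) _)]
      exact mul_le_mul_of_nonneg_right (truncPow_le (by positivity) _) (norm_nonneg _)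
    · exact (tendsto_truncPow (u x)).mul_const _
  refine tendsto_nhds_unique L1 (L2.congr fun n => ?_)
  have hn : (0 : ℝ) < n + 1 := by positivity
  refine (h.integral_deriv_comp_mul_inner hu hD (contDiff_truncPow hq hn)
    (C := max ((n : ℝ) + 1) (q * (1 + ((n : ℝ) + 1)))) (fun s => ?_) (fun s => ?_) hY hc).symm
  · rw [abs_of_nonneg (truncPow_nonneg hn s)]
    exact (truncPow_le_const hn s).trans (le_max_left _ _)
  · exact (abs_deriv_truncPow_le_const hq hn s).trans (le_max_right _ _)

end PowerIBP

/-! ### The regularised Riesz kernel. -/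

section RegKernel

variable {N : ℕ}

/-- The regularised kernel `(|z|² + ε)^{-λ/2}`. -/
noncomputable def regKernel (lam ε : ℝ) (z : RN N) : ℝ := (‖z‖ ^ 2 + ε) ^ (-(lam / 2))

variable {lam ε : ℝ}

lemma regKernel_pos (hε : 0 < ε) (z : RN N) : 0 < regKernel lam ε z :=
  Real.rpow_pos_of_pos (by positivity) _

lemma contDiff_regKernel (hε : 0 < ε) : ContDiff ℝ 1 (regKernel (N := N) lam ε) :=
  ((contDiff_norm_sq ℝ).add contDiff_const).rpow_const_of_ne fun z => by positivity

lemma fderiv_regKernel (hε : 0 < ε) (z v : RN N) : fderiv ℝ (regKernel lam ε) z v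
    = -(lam * ((‖z‖ ^ 2 + ε) ^ (-(lam / 2) - 1) * inner ℝ z v)) := by
  have d1 : HasFDerivAt (fun x : RN N => ‖x‖ ^ 2 + ε) (2 • innerSL ℝ z) z := by
    simpa using ((hasStrictFDerivAt_norm_sq z).hasFDerivAt).add_const ε
  have d2 : fderiv ℝ (regKernel lam ε) z = _ :=
    (d1.rpow_const (p := -(lam / 2)) (Or.inl (by positivity))).fderiv
  rw [d2]
  simp
  ring

lemma regKernel_le (hlam : 0 < lam) (hε : 0 < ε) {z : RN N} (hz : z ≠ 0) :
    regKernel lam ε z ≤ (‖z‖ ^ lam)⁻¹ := by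
  have hz' : 0 < ‖z‖ := norm_pos_iff.2 hz
  have e : (‖z‖ ^ lam)⁻¹ = (‖z‖ ^ 2) ^ (-(lam / 2)) := by
    rw [← Real.rpow_natCast, ← Real.rpow_mul hz'.le, ← Real.rpow_neg hz'.le]
    congr 1; push_cast; ring
  rw [e, regKernel]
  exact Real.rpow_le_rpow_of_nonpos (by positivity) (by linarith) (by linarith)

lemma regKernel_le_const (hlam : 0 < lam) (hε : 0 < ε) (z : RN N) :
    regKernel lam ε z ≤ ε ^ (-(lam / 2)) :=
  Real.rpow_le_rpow_of_nonpos hε (by linarith [sq_nonneg ‖z‖]) (by linarith)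

/-- Used with `z = x - y` and `v = X(x) - X(y)`, where the Lipschitz constant of `X` serves as `L`
for all `ε`. -/
lemma abs_fderiv_regKernel_le (hlam : 0 < lam) (hε : 0 < ε) {z v : RN N} {L : ℝ}
    (hL : |inner ℝ z v| ≤ L * (‖z‖ ^ 2 + ε)) :
    |fderiv ℝ (regKernel lam ε) z v| ≤ lam * L * regKernel lam ε z := by
  have hp : 0 < ‖z‖ ^ 2 + ε := by positivity
  rw [fderiv_regKernel hε, abs_neg, abs_mul, abs_mul, abs_of_pos hlam,
    abs_of_pos (Real.rpow_pos_of_pos hp _), mul_assoc]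
  refine mul_le_mul_of_nonneg_left ?_ hlam.le
  calc _ ≤ (‖z‖ ^ 2 + ε) ^ (-(lam / 2) - 1) * (L * (‖z‖ ^ 2 + ε)) :=
        mul_le_mul_of_nonneg_left hL (Real.rpow_pos_of_pos hp _).le
    _ = L * ((‖z‖ ^ 2 + ε) ^ (-(lam / 2) - 1) * (‖z‖ ^ 2 + ε)) := by ring
    _ = L * regKernel lam ε z := by
        rw [← Real.rpow_add_one hp.ne', regKernel]; congr 2; ring

lemma tendsto_regKernel {z : RN N} (hz : z ≠ 0) {e : ℕ → ℝ} (he : Tendsto e atTop (𝓝 0)) :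
    Tendsto (fun n => regKernel lam (e n) z) atTop (𝓝 (‖z‖ ^ lam)⁻¹) := by
  have hz' : 0 < ‖z‖ := norm_pos_iff.2 hz
  have e0 : (‖z‖ ^ lam)⁻¹ = (‖z‖ ^ 2 + 0) ^ (-(lam / 2)) := by
    rw [add_zero, ← Real.rpow_natCast, ← Real.rpow_mul hz'.le, ← Real.rpow_neg hz'.le]
    congr 1; push_cast; ring
  rw [e0]
  exact (tendsto_const_nhds.add he).rpow_const (Or.inl (by positivity))

lemma tendsto_fderiv_regKernel {z v : RN N} (hz : z ≠ 0) {e : ℕ → ℝ} (he0 : ∀ n, 0 < e n)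
    (he : Tendsto e atTop (𝓝 0)) :
    Tendsto (fun n => fderiv ℝ (regKernel lam (e n)) z v) atTop
      (𝓝 (-(lam * (inner ℝ z v / ‖z‖ ^ 2)) * (‖z‖ ^ lam)⁻¹)) := by
  have hz' : 0 < ‖z‖ := norm_pos_iff.2 hz
  simp_rw [fun n => fderiv_regKernel (lam := lam) (he0 n) z v]
  have e0 : -(lam * (inner ℝ z v / ‖z‖ ^ 2)) * (‖z‖ ^ lam)⁻¹
      = -(lam * ((‖z‖ ^ 2 + 0) ^ (-(lam / 2) - 1) * inner ℝ z v)) := by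
    rw [add_zero, Real.rpow_sub_one (by positivity), ← Real.rpow_natCast, ← Real.rpow_mul hz'.le,
      ← Real.rpow_neg hz'.le]
    have : ((2 : ℕ) : ℝ) * -(lam / 2) = -lam := by push_cast; ring
    rw [this]; ring
  rw [e0]
  refine ((Tendsto.mul_const _ ?_).const_mul lam).neg
  exact (tendsto_const_nhds.add he).rpow_const (Or.inl (by positivity))

lemma exists_norm_le_sq_add (hε : 0 < ε) : ∃ C : ℝ, 0 ≤ C ∧ ∀ z : RN N, ‖z‖ ≤ C * (‖z‖ ^ 2 + ε) := by
  refine ⟨1 + 1 / ε, by positivity, fun z => ?_⟩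
  have h : (1 + 1 / ε) * (‖z‖ ^ 2 + ε) = ‖z‖ ^ 2 + ‖z‖ ^ 2 / ε + ε + 1 := by field_simp; ring
  rw [h]
  have : 0 ≤ ‖z‖ ^ 2 / ε := by positivity
  nlinarith [sq_nonneg (‖z‖ - 1)]

/-- On the diagonal `0⁻¹ = 0` gives the Riesz kernel the wrong value, and its comparison with
`regKernel` fails there. -/
lemma ae_fst_ne_snd (hN : 0 < N) :
    ∀ᵐ p : RN N × RN N ∂(volume.prod volume), p.1 - p.2 ≠ 0 := by
  have : Nonempty (Fin N) := ⟨⟨0, hN⟩⟩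
  have : Nontrivial (RN N) := inferInstance
  have hs : MeasurableSet {p : RN N × RN N | p.1 - p.2 = 0} :=
    measurableSet_eq_fun (measurable_fst.sub measurable_snd) measurable_const
  have h : (volume.prod volume) {p : RN N × RN N | p.1 - p.2 = 0} = 0 := by
    rw [Measure.measure_prod_null hs]
    refine Eventually.of_forall fun x => ?_
    have : Prod.mk x ⁻¹' {p : RN N × RN N | p.1 - p.2 = 0} = {x} := by
      ext y; simp [sub_eq_zero, eq_comm]
    simp only [this]
    simp
  rw [ae_iff]
  simpa using h

end RegKernel

/-! ### The Riesz double integral under integration by parts. -/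

section RieszForm

variable {N : ℕ} {α r : ℝ}

lemma integrable_mul_mul_rieszKernel_of_memLp (hN : 0 < N) (hα : 0 < α) (hαN : α < N)
    (hr : r = 2 * N / (N + α)) {f g : RN N → ℝ} (hf : MemLp f (ENNReal.ofReal r) volume)
    (hg : MemLp g (ENNReal.ofReal r) volume) :
    Integrable (fun p : RN N × RN N => f p.1 * g p.2 * (‖p.1 - p.2‖ ^ ((N : ℝ) - α))⁻¹)
      (volume.prod volume) := by
  have hN' : (0 : ℝ) < N := by exact_mod_cast hN
  have hrpos : 0 < r := by rw [hr]; positivity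
  have hF : MemLp (fun x => |f x| + |g x|) (ENNReal.ofReal r) volume := hf.abs.add hg.abs
  have hFr : Integrable fun x => (|f x| + |g x|) ^ r := by
    have := hF.integrable_norm_rpow (by simpa using hrpos) ENNReal.ofReal_ne_top
    rw [ENNReal.toReal_ofReal hrpos.le] at this
    refine this.congr (Eventually.of_forall fun x => ?_)
    simp only
    rw [Real.norm_of_nonneg (by positivity)]
  have := integrable_mul_mul_rieszKernel hN hα hαN hr hF.aestronglyMeasurable
    (fun x => by positivity) hFr
  refine this.mono' ?_ (Eventually.of_forall fun p => ?_)
  · exact (hf.aestronglyMeasurable.comp_fst.mul hg.aestronglyMeasurable.comp_snd).mul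
      (((measurable_fst.sub measurable_snd).norm.pow_const _).inv).aestronglyMeasurable
  · rw [norm_mul, norm_mul, Real.norm_eq_abs, Real.norm_eq_abs,
      Real.norm_of_nonneg (by positivity : 0 ≤ (‖p.1 - p.2‖ ^ ((N : ℝ) - α))⁻¹)]
    refine mul_le_mul_of_nonneg_right ?_ (by positivity)
    exact mul_le_mul (by linarith [abs_nonneg (g p.1)]) (by linarith [abs_nonneg (f p.2)])
      (abs_nonneg _) (by positivity)

/-- The symmetrised virial of the Riesz kernel along the field `X`. -/
noncomputable def rieszVirial (lam : ℝ) (X : RN N → RN N) (p : RN N × RN N) : ℝ :=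
  divergence X p.1 + divergence X p.2
    - lam * (inner ℝ (p.1 - p.2) (X p.1 - X p.2) / ‖p.1 - p.2‖ ^ 2)

variable {u : RN N → ℝ} {D : RN N → RN N}

/-- For frozen `y` this is `integral_rpow_mul_inner` with the field `κ(x - y) X(x)`. -/
lemma IsWeakGradient.integral_rpow_mul_comp_sub (h : IsWeakGradient u D)
    (hu : MemLp u 2 volume) (hD : MemLp D 2 volume) {p : ℝ} (hp : 1 < p)
    {X : RN N → RN N} (hX : ContDiff ℝ 1 X) (hXc : HasCompactSupport X)
    (hfl : LocallyIntegrable fun x => |u x| ^ p)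
    (hb1 : Integrable fun x => p * (|u x| ^ (p - 2) * u x) * inner ℝ (D x) (X x))
    {κ : RN N → ℝ} (cκ : ContDiff ℝ 1 κ) {C : ℝ} (hC : ∀ z, ‖κ z‖ ≤ C) (y : RN N) :
    ∫ x, p * (|u x| ^ (p - 2) * u x) * inner ℝ (D x) (X x) * κ (x - y)
      = - ∫ x, |u x| ^ p * (fderiv ℝ κ (x - y) (X x) + κ (x - y) * divergence X x) := by
  have ca : ContDiff ℝ 1 (fun x => κ (x - y)) := by fun_prop
  have e1 : ∀ x, divergence (fun x => κ (x - y) • X x) x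
      = fderiv ℝ κ (x - y) (X x) + κ (x - y) * divergence X x := fun x => by
    rw [divergence_smul (ca.differentiable one_ne_zero x) (hX.differentiable one_ne_zero x),
      fderiv_comp_sub]
  have cY : ContDiff ℝ 1 fun x => κ (x - y) • X x := ca.smul hX
  have hYc : HasCompactSupport fun x => κ (x - y) • X x :=
    HasCompactSupport.smul_left (f := fun x => κ (x - y)) (f' := X) hXc
  have e2 : ∀ x, p * (|u x| ^ (p - 2) * u x) * inner ℝ (D x) (κ (x - y) • X x)
      = p * (|u x| ^ (p - 2) * u x) * inner ℝ (D x) (X x) * κ (x - y) := fun x => by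
    rw [inner_smul_right]; ring
  have j1 : Integrable fun x =>
      p * (|u x| ^ (p - 2) * u x) * inner ℝ (D x) (X x) * κ (x - y) :=
    hb1.mul_bdd (c := C) ca.continuous.aestronglyMeasurable
      (Eventually.of_forall fun x => hC _)
  have := h.integral_rpow_mul_inner hu hD hp cY hYc (by simp_rw [e2]; exact j1)
    (hfl.integrable_smul_right_of_hasCompactSupport (continuous_divergence cY)
      (hasCompactSupport_divergence hYc))
  simp_rw [e1, e2] at this
  exact this

/-- Integrate by parts in `x` for each `y`, apply Fubini, and average with the swapped form; `∇κ`
being odd brings in `X(x) - X(y)`. -/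
lemma IsWeakGradient.integral_regKernel (hN : 0 < N) (h : IsWeakGradient u D)
    (hu : MemLp u 2 volume) (hD : MemLp D 2 volume) {p : ℝ} (hp : 1 < p)
    (hα : 0 < α) (hαN : α < N) (hr : r = 2 * N / (N + α))
    {X : RN N → RN N} (hX : ContDiff ℝ 1 X) (hXc : HasCompactSupport X)
    (hf : MemLp (fun x => |u x| ^ p) (ENNReal.ofReal r) volume)
    (hb : MemLp (fun x => p * (|u x| ^ (p - 2) * u x) * inner ℝ (D x) (X x))
      (ENNReal.ofReal r) volume)
    (hb1 : Integrable fun x => p * (|u x| ^ (p - 2) * u x) * inner ℝ (D x) (X x))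
    {ε : ℝ} (hε : 0 < ε) :
    ∫ z : RN N × RN N, (p * (|u z.1| ^ (p - 2) * u z.1) * inner ℝ (D z.1) (X z.1)) * |u z.2| ^ p *
        regKernel ((N : ℝ) - α) ε (z.1 - z.2) ∂(volume.prod volume)
      = -(1 / 2) * ∫ z : RN N × RN N, |u z.1| ^ p * |u z.2| ^ p *
        (regKernel ((N : ℝ) - α) ε (z.1 - z.2) * (divergence X z.1 + divergence X z.2) +
          fderiv ℝ (regKernel ((N : ℝ) - α) ε) (z.1 - z.2) (X z.1 - X z.2))
          ∂(volume.prod volume) := by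
  set lam := (N : ℝ) - α with hlamdef
  have hlam : 0 < lam := by linarith
  have hN' : (0 : ℝ) < N := by exact_mod_cast hN
  have hr1 : 1 ≤ r := by rw [hr, le_div_iff₀ (by positivity)]; linarith
  set b : RN N → ℝ := fun x => p * (|u x| ^ (p - 2) * u x) * inner ℝ (D x) (X x) with hbdef
  set f : RN N → ℝ := fun x => |u x| ^ p with hfdef
  have hfl : LocallyIntegrable f := hf.locallyIntegrable (by simpa using hr1)
  set κ : RN N → ℝ := regKernel lam ε with hκ
  have cκ : ContDiff ℝ 1 κ := contDiff_regKernel hε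
  have cdκ : Continuous (fderiv ℝ κ) := cκ.continuous_fderiv one_ne_zero
  have κ0 : ∀ z, 0 ≤ κ z := fun z => (regKernel_pos hε z).le
  have cdiv := continuous_divergence hX
  obtain ⟨B, hB0, hB⟩ := exists_bound_of_hasCompactSupport hX.continuous hXc
  obtain ⟨d, hd0, hd⟩ := exists_bound_of_hasCompactSupport cdiv (hasCompactSupport_divergence hXc)
  -- The constant `C` depends on `ε`. It serves only for integrability before symmetrisation, where
  -- `X(x)` alone meets `∇κ`.
  obtain ⟨C, hC0, hC⟩ := exists_norm_le_sq_add (N := N) hε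
  have hff := integrable_mul_mul_rieszKernel_of_memLp hN hα hαN hr hf hf
  have hbf := integrable_mul_mul_rieszKernel_of_memLp hN hα hαN hr hb hf
  have ne := ae_fst_ne_snd hN
  have hdκ : ∀ z v : RN N, |fderiv ℝ κ z v| ≤ lam * (C * ‖v‖) * κ z := fun z v => by
    refine abs_fderiv_regKernel_le hlam hε ((abs_real_inner_le_norm _ _).trans ?_)
    have := mul_le_mul_of_nonneg_right (hC z) (norm_nonneg v)
    linarith
  have csub : Continuous fun z : RN N × RN N => z.1 - z.2 := continuous_fst.sub continuous_snd
  have mκ : AEStronglyMeasurable (fun z : RN N × RN N => κ (z.1 - z.2)) (volume.prod volume) :=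
    (cκ.continuous.comp csub).aestronglyMeasurable
  have mff : AEStronglyMeasurable (fun z : RN N × RN N => f z.1 * f z.2) (volume.prod volume) :=
    hf.aestronglyMeasurable.comp_fst.mul hf.aestronglyMeasurable.comp_snd
  have f0 : ∀ x, 0 ≤ f x := fun x => by rw [hfdef]; positivity
  have Ib : Integrable (fun z : RN N × RN N => b z.1 * f z.2 * κ (z.1 - z.2))
      (volume.prod volume) := by
    refine hbf.mono ((hb.aestronglyMeasurable.comp_fst.mul hf.aestronglyMeasurable.comp_snd).mul mκ) ?_
    filter_upwards [ne] with z hz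
    rw [norm_mul, norm_mul _ (‖z.1 - z.2‖ ^ lam)⁻¹, Real.norm_of_nonneg (κ0 _),
      Real.norm_of_nonneg (by positivity : 0 ≤ (‖z.1 - z.2‖ ^ lam)⁻¹)]
    exact mul_le_mul_of_nonneg_left (regKernel_le hlam hε hz) (norm_nonneg _)
  have Igen : ∀ (F : RN N × RN N → ℝ) (c : ℝ), Continuous F → (∀ z, |F z| ≤ c * κ (z.1 - z.2)) →
      Integrable (fun z : RN N × RN N => f z.1 * f z.2 * F z) (volume.prod volume) := by
    intro F c hF hFc
    refine (hff.const_mul c).mono' (mff.mul hF.aestronglyMeasurable) ?_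
    filter_upwards [ne] with z hz
    have hff0 : 0 ≤ f z.1 * f z.2 := mul_nonneg (f0 _) (f0 _)
    rw [norm_mul, Real.norm_of_nonneg hff0]
    have hc : 0 ≤ c := by
      have h1 := (abs_nonneg _).trans (hFc z)
      exact nonneg_of_mul_nonneg_left h1 (regKernel_pos hε _)
    calc f z.1 * f z.2 * ‖F z‖ ≤ f z.1 * f z.2 * (c * κ (z.1 - z.2)) :=
          mul_le_mul_of_nonneg_left (hFc z) hff0
      _ ≤ f z.1 * f z.2 * (c * (‖z.1 - z.2‖ ^ lam)⁻¹) :=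
          mul_le_mul_of_nonneg_left (mul_le_mul_of_nonneg_left (regKernel_le hlam hε hz) hc) hff0
      _ = _ := by ring
  have cX1 : Continuous fun z : RN N × RN N => X z.1 := hX.continuous.comp continuous_fst
  have cX2 : Continuous fun z : RN N × RN N => X z.2 := hX.continuous.comp continuous_snd
  have cF : ∀ V : RN N × RN N → RN N, Continuous V →
      Continuous fun z : RN N × RN N => fderiv ℝ κ (z.1 - z.2) (V z) := fun V hV =>
    (cdκ.comp csub).clm_apply hV
  have cG1 : Continuous fun z : RN N × RN N => κ (z.1 - z.2) * divergence X z.1 :=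
    (cκ.continuous.comp csub).mul (cdiv.comp continuous_fst)
  have bF : ∀ x y, |fderiv ℝ κ (x - y) (X x)| ≤ lam * (C * B) * κ (x - y) := fun x y =>
    (hdκ _ _).trans (mul_le_mul_of_nonneg_right (mul_le_mul_of_nonneg_left
      (mul_le_mul_of_nonneg_left (hB _) hC0) hlam.le) (κ0 _))
  have bG : ∀ x y, |κ (x - y) * divergence X x| ≤ d * κ (x - y) := fun x y => by
    rw [abs_mul, abs_of_nonneg (κ0 _), mul_comm]
    exact mul_le_mul_of_nonneg_right (hd _) (κ0 _)
  have I1 : Integrable (fun z : RN N × RN N => f z.1 * f z.2 *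
      (fderiv ℝ κ (z.1 - z.2) (X z.1) + κ (z.1 - z.2) * divergence X z.1)) (volume.prod volume) := by
    refine Igen _ (lam * (C * B) + d) ((cF _ cX1).add cG1) fun z => ?_
    refine (abs_add_le _ _).trans ?_
    rw [add_mul]
    exact add_le_add (bF _ _) (bG _ _)
  have odd : ∀ x y v, fderiv ℝ κ (y - x) v = - fderiv ℝ κ (x - y) v := fun x y v => by
    rw [hκ, fderiv_regKernel hε, fderiv_regKernel hε, norm_sub_rev y x, ← neg_sub x y,
      inner_neg_left]
    ring
  have even : ∀ x y, κ (y - x) = κ (x - y) := fun x y => by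
    rw [hκ, regKernel, regKernel, norm_sub_rev]
  have slice : ∀ y, ∫ x, b x * f y * κ (x - y)
      = - ∫ x, f x * f y * (fderiv ℝ κ (x - y) (X x) + κ (x - y) * divergence X x) := by
    intro y
    have key := h.integral_rpow_mul_comp_sub hu hD hp hX hXc hfl hb1 cκ
      (C := ε ^ (-(lam / 2))) (fun z => by
        rw [Real.norm_of_nonneg (κ0 _)]; exact regKernel_le_const hlam hε _) y
    have t1 : ∫ x, b x * f y * κ (x - y) = f y * ∫ x, b x * κ (x - y) := by
      rw [← integral_const_mul]
      exact integral_congr_ae (Eventually.of_forall fun x => by ring)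
    have t2 : ∫ x, f x * f y * (fderiv ℝ κ (x - y) (X x) + κ (x - y) * divergence X x)
        = f y * ∫ x, f x * (fderiv ℝ κ (x - y) (X x) + κ (x - y) * divergence X x) := by
      rw [← integral_const_mul]
      exact integral_congr_ae (Eventually.of_forall fun x => by ring)
    rw [t1, t2, key, mul_neg]
  have E1 : ∫ z : RN N × RN N, b z.1 * f z.2 * κ (z.1 - z.2) ∂(volume.prod volume)
      = - ∫ z : RN N × RN N, f z.1 * f z.2 *
        (fderiv ℝ κ (z.1 - z.2) (X z.1) + κ (z.1 - z.2) * divergence X z.1)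
        ∂(volume.prod volume) := by
    rw [integral_prod_symm _ Ib, integral_prod_symm _ I1, ← integral_neg]
    exact integral_congr_ae (Eventually.of_forall slice)
  have I2 : Integrable (fun z : RN N × RN N => f z.1 * f z.2 *
      (-fderiv ℝ κ (z.1 - z.2) (X z.2) + κ (z.1 - z.2) * divergence X z.2)) (volume.prod volume) := by
    refine I1.swap.congr (Eventually.of_forall fun z => ?_)
    simp only [Function.comp_apply, Prod.fst_swap, Prod.snd_swap]
    rw [odd, even]; ring
  have E2 : ∫ z : RN N × RN N, f z.1 * f z.2 *
        (fderiv ℝ κ (z.1 - z.2) (X z.1) + κ (z.1 - z.2) * divergence X z.1) ∂(volume.prod volume)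
      = ∫ z : RN N × RN N, f z.1 * f z.2 *
        (-fderiv ℝ κ (z.1 - z.2) (X z.2) + κ (z.1 - z.2) * divergence X z.2)
        ∂(volume.prod volume) := by
    rw [← integral_prod_swap]
    refine integral_congr_ae (Eventually.of_forall fun z => ?_)
    simp only [Prod.fst_swap, Prod.snd_swap]
    rw [odd, even]; ring
  have E3 : ∫ z : RN N × RN N, f z.1 * f z.2 * (κ (z.1 - z.2) * (divergence X z.1 + divergence X z.2)
        + fderiv ℝ κ (z.1 - z.2) (X z.1 - X z.2)) ∂(volume.prod volume)
      = ∫ z : RN N × RN N, (f z.1 * f z.2 *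
        (fderiv ℝ κ (z.1 - z.2) (X z.1) + κ (z.1 - z.2) * divergence X z.1) + f z.1 * f z.2 *
        (-fderiv ℝ κ (z.1 - z.2) (X z.2) + κ (z.1 - z.2) * divergence X z.2))
        ∂(volume.prod volume) := by
    refine integral_congr_ae (Eventually.of_forall fun z => ?_)
    simp only [map_sub]; ring
  rw [integral_add I1 I2, ← E2] at E3
  rw [E1, E3]
  ring

/-- The limit `ε → 0` of the regularised identity; after symmetrisation both sides are dominated,
uniformly in `ε`, by functions integrable by Hardy–Littlewood–Sobolev. -/
lemma IsWeakGradient.integral_rieszKernel (hN : 0 < N) (h : IsWeakGradient u D)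
    (hu : MemLp u 2 volume) (hD : MemLp D 2 volume) {p : ℝ} (hp : 1 < p)
    (hα : 0 < α) (hαN : α < N) (hr : r = 2 * N / (N + α))
    {X : RN N → RN N} (hX : ContDiff ℝ 1 X) (hXc : HasCompactSupport X)
    (hf : MemLp (fun x => |u x| ^ p) (ENNReal.ofReal r) volume)
    (hb : MemLp (fun x => p * (|u x| ^ (p - 2) * u x) * inner ℝ (D x) (X x))
      (ENNReal.ofReal r) volume)
    (hb1 : Integrable fun x => p * (|u x| ^ (p - 2) * u x) * inner ℝ (D x) (X x)) :
    ∫ z : RN N × RN N, (p * (|u z.1| ^ (p - 2) * u z.1) * inner ℝ (D z.1) (X z.1)) * |u z.2| ^ p *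
        (‖z.1 - z.2‖ ^ ((N : ℝ) - α))⁻¹ ∂(volume.prod volume)
      = -(1 / 2) * ∫ z : RN N × RN N, |u z.1| ^ p * |u z.2| ^ p * (‖z.1 - z.2‖ ^ ((N : ℝ) - α))⁻¹ *
        rieszVirial ((N : ℝ) - α) X z ∂(volume.prod volume) := by
  set lam := (N : ℝ) - α with hlamdef
  have hlam : 0 < lam := by linarith
  obtain ⟨d, hd0, hd⟩ := exists_bound_of_hasCompactSupport (continuous_divergence hX)
    (hasCompactSupport_divergence hXc)
  obtain ⟨L, hL0, hL⟩ := exists_lipschitz_bound hX hXc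
  have hff := integrable_mul_mul_rieszKernel_of_memLp hN hα hαN hr hf hf
  have hbf := integrable_mul_mul_rieszKernel_of_memLp hN hα hαN hr hb hf
  have ne := ae_fst_ne_snd hN
  set e : ℕ → ℝ := fun n => 1 / ((n : ℝ) + 1) with he
  have he0 : ∀ n, 0 < e n := fun n => by rw [he]; positivity
  have het : Tendsto e atTop (𝓝 0) := tendsto_one_div_add_atTop_nhds_zero_nat
  have csub : Continuous fun z : RN N × RN N => z.1 - z.2 := continuous_fst.sub continuous_snd
  have mκ : ∀ n, AEStronglyMeasurable (fun z : RN N × RN N => regKernel lam (e n) (z.1 - z.2))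
      (volume.prod volume) := fun n =>
    ((contDiff_regKernel (he0 n)).continuous.comp csub).aestronglyMeasurable
  have cdiv := continuous_divergence hX
  have L1 : Tendsto (fun n => ∫ z : RN N × RN N, (p * (|u z.1| ^ (p - 2) * u z.1) *
        inner ℝ (D z.1) (X z.1)) * |u z.2| ^ p * regKernel lam (e n) (z.1 - z.2)
        ∂(volume.prod volume)) atTop
      (𝓝 (∫ z : RN N × RN N, (p * (|u z.1| ^ (p - 2) * u z.1) * inner ℝ (D z.1) (X z.1)) *
        |u z.2| ^ p * (‖z.1 - z.2‖ ^ lam)⁻¹ ∂(volume.prod volume))) := by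
    refine tendsto_integral_of_dominated_convergence _ (fun n => ?_) hbf.norm (fun n => ?_) ?_
    · exact (hb.aestronglyMeasurable.comp_fst.mul hf.aestronglyMeasurable.comp_snd).mul (mκ n)
    · filter_upwards [ne] with z hz
      rw [norm_mul, norm_mul _ (‖z.1 - z.2‖ ^ lam)⁻¹, Real.norm_of_nonneg (regKernel_pos (he0 n) _).le,
        Real.norm_of_nonneg (by positivity : 0 ≤ (‖z.1 - z.2‖ ^ lam)⁻¹)]
      exact mul_le_mul_of_nonneg_left (regKernel_le hlam (he0 n) hz) (norm_nonneg _)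
    · filter_upwards [ne] with z hz
      exact (tendsto_regKernel hz het).const_mul _
  have L2 : Tendsto (fun n => -(1 / 2) * ∫ z : RN N × RN N, |u z.1| ^ p * |u z.2| ^ p *
        (regKernel lam (e n) (z.1 - z.2) * (divergence X z.1 + divergence X z.2) +
          fderiv ℝ (regKernel lam (e n)) (z.1 - z.2) (X z.1 - X z.2)) ∂(volume.prod volume)) atTop
      (𝓝 (-(1 / 2) * ∫ z : RN N × RN N, |u z.1| ^ p * |u z.2| ^ p * (‖z.1 - z.2‖ ^ lam)⁻¹ *
        rieszVirial lam X z ∂(volume.prod volume))) := by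
    refine Tendsto.const_mul _ (tendsto_integral_of_dominated_convergence _ (fun n => ?_)
      (hff.norm.const_mul (2 * d + lam * L)) (fun n => ?_) ?_)
    · refine (hf.aestronglyMeasurable.comp_fst.mul hf.aestronglyMeasurable.comp_snd).mul
        (((mκ n).mul ((cdiv.comp continuous_fst).add (cdiv.comp continuous_snd)).aestronglyMeasurable).add
        ?_)
      exact ((((contDiff_regKernel (he0 n)).continuous_fderiv one_ne_zero).comp csub).clm_apply
        ((hX.continuous.comp continuous_fst).sub (hX.continuous.comp continuous_snd))).aestronglyMeasurable
    · filter_upwards [ne] with z hz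
      have hk : 0 ≤ (‖z.1 - z.2‖ ^ lam)⁻¹ := by positivity
      have hκ0 := (regKernel_pos (lam := lam) (he0 n) (z.1 - z.2)).le
      have hκ := regKernel_le hlam (he0 n) hz
      -- Here the Lipschitz bound on `X` cancels the extra singularity of the gradient.
      have b2 : |fderiv ℝ (regKernel lam (e n)) (z.1 - z.2) (X z.1 - X z.2)|
          ≤ lam * L * regKernel lam (e n) (z.1 - z.2) := by
        refine abs_fderiv_regKernel_le hlam (he0 n) ((abs_real_inner_le_norm _ _).trans ?_)
        have h1 := mul_le_mul_of_nonneg_left (hL z.1 z.2) (norm_nonneg (z.1 - z.2))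
        have h2 := mul_nonneg hL0 (he0 n).le
        nlinarith
      have b1 : |regKernel lam (e n) (z.1 - z.2) * (divergence X z.1 + divergence X z.2)|
          ≤ 2 * d * regKernel lam (e n) (z.1 - z.2) := by
        rw [abs_mul, abs_of_nonneg hκ0, mul_comm]
        refine mul_le_mul_of_nonneg_right ((abs_add_le _ _).trans ?_) hκ0
        have h1 := hd z.1
        have h2 := hd z.2
        rw [Real.norm_eq_abs] at h1 h2
        linarith
      rw [norm_mul, norm_mul _ (‖z.1 - z.2‖ ^ lam)⁻¹, Real.norm_of_nonneg hk, mul_left_comm]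
      refine mul_le_mul_of_nonneg_left ?_ (norm_nonneg _)
      calc _ ≤ (2 * d + lam * L) * regKernel lam (e n) (z.1 - z.2) := by
            rw [add_mul]; exact (abs_add_le _ _).trans (add_le_add b1 b2)
        _ ≤ _ := mul_le_mul_of_nonneg_left hκ (by positivity)
    · filter_upwards [ne] with z hz
      rw [mul_assoc (_ * _)]
      refine Tendsto.const_mul _ ?_
      have := ((tendsto_regKernel (lam := lam) hz het).mul_const
        (divergence X z.1 + divergence X z.2)).add
        (tendsto_fderiv_regKernel (lam := lam) (v := X z.1 - X z.2) hz he0 het)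
      convert this using 2
      rw [rieszVirial]
      ring
  refine tendsto_nhds_unique L1 (L2.congr fun n => ?_)
  exact (h.integral_regKernel hN hu hD hp hα hαN hr hX hXc hf hb hb1 (he0 n)).symm

end RieszForm

/-! ### Pairings with the Riesz potential. -/

section RieszPotential

variable {N : ℕ} {α r : ℝ}

lemma integrable_mul_rieszPotential (hN : 0 < N) (hα : 0 < α) (hαN : α < N)
    (hr : r = 2 * N / (N + α)) {g f : RN N → ℝ} (hg : MemLp g (ENNReal.ofReal r) volume)
    (hf : MemLp f (ENNReal.ofReal r) volume) :
    Integrable (fun x => g x * rieszPotential α f x) ∧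
      ∫ x, g x * rieszPotential α f x = rieszConst N α *
        ∫ z : RN N × RN N, g z.1 * f z.2 * (‖z.1 - z.2‖ ^ ((N : ℝ) - α))⁻¹
          ∂(volume.prod volume) := by
  have hI := integrable_mul_mul_rieszKernel_of_memLp hN hα hαN hr hg hf
  have e : ∀ x, g x * rieszPotential α f x = rieszConst N α *
      ∫ y, g x * f y * (‖x - y‖ ^ ((N : ℝ) - α))⁻¹ := fun x => by
    rw [rieszPotential, ← integral_const_mul, ← integral_const_mul]
    refine integral_congr_ae (Eventually.of_forall fun y => ?_)
    simp only [rieszKernel]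
    ring
  simp_rw [e]
  refine ⟨hI.integral_prod_left.const_mul _, ?_⟩
  rw [integral_const_mul, integral_prod _ hI]

lemma locallyIntegrable_mul_rieszPotential (hN : 0 < N) (hα : 0 < α) (hαN : α < N)
    (hr : r = 2 * N / (N + α)) {g f : RN N → ℝ} (hg : MemLpLoc g (ENNReal.ofReal r))
    (hf : MemLp f (ENNReal.ofReal r) volume) :
    LocallyIntegrable fun x => g x * rieszPotential α f x := by
  rw [locallyIntegrable_iff]
  intro S hS
  have h := (integrable_mul_rieszPotential hN hα hαN hr
    ((memLp_indicator_iff_restrict hS.measurableSet).2 (hg S hS)) hf).1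
  have e : (fun x => S.indicator g x * rieszPotential α f x)
      = S.indicator fun x => g x * rieszPotential α f x := by
    ext x; by_cases hx : x ∈ S <;> simp [hx]
  rw [e, integrable_indicator_iff hS.measurableSet] at h
  exact h

end RieszPotential

/-! ### Integrability of the nonlinear terms. -/

section Powers

variable {N : ℕ} {p r : ℝ}

lemma memLp_norm_rpow {X F : Type*} [MeasurableSpace X] {μ : Measure X} [NormedAddCommGroup F]
    {f : X → F} (hp : 0 < p) (hf : MemLp f (ENNReal.ofReal (p * r)) μ) :
    MemLp (fun x => ‖f x‖ ^ p) (ENNReal.ofReal r) μ := by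
  have := hf.norm_rpow_div (ENNReal.ofReal p)
  rw [ENNReal.toReal_ofReal hp.le, ← ENNReal.ofReal_div_of_pos hp,
    mul_div_cancel_left₀ _ hp.ne'] at this
  exact this

lemma memLpLoc_rpow_sub_two_mul {u : RN N → ℝ} (hp : 1 < p)
    (hu : AEStronglyMeasurable u volume)
    (hf : MemLp (fun x => |u x| ^ p) (ENNReal.ofReal r) volume) :
    MemLpLoc (fun x => |u x| ^ (p - 2) * u x) (ENNReal.ofReal r) := by
  intro S hS
  have : IsFiniteMeasure (volume.restrict S) := isFiniteMeasure_restrict.2 hS.measure_lt_top.ne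
  refine ((memLp_const (1 : ℝ)).add (hf.restrict S)).mono'
    ((continuous_abs_rpow_sub_two_mul hp).comp_aestronglyMeasurable hu.restrict)
    (Eventually.of_forall fun x => ?_)
  rw [Real.norm_eq_abs, abs_mul, abs_of_nonneg (Real.rpow_nonneg (abs_nonneg _) _),
    abs_rpow_sub_two_mul_abs hp]
  exact rpow_sub_one_le hp (abs_nonneg _)

lemma rpow_sub_one_mul_le (hp : 1 < p) {a d : ℝ} (ha : 0 ≤ a) (hd : 0 ≤ d) :
    a ^ (p - 1) * d ≤ a ^ p + d ^ p := by
  have hA : 0 ≤ a ^ p := Real.rpow_nonneg ha _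
  have hD : 0 ≤ d ^ p := Real.rpow_nonneg hd _
  have e : ∀ s : ℝ, 0 ≤ s → s ^ (p - 1) * s = s ^ p := fun s hs => by
    rw [← Real.rpow_add_one' hs (by linarith), sub_add_cancel]
  rcases le_total d a with h | h
  · have := mul_le_mul_of_nonneg_left h (Real.rpow_nonneg ha (p - 1))
    rw [e a ha] at this
    linarith
  · have := mul_le_mul_of_nonneg_right (Real.rpow_le_rpow ha h (by linarith : 0 ≤ p - 1)) hd
    rw [e d hd] at this
    linarith

/-- From `|u|^(p-1)|D| ≤ |u|^p + |D|^p` on the support of `X`; this is where the local integrability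
of the gradient to the power `pr` enters. -/
lemma memLp_rpow_mul_inner {u : RN N → ℝ} {D X : RN N → RN N} (hp : 1 < p) (hr1 : 1 ≤ r)
    (hu : AEStronglyMeasurable u volume) (hD : AEStronglyMeasurable D volume)
    (hf : MemLp (fun x => |u x| ^ p) (ENNReal.ofReal r) volume)
    (hDloc : MemLpLoc D (ENNReal.ofReal (p * r))) (hX : Continuous X)
    (hXc : HasCompactSupport X) :
    MemLp (fun x => (|u x| ^ (p - 2) * u x) * inner ℝ (D x) (X x)) (ENNReal.ofReal r) volume ∧
      Integrable fun x => (|u x| ^ (p - 2) * u x) * inner ℝ (D x) (X x) := by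
  obtain ⟨B, hB0, hB⟩ := exists_bound_of_hasCompactSupport hX hXc
  have hS : IsCompact (tsupport X) := hXc
  have mS : MeasurableSet (tsupport X) := hS.measurableSet
  have : IsFiniteMeasure (volume.restrict (tsupport X)) :=
    isFiniteMeasure_restrict.2 hS.measure_lt_top.ne
  have hm : MemLp (fun x => (|u x| ^ (p - 2) * u x) * inner ℝ (D x) (X x)) (ENNReal.ofReal r)
      (volume.restrict (tsupport X)) := by
    refine ((hf.restrict (tsupport X)).add
      (memLp_norm_rpow (by linarith) (hDloc _ hS))).of_le_mul (c := B)
      (((continuous_abs_rpow_sub_two_mul hp).comp_aestronglyMeasurable hu).mul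
        (hD.inner hX.aestronglyMeasurable)).restrict (Eventually.of_forall fun x => ?_)
    have h0 : 0 ≤ |u x| ^ (p - 1) := Real.rpow_nonneg (abs_nonneg _) _
    have h1 := rpow_sub_one_mul_le hp (abs_nonneg (u x)) (norm_nonneg (D x))
    have h2 : |inner ℝ (D x) (X x)| ≤ ‖D x‖ * B :=
      (abs_real_inner_le_norm _ _).trans (mul_le_mul_of_nonneg_left (hB x) (norm_nonneg _))
    simp only [Pi.add_apply]
    rw [Real.norm_eq_abs, Real.norm_of_nonneg (by positivity), abs_mul, abs_mul,
      abs_of_nonneg (Real.rpow_nonneg (abs_nonneg _) _), abs_rpow_sub_two_mul_abs hp]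
    calc _ ≤ |u x| ^ (p - 1) * (‖D x‖ * B) := mul_le_mul_of_nonneg_left h2 h0
      _ = B * (|u x| ^ (p - 1) * ‖D x‖) := by ring
      _ ≤ _ := mul_le_mul_of_nonneg_left h1 hB0
  have e : (tsupport X).indicator (fun x => (|u x| ^ (p - 2) * u x) * inner ℝ (D x) (X x))
      = fun x => (|u x| ^ (p - 2) * u x) * inner ℝ (D x) (X x) := by
    rw [indicator_eq_self]
    intro x hx
    by_contra h
    exact hx (by simp [image_eq_zero_of_notMem_tsupport h])
  constructor
  · rw [← e]; exact (memLp_indicator_iff_restrict mS).2 hm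
  · rw [← e]
    refine (integrable_indicator_iff mS).2 ?_
    exact memLp_one_iff_integrable.1 (hm.mono_exponent (by simpa using hr1))

end Powers

/-! ### The equation tested with a transported solution. -/

section EllipticIdentity

variable {N : ℕ} {u h : RN N → ℝ} {D : RN N → RN N}

lemma IsWeakGradient.memLpLoc_of_equation (hw : IsWeakGradient u D) (hu : MemLp u 2 volume)
    (hH : ∀ i, MemH1Loc fun x => D x i) (hl : LocallyIntegrable h)
    (heq : ∀ ψ, IsTestFunction ψ →
      (∫ x, inner ℝ (D x) (gradient ψ x)) + (∫ x, u x * ψ x) = ∫ x, h x * ψ x) :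
    MemLpLoc h 2 := by
  choose hD2 g hg hg2 using hH
  have hgl : ∀ i, LocallyIntegrable fun x => g i x i := fun i =>
    (hg i).locallyIntegrable_grad.coord i
  have hsum : LocallyIntegrable fun x => ∑ i, g i x i := by
    rw [locallyIntegrable_iff]
    exact fun S hS => integrable_finsetSum _ fun i _ => locallyIntegrable_iff.1 (hgl i) _ hS
  have hu' := hu.locallyIntegrable_two
  -- `∑ i, g i x i` is the weak Laplacian of `u`, so by the fundamental lemma of the calculus of
  -- variations `h = u - Δu` almost everywhere.
  have key : ∀ᵐ x, h x + ∑ i, g i x i - u x = 0 := by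
    refine ae_eq_zero_of_integral_contDiff_smul_eq_zero ((hl.add hsum).sub hu') fun ψ c1 c2 => ?_
    have hψ : IsTestFunction ψ := ⟨c1, c2⟩
    have I : ∀ {w : RN N → ℝ}, LocallyIntegrable w → Integrable fun x => w x * ψ x :=
      fun hw => hw.integrable_smul_right_of_hasCompactSupport c1.continuous c2
    have I' : ∀ i, Integrable fun x => D x i * fderiv ℝ ψ x (stdVec i) := fun i =>
      (hw.locallyIntegrable_grad.coord i).integrable_smul_right_of_hasCompactSupport
        ((hψ.contDiff_one.continuous_fderiv one_ne_zero).clm_apply continuous_const)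
        ((c2.fderiv ℝ).comp_left (g := fun L : RN N →L[ℝ] ℝ => L (stdVec i)) (by simp))
    have e1 : ∫ x, inner ℝ (D x) (gradient ψ x) = - ∑ i, ∫ x, g i x i * ψ x := by
      simp_rw [inner_eq_sum_coord, gradient_apply]
      rw [integral_finsetSum _ fun i _ => I' i, ← Finset.sum_neg_distrib]
      refine Finset.sum_congr rfl fun i _ => ?_
      rw [(hg i).integral_mul_fderiv hψ i]
      simp_rw [mul_comm]
    have e2 : ∫ x, ψ x • (h x + ∑ i, g i x i - u x)
        = (∫ x, h x * ψ x) + (∑ i, ∫ x, g i x i * ψ x) - ∫ x, u x * ψ x := by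
      have J : Integrable fun x => ∑ i, g i x i * ψ x := integrable_finsetSum _ fun i _ => I (hgl i)
      have JA : Integrable fun x => h x * ψ x + ∑ i, g i x i * ψ x := (I hl).add J
      rw [← integral_finsetSum _ fun i _ => I (hgl i), ← integral_add (I hl) J,
        ← integral_sub JA (I hu')]
      refine integral_congr_ae (Eventually.of_forall fun x => ?_)
      simp only [smul_eq_mul]
      rw [← Finset.sum_mul]
      ring
    rw [e2, ← heq ψ hψ, e1]
    ring
  intro S hS
  have hM : MemLp (fun x => u x - ∑ i, g i x i) 2 (volume.restrict S) := by
    refine (hu.restrict S).sub (memLp_finsetSum _ fun i _ => ?_)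
    exact (EuclideanSpace.proj (𝕜 := ℝ) i : RN N →L[ℝ] ℝ).comp_memLp' (hg2 i S hS)
  refine hM.ae_eq (ae_restrict_of_ae ?_)
  filter_upwards [key] with x hx
  linarith

/-- Test with `X·∇u_t` and let `t → 0`: the left side converges by the commutator lemma for `D` and
for `u`, the right side because `h X ∈ L²` and `(D_i)_t → D_i` in L². -/
lemma IsWeakGradient.stressForm_sub_eq (hw : IsWeakGradient u D) (hu : MemLp u 2 volume)
    (hD : MemLp D 2 volume) (h2 : MemLpLoc h 2)
    (heq : ∀ ψ, IsTestFunction ψ →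
      (∫ x, inner ℝ (D x) (gradient ψ x)) + (∫ x, u x * ψ x) = ∫ x, h x * ψ x)
    {X : RN N → RN N} (hX : ContDiff ℝ ∞ X) (hXc : HasCompactSupport X) :
    Integrable (fun x => h x * inner ℝ (D x) (X x)) ∧
    stressForm X D - 1 / 2 * ∫ x, divergence X x * u x ^ 2
      = ∫ x, h x * inner ℝ (D x) (X x) := by
  obtain ⟨η, ζ, hη⟩ := exists_isMollifierPair N
  have hX1 : ContDiff ℝ 1 X := hX.of_le (by exact_mod_cast le_top)
  obtain ⟨B, hB0, hB⟩ := exists_bound_of_hasCompactSupport hX.continuous hXc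
  have hS : IsCompact (tsupport X) := hXc
  have mhX : ∀ i, MemLp (fun x => h x * X x i) 2 volume := fun i => by
    have e : (tsupport X).indicator (fun x => h x * X x i) = fun x => h x * X x i := by
      rw [indicator_eq_self]
      intro x hx
      by_contra hn
      exact hx (by simp [image_eq_zero_of_notMem_tsupport hn])
    rw [← e]
    refine (memLp_indicator_iff_restrict hS.measurableSet).2 ?_
    refine (h2 _ hS).of_le_mul (c := B) ((h2 _ hS).aestronglyMeasurable.mul
      (contDiff_coord hX i).continuous.aestronglyMeasurable) (Eventually.of_forall fun x => ?_)
    rw [norm_mul, mul_comm]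
    exact mul_le_mul_of_nonneg_right ((PiLp.norm_apply_le _ _).trans (hB x)) (norm_nonneg _)
  have T1 := hw.tendsto_integral_inner_gradient hη hD hX hXc
  have T2 := hη.tendsto_integral_mul_fderiv_mollify hu hX1 hXc
  have e : ∀ t, 0 < t → ∫ x, h x * fderiv ℝ (mollify (rescale η t) u) x (X x)
      = ∑ i, ∫ x, (h x * X x i) * mollify (rescale η t) (fun y => D y i) x := fun t ht => by
    simp_rw [hw.fderiv_mollify_apply (hη.isTestFunction_rescale ht), Finset.mul_sum, ← mul_assoc]
    exact integral_finsetSum _ fun i _ =>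
      (mhX i).integrable_mul_two (hη.memLp_mollify (hD.coord i) ht)
  have I : ∀ i, Integrable fun x => (h x * X x i) * D x i := fun i =>
    (mhX i).integrable_mul_two (hD.coord i)
  have e0 : (fun x => h x * inner ℝ (D x) (X x)) = fun x => ∑ i, (h x * X x i) * D x i := by
    ext x
    rw [inner_eq_sum_coord, Finset.mul_sum]
    exact Finset.sum_congr rfl fun i _ => by ring
  have T3 : Tendsto (fun t => ∫ x, h x * fderiv ℝ (mollify (rescale η t) u) x (X x)) (𝓝[>] 0)
      (𝓝 (∫ x, h x * inner ℝ (D x) (X x))) := by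
    rw [e0, integral_finsetSum _ fun i _ => I i]
    refine Tendsto.congr' ?_ (tendsto_finsetSum _ fun i _ =>
      (mhX i).tendsto_integral_mul (hD.coord i) (l := 𝓝[>] 0) (by
        filter_upwards [self_mem_nhdsWithin] with t ht
        exact hη.memLp_mollify (hD.coord i) ht) (hη.tendsto_integral_sq_mollify_sub (hD.coord i)))
    filter_upwards [self_mem_nhdsWithin] with t ht
    exact (e t ht).symm
  refine ⟨by rw [e0]; exact integrable_finsetSum _ fun i _ => I i, ?_⟩
  have T4 := (T1.add T2).congr' (f₂ := fun t =>
      ∫ x, h x * fderiv ℝ (mollify (rescale η t) u) x (X x)) (by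
    filter_upwards [self_mem_nhdsWithin] with t ht
    exact heq _ (isTestFunction_fderiv_apply
      (hη.contDiff_mollify hw.locallyIntegrable_fun ht) hX hXc))
  have := tendsto_nhds_unique T4 T3
  linarith

end EllipticIdentity

/-! ### Comparison of positive and negative parts. -/

section OneSided

lemma max_mul_le_max_mul {a b s : ℝ} (ha : 0 ≤ a) (hab : a ≤ b) :
    max (a * s) 0 ≤ max (b * s) 0 := by
  rcases le_total 0 s with hs | hs
  · exact max_le_max (mul_le_mul_of_nonneg_right hab hs) le_rfl
  · rw [max_eq_right (mul_nonpos_of_nonneg_of_nonpos ha hs)]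
    exact le_max_right _ _

lemma max_neg_mul_le_max_neg_mul {a b s : ℝ} (ha : 0 ≤ a) (hab : a ≤ b) :
    max (-(a * s)) 0 ≤ max (-(b * s)) 0 := by
  rw [← mul_neg, ← mul_neg]
  exact max_mul_le_max_mul ha hab

lemma integrable_max_or_of_le {X : Type*} [MeasurableSpace X] {μ : Measure X} {V w : X → ℝ}
    (hw : AEStronglyMeasurable w μ) (hpos : ∀ᵐ x ∂μ, max (w x) 0 ≤ max (V x) 0)
    (hneg : ∀ᵐ x ∂μ, max (-w x) 0 ≤ max (-V x) 0)
    (h : Integrable (fun x => max (V x) 0) μ ∨ Integrable (fun x => max (-V x) 0) μ) :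
    Integrable (fun x => max (w x) 0) μ ∨ Integrable (fun x => max (-w x) 0) μ := by
  have m1 : ∀ {v : X → ℝ}, AEStronglyMeasurable v μ → AEStronglyMeasurable (fun x => max (v x) 0) μ :=
    fun hv => (continuous_id.max continuous_const).comp_aestronglyMeasurable hv
  refine h.imp (fun h => h.mono' (m1 hw) ?_) (fun h => h.mono' (m1 hw.neg) ?_)
  · filter_upwards [hpos] with x hx
    rwa [Real.norm_of_nonneg (le_max_right _ _)]
  · filter_upwards [hneg] with x hx
    rwa [Real.norm_of_nonneg (le_max_right _ _)]

end OneSided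

/-! ### The coupling term and the integrand containing `∇K`. -/

section CoupledVirial

variable {N : ℕ} {q : ℝ} {K u φ m χ : RN N → ℝ} {D Dφ : RN N → RN N}

lemma fderiv_apply_smul_self (K χ : RN N → ℝ) (x : RN N) :
    fderiv ℝ K x (χ x • x) = χ x * inner ℝ x (gradient K x) := by
  rw [map_smul, smul_eq_mul, inner_gradient_right_real]

lemma divergence_mul_smul {X : RN N → RN N} (hK : ContDiff ℝ 1 K) (hm : ContDiff ℝ 1 m)
    (hX : ContDiff ℝ 1 X) (x : RN N) : divergence (fun y => (K y * m y) • X y) x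
      = m x * fderiv ℝ K x (X x) + K x * fderiv ℝ m x (X x) + K x * m x * divergence X x := by
  have dK := hK.differentiable one_ne_zero x
  have dm := hm.differentiable one_ne_zero x
  rw [divergence_smul (a := fun y => K y * m y) (dK.mul dm) (hX.differentiable one_ne_zero x),
    fderiv_fun_mul dK dm]
  simp only [add_apply, smul_apply, smul_eq_mul]
  ring

/-- Here `m` is a `C¹` substitute for `φ` lying below it. The chain rule with truncated powers is
applied to the field `K m χ x`, and the truncation is removed: three terms are dominated, while the
one with `∇K` is obtained by the one-sided argument, since `|u|^q` without the weight `K` has no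
integrability of its own. -/
lemma IsWeakGradient.virial_of_le (hw : IsWeakGradient u D) (hu : MemLp u 2 volume)
    (hD : MemLp D 2 volume) (hq : 1 < q) (hK : ContDiff ℝ 1 K) (hK0 : ∀ x, 0 ≤ K x)
    (hm : ContDiff ℝ 1 m) (hm0 : ∀ x, 0 ≤ m x) (hmφ : ∀ᵐ x, m x ≤ φ x)
    (hχ : ContDiff ℝ 1 χ) (hχc : HasCompactSupport χ) (hχ0 : ∀ x, 0 ≤ χ x) (hχ1 : ∀ x, χ x ≤ 1)
    (hf : LocallyIntegrable fun x => K x * |u x| ^ q)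
    (hP : Integrable fun x => K x * |u x| ^ q * φ x)
    (hQ : Integrable fun x => K x * φ x * (|u x| ^ (q - 2) * u x) * inner ℝ (D x) (χ x • x))
    (hV : Integrable (fun x => max (virialDensity q K u φ x) 0) ∨
      Integrable fun x => max (-virialDensity q K u φ x) 0) :
    Integrable (fun x => (m x * |u x| ^ q * χ x) * inner ℝ x (gradient K x)) ∧
    ∫ x, (m x * |u x| ^ q * χ x) * inner ℝ x (gradient K x)
      = -(q * ∫ x, K x * m x * (|u x| ^ (q - 2) * u x) * inner ℝ (D x) (χ x • x))
        - (∫ x, (K x * |u x| ^ q) * fderiv ℝ m x (χ x • x))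
        - ∫ x, K x * |u x| ^ q * m x * divergence (fun y => χ y • y) x := by
  have hX : ContDiff ℝ 1 fun x => χ x • x := hχ.smul contDiff_id
  have hXc : HasCompactSupport fun x => χ x • x :=
    HasCompactSupport.smul_right (f := χ) (f' := fun x => x) hχc
  have mu := hu.aestronglyMeasurable
  have muq : AEStronglyMeasurable (fun x => |u x| ^ q) volume :=
    (continuous_abs_rpow hq).comp_aestronglyMeasurable mu
  have cs : Continuous fun x => inner ℝ x (gradient K x) :=
    continuous_id.inner (continuous_gradient hK)
  have cdm : Continuous fun x => fderiv ℝ m x (χ x • x) :=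
    (hm.continuous_fderiv one_ne_zero).clm_apply hX.continuous
  have cdmc : HasCompactSupport fun x => fderiv ℝ m x (χ x • x) := by
    refine hXc.mono fun x hx => ?_
    contrapose! hx
    simp only [Function.mem_support, not_not] at hx ⊢
    rw [hx, map_zero]
  have cdiv := continuous_divergence hX
  obtain ⟨d, hd0, hd⟩ := exists_bound_of_hasCompactSupport cdiv (hasCompactSupport_divergence hXc)
  have uq0 : ∀ x, 0 ≤ |u x| ^ q := fun x => Real.rpow_nonneg (abs_nonneg _) _
  set G : ℕ → ℝ → ℝ := fun n => truncPow q ((n : ℝ) + 1) with hG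
  have k0 : ∀ n : ℕ, (0 : ℝ) < n + 1 := fun n => by positivity
  have G0 : ∀ n s, 0 ≤ G n s := fun n s => truncPow_nonneg (k0 n) s
  have Gle : ∀ n s, G n s ≤ |s| ^ q := fun n s => truncPow_le (k0 n) s
  have cG : ∀ n, ContDiff ℝ 1 (G n) := fun n => contDiff_truncPow hq (k0 n)
  have mG : ∀ n, AEStronglyMeasurable (fun x => G n (u x)) volume := fun n =>
    (cG n).continuous.comp_aestronglyMeasurable mu
  have Glim : ∀ x, Tendsto (fun n => G n (u x)) atTop (𝓝 (|u x| ^ q)) := fun x =>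
    tendsto_truncPow (u x)
  have A2 : Integrable fun x => (K x * |u x| ^ q) * fderiv ℝ m x (χ x • x) :=
    hf.integrable_smul_right_of_hasCompactSupport cdm cdmc
  have A3' : Integrable fun x => d * (K x * |u x| ^ q * φ x) := hP.const_mul d
  have mKm : AEStronglyMeasurable (fun x => K x * m x) volume :=
    (hK.continuous.mul hm.continuous).aestronglyMeasurable
  -- Since `m ≤ φ`, the integrable coupling density with `φ` dominates.
  have L0 : Tendsto (fun n => ∫ x, deriv (G n) (u x) * inner ℝ (D x) ((K x * m x) • χ x • x)) atTop
      (𝓝 (∫ x, q * (K x * m x * (|u x| ^ (q - 2) * u x) * inner ℝ (D x) (χ x • x)))) := by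
    refine tendsto_integral_of_dominated_convergence _ (fun n => ?_) (hQ.norm.const_mul q)
      (fun n => ?_) (Eventually.of_forall fun x => ?_)
    · exact (((cG n).continuous_deriv le_rfl).comp_aestronglyMeasurable mu).mul
        (hD.aestronglyMeasurable.inner (mKm.smul hX.continuous.aestronglyMeasurable))
    · filter_upwards [hmφ] with x hx
      have h1 := abs_deriv_truncPow_le hq (k0 n) (u x)
      have hφ0 : 0 ≤ φ x := (hm0 x).trans hx
      have hi := abs_nonneg (inner ℝ (D x) (χ x • x))
      have hr := Real.rpow_nonneg (abs_nonneg (u x)) (q - 1)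
      rw [inner_smul_right (D x) (χ x • x) (K x * m x), Real.norm_eq_abs, Real.norm_eq_abs, abs_mul, abs_mul, abs_mul (_ * _ * _),
        abs_mul (K x * φ x), abs_mul (_ ^ _) (u x),
        abs_of_nonneg (Real.rpow_nonneg (abs_nonneg (u x)) _), abs_rpow_sub_two_mul_abs hq,
        abs_of_nonneg (mul_nonneg (hK0 x) (hm0 x)), abs_of_nonneg (mul_nonneg (hK0 x) hφ0)]
      calc _ ≤ (q * |u x| ^ (q - 1)) * (K x * φ x * |inner ℝ (D x) (χ x • x)|) := by
            refine mul_le_mul h1 (mul_le_mul_of_nonneg_right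
              (mul_le_mul_of_nonneg_left hx (hK0 x)) hi)
              (mul_nonneg (mul_nonneg (hK0 x) (hm0 x)) hi) (by positivity)
        _ = _ := by ring
    · have := (tendsto_deriv_truncPow hq (u x)).mul_const (inner ℝ (D x) ((K x * m x) • χ x • x))
      convert this using 2
      rw [inner_smul_right (D x) (χ x • x) (K x * m x)]; ring
  have L2 : Tendsto (fun n => ∫ x, (K x * G n (u x)) * fderiv ℝ m x (χ x • x)) atTop
      (𝓝 (∫ x, (K x * |u x| ^ q) * fderiv ℝ m x (χ x • x))) := by
    refine tendsto_integral_of_dominated_convergence _ (fun n => ?_) A2.norm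
      (fun n => Eventually.of_forall fun x => ?_) (Eventually.of_forall fun x => ?_)
    · exact (hK.continuous.aestronglyMeasurable.mul (mG n)).mul cdm.aestronglyMeasurable
    · rw [norm_mul, norm_mul (_ * _), Real.norm_of_nonneg (mul_nonneg (hK0 x) (G0 n _)),
        Real.norm_of_nonneg (mul_nonneg (hK0 x) (uq0 x))]
      exact mul_le_mul_of_nonneg_right (mul_le_mul_of_nonneg_left (Gle n _) (hK0 x)) (norm_nonneg _)
    · exact ((Glim x).const_mul _).mul_const _
  have b3 : ∀ n, ∀ᵐ x, ‖K x * G n (u x) * m x * divergence (fun y => χ y • y) x‖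
      ≤ d * (K x * |u x| ^ q * φ x) := fun n => by
    filter_upwards [hmφ] with x hx
    have hφ0 : 0 ≤ φ x := (hm0 x).trans hx
    rw [norm_mul, Real.norm_of_nonneg (mul_nonneg (mul_nonneg (hK0 x) (G0 n _)) (hm0 x)), mul_comm]
    exact mul_le_mul (hd x) (mul_le_mul (mul_le_mul_of_nonneg_left (Gle n _) (hK0 x)) hx (hm0 x)
      (mul_nonneg (hK0 x) (uq0 x))) (mul_nonneg (mul_nonneg (hK0 x) (G0 n _)) (hm0 x)) hd0
  have m3 : ∀ n, AEStronglyMeasurable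
      (fun x => K x * G n (u x) * m x * divergence (fun y => χ y • y) x) volume := fun n =>
    ((hK.continuous.aestronglyMeasurable.mul (mG n)).mul hm.continuous.aestronglyMeasurable).mul
      cdiv.aestronglyMeasurable
  have L3 : Tendsto (fun n => ∫ x, K x * G n (u x) * m x * divergence (fun y => χ y • y) x) atTop
      (𝓝 (∫ x, K x * |u x| ^ q * m x * divergence (fun y => χ y • y) x)) := by
    refine tendsto_integral_of_dominated_convergence _ m3 A3' b3 (Eventually.of_forall fun x => ?_)
    exact (((Glim x).const_mul _).mul_const _).mul_const _
  have bG : ∀ n x, ‖G n (u x)‖ ≤ n + 1 := fun n x => by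
    rw [Real.norm_of_nonneg (G0 n _)]; exact truncPow_le_const (k0 n) _
  have I1 : ∀ n, Integrable fun x => (m x * G n (u x) * χ x) * inner ℝ x (gradient K x) := fun n => by
    have c1 : Continuous fun x => χ x * (m x * inner ℝ x (gradient K x)) :=
      hχ.continuous.mul (hm.continuous.mul cs)
    have := (c1.integrable_of_hasCompactSupport hχc.mul_right).bdd_mul (mG n)
      (Eventually.of_forall (bG n))
    exact this.congr (Eventually.of_forall fun x => by simp only; ring)
  have I2 : ∀ n, Integrable fun x => (K x * G n (u x)) * fderiv ℝ m x (χ x • x) := fun n => by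
    refine A2.mono ((hK.continuous.aestronglyMeasurable.mul (mG n)).mul cdm.aestronglyMeasurable)
      (Eventually.of_forall fun x => ?_)
    rw [norm_mul, norm_mul (_ * _), Real.norm_of_nonneg (mul_nonneg (hK0 x) (G0 n _)),
      Real.norm_of_nonneg (mul_nonneg (hK0 x) (uq0 x))]
    exact mul_le_mul_of_nonneg_right (mul_le_mul_of_nonneg_left (Gle n _) (hK0 x)) (norm_nonneg _)
  have I3 : ∀ n, Integrable fun x => K x * G n (u x) * m x * divergence (fun y => χ y • y) x :=
    fun n => A3'.mono' (m3 n) (b3 n)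
  have step : ∀ n, ∫ x, (m x * G n (u x) * χ x) * inner ℝ x (gradient K x)
      = -(∫ x, deriv (G n) (u x) * inner ℝ (D x) ((K x * m x) • χ x • x))
        - (∫ x, (K x * G n (u x)) * fderiv ℝ m x (χ x • x))
        - ∫ x, K x * G n (u x) * m x * divergence (fun y => χ y • y) x := fun n => by
    have cY : ContDiff ℝ 1 fun x => (K x * m x) • χ x • x := (hK.mul hm).smul hX
    have hYc : HasCompactSupport fun x => (K x * m x) • χ x • x :=
      HasCompactSupport.smul_left (f := fun x => K x * m x) (f' := fun x => χ x • x) hXc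
    have key := hw.integral_deriv_comp_mul_inner hu hD (cG n)
      (C := max ((n : ℝ) + 1) (q * (1 + ((n : ℝ) + 1))))
      (fun s => by
        rw [abs_of_nonneg (G0 n s)]
        exact (truncPow_le_const (k0 n) s).trans (le_max_left _ _))
      (fun s => (abs_deriv_truncPow_le_const hq (k0 n) s).trans (le_max_right _ _)) cY hYc
    have I12 : Integrable fun x => (m x * G n (u x) * χ x) * inner ℝ x (gradient K x)
        + (K x * G n (u x)) * fderiv ℝ m x (χ x • x) := (I1 n).add (I2 n)
    have e : ∫ x, G n (u x) * divergence (fun x => (K x * m x) • χ x • x) x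
        = (∫ x, (m x * G n (u x) * χ x) * inner ℝ x (gradient K x))
          + (∫ x, (K x * G n (u x)) * fderiv ℝ m x (χ x • x))
          + ∫ x, K x * G n (u x) * m x * divergence (fun y => χ y • y) x := by
      rw [← integral_add (I1 n) (I2 n), ← integral_add I12 (I3 n)]
      refine integral_congr_ae (Eventually.of_forall fun x => ?_)
      simp only
      rw [divergence_mul_smul (X := fun y => χ y • y) hK hm hX, fderiv_apply_smul_self K]
      ring
    rw [key, e]
    ring
  have hlim := ((L0.neg.sub L2).sub L3).congr fun n => (step n).symm
  rw [integral_const_mul] at hlim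
  have cV : ∀ x, virialDensity q K u φ x = (φ x * |u x| ^ q) * inner ℝ x (gradient K x) :=
    fun x => rfl
  have mw : AEStronglyMeasurable (fun x => (m x * |u x| ^ q * χ x) * inner ℝ x (gradient K x))
      volume := ((hm.continuous.aestronglyMeasurable.mul muq).mul
        hχ.continuous.aestronglyMeasurable).mul cs.aestronglyMeasurable
  have cmp : ∀ x, m x ≤ φ x → 0 ≤ m x * |u x| ^ q * χ x ∧
      m x * |u x| ^ q * χ x ≤ φ x * |u x| ^ q := fun x hx => by
    have h1 := mul_nonneg (hm0 x) (uq0 x)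
    exact ⟨mul_nonneg h1 (hχ0 x), (mul_le_of_le_one_right h1 (hχ1 x)).trans
      (mul_le_mul_of_nonneg_right hx (uq0 x))⟩
  have cmpG : ∀ n x, 0 ≤ m x * G n (u x) * χ x ∧
      m x * G n (u x) * χ x ≤ m x * |u x| ^ q * χ x := fun n x =>
    ⟨mul_nonneg (mul_nonneg (hm0 x) (G0 n _)) (hχ0 x),
      mul_le_mul_of_nonneg_right (mul_le_mul_of_nonneg_left (Gle n _) (hm0 x)) (hχ0 x)⟩
  refine integrable_of_tendsto_of_one_sided mw I1
    (fun n => Eventually.of_forall fun x => max_mul_le_max_mul (cmpG n x).1 (cmpG n x).2)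
    (fun n => Eventually.of_forall fun x => max_neg_mul_le_max_neg_mul (cmpG n x).1 (cmpG n x).2)
    (Eventually.of_forall fun x => (((Glim x).const_mul _).mul_const _).mul_const _) hlim
    (integrable_max_or_of_le mw ?_ ?_ hV)
  · filter_upwards [hmφ] with x hx
    rw [cV]
    exact max_mul_le_max_mul (cmp x hx).1 (cmp x hx).2
  · filter_upwards [hmφ] with x hx
    rw [cV]
    exact max_neg_mul_le_max_neg_mul (cmp x hx).1 (cmp x hx).2

/-- Take `m = φ_t` in `virial_of_le` and let `t → 0`. Superharmonicity gives `0 ≤ φ_t ≤ φ`, hence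
domination; the term with `∇φ_t` is never bounded pointwise but evaluated through the equation for
`φ`. -/
lemma IsWeakGradient.coupled_virial (hN : 0 < N) (hw : IsWeakGradient u D) (hu : MemLp u 2 volume)
    (hD : MemLp D 2 volume) (hq : 1 < q) (hK : ContDiff ℝ 1 K) (hK0 : ∀ x, 0 ≤ K x)
    (hwφ : IsWeakGradient φ Dφ) (hφ : MemLp φ 2 volume) (hDφ : MemLp Dφ 2 volume)
    (hχ : ContDiff ℝ ∞ χ) (hχc : HasCompactSupport χ) (hχ0 : ∀ x, 0 ≤ χ x) (hχ1 : ∀ x, χ x ≤ 1)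
    (hf : LocallyIntegrable fun x => K x * |u x| ^ q)
    (heq : ∀ ψ, IsTestFunction ψ →
      ∫ x, inner ℝ (Dφ x) (gradient ψ x) = ∫ x, K x * |u x| ^ q * ψ x)
    (hP : Integrable fun x => K x * |u x| ^ q * φ x)
    (hQ : Integrable fun x => K x * φ x * (|u x| ^ (q - 2) * u x) * inner ℝ (D x) (χ x • x))
    (hV : Integrable (fun x => max (virialDensity q K u φ x) 0) ∨
      Integrable fun x => max (-virialDensity q K u φ x) 0) :
    Integrable (fun x => χ x * virialDensity q K u φ x) ∧
    ∫ x, χ x * virialDensity q K u φ x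
      = -(q * ∫ x, K x * φ x * (|u x| ^ (q - 2) * u x) * inner ℝ (D x) (χ x • x))
        - stressForm (fun x => χ x • x) Dφ
        - ∫ x, K x * |u x| ^ q * φ x * divergence (fun y => χ y • y) x := by
  obtain ⟨η, ζ, hη⟩ := exists_isMollifierPair N
  have hχ' : ContDiff ℝ 1 χ := hχ.of_le (by exact_mod_cast le_top)
  have hX : ContDiff ℝ ∞ fun x => χ x • x := hχ.smul contDiff_id
  have hX1 : ContDiff ℝ 1 fun x => χ x • x := hX.of_le (by exact_mod_cast le_top)
  have hXc : HasCompactSupport fun x => χ x • x :=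
    HasCompactSupport.smul_right (f := χ) (f' := fun x => x) hχc
  have uq0 : ∀ x, 0 ≤ |u x| ^ q := fun x => Real.rpow_nonneg (abs_nonneg _) _
  have hs : IsWeaklySuperharmonic Dφ := fun ψ hψ hψ0 => by
    rw [heq ψ hψ]
    exact integral_nonneg fun x => mul_nonneg (mul_nonneg (hK0 x) (uq0 x)) (hψ0 x)
  have cs : Continuous fun x => inner ℝ x (gradient K x) :=
    continuous_id.inner (continuous_gradient hK)
  have cdiv := continuous_divergence hX1
  obtain ⟨d, hd0, hd⟩ := exists_bound_of_hasCompactSupport cdiv (hasCompactSupport_divergence hXc)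
  have muq : AEStronglyMeasurable (fun x => |u x| ^ q) volume :=
    (continuous_abs_rpow hq).comp_aestronglyMeasurable hu.aestronglyMeasurable
  obtain ⟨t, ht0, ht, hlim⟩ := hη.exists_seq hφ
  set m : ℕ → RN N → ℝ := fun n => mollify (rescale η (t n)) φ with hm
  have cms : ∀ n, ContDiff ℝ ∞ (m n) := fun n => hη.contDiff_mollify hwφ.locallyIntegrable_fun (ht0 n)
  have cm : ∀ n, ContDiff ℝ 1 (m n) := fun n => (cms n).of_le (by exact_mod_cast le_top)
  have m0 : ∀ n x, 0 ≤ m n x := fun n x => hη.mollify_nonneg hN hwφ hs hφ (ht0 n) x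
  have mle : ∀ᵐ x, ∀ n, m n x ≤ φ x := by
    filter_upwards [hη.mollify_le hwφ hs hφ] with x hx n using hx _ (ht0 n)
  have step := fun n => hw.virial_of_le hu hD hq hK hK0 (cm n) (m0 n)
    (by filter_upwards [mle] with x hx using hx n) hχ' hχc hχ0 hχ1 hf hP hQ hV
  have L0 : Tendsto (fun n => ∫ x, K x * m n x * (|u x| ^ (q - 2) * u x) * inner ℝ (D x) (χ x • x))
      atTop (𝓝 (∫ x, K x * φ x * (|u x| ^ (q - 2) * u x) * inner ℝ (D x) (χ x • x))) := by
    refine tendsto_integral_of_dominated_convergence _ (fun n => ?_) hQ.norm (fun n => ?_) ?_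
    · exact ((hK.continuous.mul (cm n).continuous).aestronglyMeasurable.mul
        ((continuous_abs_rpow_sub_two_mul hq).comp_aestronglyMeasurable hu.aestronglyMeasurable)).mul
        (hD.aestronglyMeasurable.inner hX.continuous.aestronglyMeasurable)
    · filter_upwards [mle] with x hx
      have hφ0 : 0 ≤ φ x := (m0 0 x).trans (hx 0)
      rw [norm_mul, norm_mul (K x * m n x), norm_mul (K x * φ x * _), norm_mul (K x * φ x),
        Real.norm_of_nonneg (mul_nonneg (hK0 x) (m0 n x)),
        Real.norm_of_nonneg (mul_nonneg (hK0 x) hφ0)]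
      exact mul_le_mul_of_nonneg_right (mul_le_mul_of_nonneg_right
        (mul_le_mul_of_nonneg_left (hx n) (hK0 x)) (norm_nonneg _)) (norm_nonneg _)
    · filter_upwards [hlim] with x hx
      exact ((hx.const_mul _).mul_const _).mul_const _
  -- This is the second equation tested with `X·∇φ_t`, so it equals the pairing that converges to
  -- the stress form.
  have L2 : Tendsto (fun n => ∫ x, (K x * |u x| ^ q) * fderiv ℝ (m n) x (χ x • x)) atTop
      (𝓝 (stressForm (fun x => χ x • x) Dφ)) := by
    refine ((hwφ.tendsto_integral_inner_gradient hη hDφ hX hXc).comp ht).congr fun n => ?_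
    exact heq _ (isTestFunction_fderiv_apply (cms n) hX hXc)
  have L3 : Tendsto (fun n => ∫ x, K x * |u x| ^ q * m n x * divergence (fun y => χ y • y) x) atTop
      (𝓝 (∫ x, K x * |u x| ^ q * φ x * divergence (fun y => χ y • y) x)) := by
    refine tendsto_integral_of_dominated_convergence _ (fun n => ?_) (hP.norm.const_mul d)
      (fun n => ?_) ?_
    · exact ((hK.continuous.aestronglyMeasurable.mul muq).mul
        (cm n).continuous.aestronglyMeasurable).mul cdiv.aestronglyMeasurable
    · filter_upwards [mle] with x hx
      have hφ0 : 0 ≤ φ x := (m0 0 x).trans (hx 0)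
      have h1 := mul_nonneg (hK0 x) (uq0 x)
      rw [norm_mul, Real.norm_of_nonneg (mul_nonneg h1 (m0 n x)),
        Real.norm_of_nonneg (mul_nonneg h1 hφ0), mul_comm]
      exact mul_le_mul (hd x) (mul_le_mul_of_nonneg_left (hx n) h1) (mul_nonneg h1 (m0 n x)) hd0
    · filter_upwards [hlim] with x hx
      exact (hx.const_mul _).mul_const _
  have hL := (((L0.const_mul q).neg.sub L2).sub L3).congr fun n => (step n).2.symm
  have cV : ∀ x, χ x * virialDensity q K u φ x
      = (φ x * |u x| ^ q * χ x) * inner ℝ x (gradient K x) := fun x => by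
    rw [virialDensity]; ring
  have cV' : ∀ x, virialDensity q K u φ x = (φ x * |u x| ^ q) * inner ℝ x (gradient K x) :=
    fun x => rfl
  simp_rw [cV]
  have mw : AEStronglyMeasurable (fun x => (φ x * |u x| ^ q * χ x) * inner ℝ x (gradient K x))
      volume := ((hφ.aestronglyMeasurable.mul muq).mul
        hχ.continuous.aestronglyMeasurable).mul cs.aestronglyMeasurable
  have cmp : ∀ n x, m n x ≤ φ x → 0 ≤ m n x * |u x| ^ q * χ x ∧
      m n x * |u x| ^ q * χ x ≤ φ x * |u x| ^ q * χ x := fun n x hx =>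
    ⟨mul_nonneg (mul_nonneg (m0 n x) (uq0 x)) (hχ0 x),
      mul_le_mul_of_nonneg_right (mul_le_mul_of_nonneg_right hx (uq0 x)) (hχ0 x)⟩
  have cmp' : ∀ x, m 0 x ≤ φ x → 0 ≤ φ x * |u x| ^ q * χ x ∧
      φ x * |u x| ^ q * χ x ≤ φ x * |u x| ^ q := fun x hx => by
    have h1 := mul_nonneg ((m0 0 x).trans hx) (uq0 x)
    exact ⟨mul_nonneg h1 (hχ0 x), mul_le_of_le_one_right h1 (hχ1 x)⟩
  refine integrable_of_tendsto_of_one_sided mw (fun n => (step n).1) (fun n => ?_) (fun n => ?_) ?_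
    hL (integrable_max_or_of_le mw ?_ ?_ hV)
  · filter_upwards [mle] with x hx
    exact max_mul_le_max_mul (cmp n x (hx n)).1 (cmp n x (hx n)).2
  · filter_upwards [mle] with x hx
    exact max_neg_mul_le_max_neg_mul (cmp n x (hx n)).1 (cmp n x (hx n)).2
  · filter_upwards [hlim] with x hx
    exact ((hx.mul_const _).mul_const _).mul_const _
  · filter_upwards [mle] with x hx
    rw [cV']
    exact max_mul_le_max_mul (cmp' x (hx 0)).1 (cmp' x (hx 0)).2
  · filter_upwards [mle] with x hx
    rw [cV']
    exact max_neg_mul_le_max_neg_mul (cmp' x (hx 0)).1 (cmp' x (hx 0)).2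

end CoupledVirial

/-! ### The cut-off position field and its limit. -/

section DilatedCutoff

variable {N : ℕ} {θ : RN N → ℝ}

/-- The position field cut off at distance of order `l⁻¹`. -/
noncomputable def cutoffField (θ : RN N → ℝ) (l : ℝ) (x : RN N) : RN N := θ (l • x) • x

lemma IsCutoff.contDiff_comp_smul (hθ : IsCutoff θ) (l : ℝ) : ContDiff ℝ ∞ fun x => θ (l • x) :=
  hθ.contDiff.comp (contDiff_const_smul l)

lemma IsCutoff.contDiff_cutoffField (hθ : IsCutoff θ) (l : ℝ) : ContDiff ℝ ∞ (cutoffField θ l) :=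
  (hθ.contDiff_comp_smul l).smul contDiff_id

lemma IsCutoff.contDiff_one_cutoffField (hθ : IsCutoff θ) (l : ℝ) :
    ContDiff ℝ 1 (cutoffField θ l) :=
  (hθ.contDiff_cutoffField l).of_le (by exact_mod_cast le_top)

lemma IsCutoff.hasCompactSupport_cutoffField (hθ : IsCutoff θ) {l : ℝ} (hl : l ≠ 0) :
    HasCompactSupport (cutoffField θ l) :=
  HasCompactSupport.smul_right (f := fun x => θ (l • x)) (f' := fun x => x)
    (hθ.compact.comp_smul_ne_zero hl)

lemma cutoffField_eq {l : ℝ} (hl : l ≠ 0) (x : RN N) :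
    cutoffField θ l x = l⁻¹ • cutoffField θ 1 (l • x) := by
  rw [cutoffField, cutoffField, one_smul, smul_comm, smul_smul l⁻¹, inv_mul_cancel₀ hl, one_smul]

lemma IsCutoff.fderiv_cutoffField (hθ : IsCutoff θ) {l : ℝ} (hl : l ≠ 0) (x v : RN N) :
    fderiv ℝ (cutoffField θ l) x v = fderiv ℝ (cutoffField θ 1) (l • x) v := by
  have h1 : Differentiable ℝ (cutoffField θ 1) :=
    (hθ.contDiff_one_cutoffField 1).differentiable one_ne_zero
  have h2 : Differentiable ℝ fun x => cutoffField θ 1 (l • x) :=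
    h1.comp (differentiable_id.const_smul l)
  have e : cutoffField θ l = fun x => l⁻¹ • cutoffField θ 1 (l • x) := funext (cutoffField_eq hl)
  rw [e, fderiv_fun_const_smul (h2 x), smul_apply, fderiv_comp_smul_apply h1,
    smul_smul, inv_mul_cancel₀ hl, one_smul]

lemma IsCutoff.fderiv_cutoffField_of_lt (hθ : IsCutoff θ) {l : ℝ} {x : RN N} (h : ‖l • x‖ < 1) :
    fderiv ℝ (cutoffField θ l) x = ContinuousLinearMap.id ℝ (RN N) := by
  have e : cutoffField θ l =ᶠ[𝓝 x] id := by
    have : ∀ᶠ y in 𝓝 x, ‖l • y‖ < 1 :=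
      (continuous_id.const_smul l).norm.continuousAt.eventually_lt continuousAt_const h
    filter_upwards [this] with y hy
    rw [cutoffField, hθ.eq_one _ hy.le, one_smul, id]
  rw [e.fderiv_eq, fderiv_id]

lemma IsCutoff.divergence_cutoffField_of_lt (hθ : IsCutoff θ) {l : ℝ} {x : RN N}
    (h : ‖l • x‖ < 1) : divergence (cutoffField θ l) x = N := by
  rw [divergence, hθ.fderiv_cutoffField_of_lt h]
  simp [stdVec]

/-- The field is `l⁻¹ X₁(l x)`, so its derivative is that of `X₁` at `l x`. Bounds independent of
`l` make the limits `l → 0` instances of dominated convergence. -/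
lemma IsCutoff.exists_bounds (hθ : IsCutoff θ) : ∃ C d L : ℝ, 0 ≤ C ∧ 0 ≤ d ∧ 0 ≤ L ∧
    ∀ l : ℝ, l ≠ 0 → (∀ x v, ‖fderiv ℝ (cutoffField θ l) x v‖ ≤ C * ‖v‖) ∧
      (∀ x, |divergence (cutoffField θ l) x| ≤ d) ∧
      ∀ x y, ‖cutoffField θ l x - cutoffField θ l y‖ ≤ L * ‖x - y‖ := by
  have c1 := hθ.contDiff_one_cutoffField 1
  have cc := hθ.hasCompactSupport_cutoffField one_ne_zero
  obtain ⟨C, hC0, hC⟩ := exists_bound_of_hasCompactSupport (c1.continuous_fderiv one_ne_zero)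
    (cc.fderiv ℝ)
  obtain ⟨d, hd0, hd⟩ := exists_bound_of_hasCompactSupport (continuous_divergence c1)
    (hasCompactSupport_divergence cc)
  obtain ⟨L, hL0, hL⟩ := exists_lipschitz_bound c1 cc
  refine ⟨C, d, L, hC0, hd0, hL0, fun l hl => ⟨fun x v => ?_, fun x => ?_, fun x y => ?_⟩⟩
  · rw [hθ.fderiv_cutoffField hl]
    exact (ContinuousLinearMap.le_opNorm _ _).trans
      (mul_le_mul_of_nonneg_right (hC _) (norm_nonneg _))
  · have e : divergence (cutoffField θ l) x = divergence (cutoffField θ 1) (l • x) := by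
      simp only [divergence, hθ.fderiv_cutoffField hl]
    rw [e]
    exact hd _
  · rw [cutoffField_eq hl, cutoffField_eq hl y, ← smul_sub, norm_smul, norm_inv]
    have h := hL (l • x) (l • y)
    rw [← smul_sub, norm_smul] at h
    have hl' : 0 < ‖l‖ := norm_pos_iff.2 hl
    rw [inv_mul_le_iff₀ hl']
    linarith

variable {l : ℕ → ℝ}

lemma eventually_norm_smul_lt_one (hl : Tendsto l atTop (𝓝 0)) (x : RN N) :
    ∀ᶠ n in atTop, ‖l n • x‖ < 1 := by
  have : Tendsto (fun n => ‖l n • x‖) atTop (𝓝 0) := by simpa using (hl.smul_const x).norm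
  exact this.eventually_lt_const one_pos

lemma IsCutoff.tendsto_integral_divergence_mul (hθ : IsCutoff θ) (hl0 : ∀ n, l n ≠ 0)
    (hl : Tendsto l atTop (𝓝 0)) {w : RN N → ℝ} (hw : Integrable w) :
    Tendsto (fun n => ∫ x, w x * divergence (cutoffField θ (l n)) x) atTop
      (𝓝 ((N : ℝ) * ∫ x, w x)) := by
  obtain ⟨C, d, L, hC0, hd0, hL0, hb⟩ := hθ.exists_bounds
  rw [← integral_const_mul]
  refine tendsto_integral_of_dominated_convergence _ (fun n => ?_) (hw.norm.const_mul d)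
    (fun n => Eventually.of_forall fun x => ?_) (Eventually.of_forall fun x => ?_)
  · exact hw.aestronglyMeasurable.mul
      (continuous_divergence (hθ.contDiff_one_cutoffField _)).aestronglyMeasurable
  · rw [norm_mul, mul_comm]
    exact mul_le_mul_of_nonneg_right ((hb _ (hl0 n)).2.1 x) (norm_nonneg _)
  · refine tendsto_const_nhds.congr' ?_
    filter_upwards [eventually_norm_smul_lt_one hl x] with n hn
    rw [hθ.divergence_cutoffField_of_lt hn, mul_comm]

lemma IsCutoff.tendsto_stressForm (hθ : IsCutoff θ) (hl0 : ∀ n, l n ≠ 0)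
    (hl : Tendsto l atTop (𝓝 0)) {D : RN N → RN N} (hD : MemLp D 2 volume) :
    Tendsto (fun n => stressForm (cutoffField θ (l n)) D) atTop
      (𝓝 (-(((N : ℝ) - 2) / 2) * ∫ x, ‖D x‖ ^ 2)) := by
  obtain ⟨C, d, L, hC0, hd0, hL0, hb⟩ := hθ.exists_bounds
  have hD2 : Integrable fun x => ‖D x‖ ^ 2 := hD.integrable_norm_pow two_ne_zero
  rw [← integral_const_mul]
  refine tendsto_integral_of_dominated_convergence _ (fun n => ?_) (hD2.const_mul (C + 1 / 2 * d))
    (fun n => Eventually.of_forall fun x => ?_) (Eventually.of_forall fun x => ?_)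
  · have c1 := hθ.contDiff_one_cutoffField (l n)
    refine (hD.aestronglyMeasurable.inner ?_).sub (AEStronglyMeasurable.const_mul
      ((continuous_divergence c1).aestronglyMeasurable.mul hD2.aestronglyMeasurable) _)
    exact (isBoundedBilinearMap_apply (𝕜 := ℝ) (E := RN N)
      (F := RN N)).continuous.comp_aestronglyMeasurable
      ((c1.continuous_fderiv one_ne_zero).aestronglyMeasurable.prodMk hD.aestronglyMeasurable)
  · obtain ⟨h1, h2, -⟩ := hb _ (hl0 n)
    have i1 : |inner ℝ (D x) (fderiv ℝ (cutoffField θ (l n)) x (D x))| ≤ C * ‖D x‖ ^ 2 := by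
      refine (abs_real_inner_le_norm _ _).trans ?_
      have := mul_le_mul_of_nonneg_left (h1 x (D x)) (norm_nonneg (D x))
      linarith
    have i2 : |1 / 2 * (divergence (cutoffField θ (l n)) x * ‖D x‖ ^ 2)|
        ≤ 1 / 2 * d * ‖D x‖ ^ 2 := by
      rw [abs_mul, abs_mul, abs_of_nonneg (sq_nonneg ‖D x‖), abs_of_pos (by norm_num : (0 : ℝ) < 1 / 2),
        mul_assoc]
      exact mul_le_mul_of_nonneg_left (mul_le_mul_of_nonneg_right (h2 x) (sq_nonneg _)) (by norm_num)
    rw [add_mul]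
    exact (abs_sub _ _).trans (add_le_add i1 i2)
  · refine tendsto_const_nhds.congr' ?_
    filter_upwards [eventually_norm_smul_lt_one hl x] with n hn
    rw [hθ.divergence_cutoffField_of_lt hn, hθ.fderiv_cutoffField_of_lt hn,
      ContinuousLinearMap.id_apply, real_inner_self_eq_norm_sq]
    ring

/-- Once both points lie where the field is the identity, `rieszVirial` equals `N + N - lam`. -/
lemma IsCutoff.tendsto_integral_rieszVirial (hθ : IsCutoff θ) (hN : 0 < N) (hl0 : ∀ n, l n ≠ 0)
    (hl : Tendsto l atTop (𝓝 0)) {lam : ℝ} (hlam : 0 ≤ lam) {F : RN N × RN N → ℝ}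
    (hF : Integrable F (volume.prod volume)) :
    Tendsto (fun n => ∫ z, F z * rieszVirial lam (cutoffField θ (l n)) z ∂(volume.prod volume)) atTop
      (𝓝 ((2 * (N : ℝ) - lam) * ∫ z, F z ∂(volume.prod volume))) := by
  obtain ⟨C, d, L, hC0, hd0, hL0, hb⟩ := hθ.exists_bounds
  have ne := ae_fst_ne_snd hN
  rw [← integral_const_mul]
  refine tendsto_integral_of_dominated_convergence _ (fun n => ?_)
    (hF.norm.const_mul (2 * d + lam * L)) (fun n => ?_) ?_
  · have c1 := hθ.contDiff_one_cutoffField (l n)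
    have cd := continuous_divergence c1
    refine hF.aestronglyMeasurable.mul (Measurable.aestronglyMeasurable ?_)
    refine ((cd.measurable.comp measurable_fst).add (cd.measurable.comp measurable_snd)).sub
      (Measurable.const_mul (Measurable.div ?_ ?_) _)
    · exact ((continuous_fst.sub continuous_snd).inner
        ((c1.continuous.comp continuous_fst).sub (c1.continuous.comp continuous_snd))).measurable
    · exact (measurable_fst.sub measurable_snd).norm.pow_const 2
  · filter_upwards [ne] with z hz
    obtain ⟨-, h2, h3⟩ := hb _ (hl0 n)
    have hz' : 0 < ‖z.1 - z.2‖ := norm_pos_iff.2 hz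
    have i1 : |lam * (inner ℝ (z.1 - z.2) (cutoffField θ (l n) z.1 - cutoffField θ (l n) z.2)
        / ‖z.1 - z.2‖ ^ 2)| ≤ lam * L := by
      rw [abs_mul, abs_of_nonneg hlam, abs_div, abs_of_nonneg (sq_nonneg ‖z.1 - z.2‖)]
      refine mul_le_mul_of_nonneg_left ?_ hlam
      rw [div_le_iff₀ (by positivity)]
      refine (abs_real_inner_le_norm _ _).trans ?_
      have := mul_le_mul_of_nonneg_left (h3 z.1 z.2) hz'.le
      linarith
    have i2 := (abs_add_le (divergence (cutoffField θ (l n)) z.1)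
      (divergence (cutoffField θ (l n)) z.2)).trans (add_le_add (h2 z.1) (h2 z.2))
    rw [norm_mul, mul_comm]
    refine mul_le_mul_of_nonneg_right ((abs_sub _ _).trans ?_) (norm_nonneg _)
    linarith
  · filter_upwards [ne] with z hz
    refine tendsto_const_nhds.congr' ?_
    have hz' : 0 < ‖z.1 - z.2‖ := norm_pos_iff.2 hz
    filter_upwards [eventually_norm_smul_lt_one hl z.1, eventually_norm_smul_lt_one hl z.2]
      with n h1 h2
    rw [rieszVirial, hθ.divergence_cutoffField_of_lt h1, hθ.divergence_cutoffField_of_lt h2,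
      cutoffField, cutoffField, hθ.eq_one _ h1.le, hθ.eq_one _ h2.le, one_smul, one_smul,
      real_inner_self_eq_norm_sq, div_self (by positivity)]
    ring

end DilatedCutoff

/-! ### Application to weak solutions. -/

section Solution

variable {N : ℕ} {α p q : ℝ} {K u φ : RN N → ℝ} {Du Dφ : RN N → RN N}

lemma HasSolutionRegularity.memLp_abs_rpow (hreg : HasSolutionRegularity α p q K u φ Du Dφ)
    (hp : 1 < p) : MemLp (fun x => |u x| ^ p) (ENNReal.ofReal (2 * N / (N + α))) volume := by
  refine memLp_norm_rpow (f := u) (by linarith) ?_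
  rw [show p * (2 * N / (N + α)) = 2 * N * p / (N + α) by ring]
  exact hreg.u_Ls

lemma HasSolutionRegularity.locallyIntegrable_source (hN : 3 ≤ N)
    (hreg : HasSolutionRegularity α p q K u φ Du Dφ) :
    LocallyIntegrable fun x => K x * |u x| ^ q := by
  refine hreg.source_Lr.locallyIntegrable ?_
  have hN' : (3 : ℝ) ≤ N := by exact_mod_cast hN
  rw [← ENNReal.ofReal_one]
  refine ENNReal.ofReal_le_ofReal ?_
  rw [le_div_iff₀ (by positivity)]
  linarith

lemma IsWeakSolution.energy (hN : 3 ≤ N) (hK0 : ∀ x, 0 ≤ K x)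
    (hsol : IsWeakSolution α p q K u φ Du Dφ) (hreg : HasSolutionRegularity α p q K u φ Du Dφ) :
    Integrable (fun x => K x * |u x| ^ q * φ x) ∧
      ∫ x, K x * |u x| ^ q * φ x = ∫ x, ‖Dφ x‖ ^ 2 :=
  hsol.grad_φ.integral_mul_eq_integral_norm_sq (by omega) hreg.φ_L2 hreg.Dφ_L2
    (hreg.locallyIntegrable_source hN)
    (fun x => mul_nonneg (hK0 x) (Real.rpow_nonneg (abs_nonneg _) _)) hsol.eq_φ

/-- By `|u|^(q-1) ≤ 1 + |u|^q` it is dominated by `|Kφ|`, locally integrable, plus the integrable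
`K|u|^q|φ|`. -/
lemma IsWeakSolution.locallyIntegrable_coupling (hN : 3 ≤ N) (hq : 1 < q) (hK : ContDiff ℝ 1 K)
    (hK0 : ∀ x, 0 ≤ K x) (hsol : IsWeakSolution α p q K u φ Du Dφ)
    (hreg : HasSolutionRegularity α p q K u φ Du Dφ) :
    LocallyIntegrable fun x => K x * φ x * (|u x| ^ (q - 2) * u x) := by
  have h1 : LocallyIntegrable fun x => K x * φ x := by
    have := (hreg.φ_L2.locallyIntegrable_two.locallyIntegrableOn univ).continuousOn_mul
      hK.continuous.continuousOn isOpen_univ.isLocallyClosed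
    exact locallyIntegrableOn_univ.1 this
  have h2 := (hsol.energy hN hK0 hreg).1.locallyIntegrable
  have h3 : LocallyIntegrable fun x => ‖K x * φ x‖ + ‖K x * |u x| ^ q * φ x‖ :=
    (h1.mono h1.aestronglyMeasurable.norm (Eventually.of_forall fun x => by simp)).add
      (h2.mono h2.aestronglyMeasurable.norm (Eventually.of_forall fun x => by simp))
  refine h3.mono ((hK.continuous.aestronglyMeasurable.mul hreg.φ_L2.aestronglyMeasurable).mul
    ((continuous_abs_rpow_sub_two_mul hq).comp_aestronglyMeasurable
      hreg.u_L2.aestronglyMeasurable)) (Eventually.of_forall fun x => ?_)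
  rw [Real.norm_of_nonneg (by positivity : 0 ≤ ‖K x * φ x‖ + ‖K x * |u x| ^ q * φ x‖), norm_mul,
    Real.norm_eq_abs (_ * u x), abs_mul (_ ^ _), abs_of_nonneg (Real.rpow_nonneg (abs_nonneg _) _),
    abs_rpow_sub_two_mul_abs hq]
  calc _ ≤ ‖K x * φ x‖ * (1 + |u x| ^ q) :=
        mul_le_mul_of_nonneg_left (rpow_sub_one_le hq (abs_nonneg _)) (norm_nonneg _)
    _ = _ := by
        rw [mul_right_comm, norm_mul (K x * φ x),
          Real.norm_of_nonneg (Real.rpow_nonneg (abs_nonneg (u x)) q)]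
        ring

/-- The identity obtained by testing the first equation with `X·∇u`. -/
lemma IsWeakSolution.stress_identity (hN : 3 ≤ N) (hα : 0 < α) (hαN : α < N) (hp : 1 < p)
    (hq : 1 < q) (hK : ContDiff ℝ 1 K) (hK0 : ∀ x, 0 ≤ K x)
    (hsol : IsWeakSolution α p q K u φ Du Dφ) (hreg : HasSolutionRegularity α p q K u φ Du Dφ)
    {X : RN N → RN N} (hX : ContDiff ℝ ∞ X) (hXc : HasCompactSupport X) :
    Integrable (fun x => K x * φ x * (|u x| ^ (q - 2) * u x) * inner ℝ (Du x) (X x)) ∧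
    stressForm X Du - 1 / 2 * ∫ x, u x ^ 2 * divergence X x
      = -(rieszConst N α / (2 * p)) *
          (∫ z : RN N × RN N, |u z.1| ^ p * |u z.2| ^ p * (‖z.1 - z.2‖ ^ ((N : ℝ) - α))⁻¹ *
            rieszVirial ((N : ℝ) - α) X z ∂(volume.prod volume))
        - ∫ x, K x * φ x * (|u x| ^ (q - 2) * u x) * inner ℝ (Du x) (X x) := by
  have hN0 : 0 < N := by omega
  have hN' : (0 : ℝ) < N := by exact_mod_cast hN0
  have hp0 : 0 < p := by linarith
  have hr1 : 1 ≤ 2 * N / (N + α) := by rw [le_div_iff₀ (by positivity)]; linarith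
  have hup := hreg.memLp_abs_rpow hp
  have mu := hreg.u_L2.aestronglyMeasurable
  have hDloc : MemLpLoc Du (ENNReal.ofReal (p * (2 * N / (N + α)))) := by
    rw [show p * (2 * N / (N + α)) = 2 * N * p / (N + α) by ring]
    exact hreg.Du_Lsloc
  have hX1 : ContDiff ℝ 1 X := hX.of_le (by exact_mod_cast le_top)
  have hc := hsol.locallyIntegrable_coupling hN hq hK hK0 hreg
  have hrl := locallyIntegrable_mul_rieszPotential hN0 hα hαN rfl
    (memLpLoc_rpow_sub_two_mul hp mu hup) hup
  have heq : ∀ ψ, IsTestFunction ψ →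
      (∫ x, inner ℝ (Du x) (gradient ψ x)) + (∫ x, u x * ψ x)
        = ∫ x, ((|u x| ^ (p - 2) * u x) * rieszPotential α (fun y => |u y| ^ p) x
            - K x * φ x * (|u x| ^ (q - 2) * u x)) * ψ x := fun ψ hψ => by
    have h := hsol.eq_u ψ hψ
    have i1 := hrl.integrable_smul_right_of_hasCompactSupport hψ.1.continuous hψ.2
    have i2 := hc.integrable_smul_right_of_hasCompactSupport hψ.1.continuous hψ.2
    simp only [smul_eq_mul] at i1 i2
    have e : ∫ x, ((|u x| ^ (p - 2) * u x) * rieszPotential α (fun y => |u y| ^ p) x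
            - K x * φ x * (|u x| ^ (q - 2) * u x)) * ψ x
        = (∫ x, rieszPotential α (fun y => |u y| ^ p) x * (|u x| ^ (p - 2) * u x) * ψ x)
          - ∫ x, K x * φ x * (|u x| ^ (q - 2) * u x) * ψ x := by
      rw [← h]
      simp_rw [sub_mul]
      rw [integral_sub i1 i2, h]
      congr 1
      exact integral_congr_ae (Eventually.of_forall fun x => by simp only; ring)
    rw [e]
    linarith
  -- Only the difference of the Riesz and coupling terms is known to be in `L²_loc`. Paired with
  -- `X·∇u`, the Riesz term is integrable by itself through Hardy–Littlewood–Sobolev, so the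
  -- coupling term is too.
  have h2 := hsol.grad_u.memLpLoc_of_equation hreg.u_L2 hreg.Du_H1loc (hrl.sub hc) heq
  obtain ⟨hI, hid⟩ := hsol.grad_u.stressForm_sub_eq hreg.u_L2 hreg.Du_L2 h2 heq hX hXc
  obtain ⟨hb, hb1⟩ := memLp_rpow_mul_inner hp hr1 mu hreg.Du_L2.aestronglyMeasurable hup hDloc
    hX.continuous hXc
  obtain ⟨hR, hRe⟩ := integrable_mul_rieszPotential hN0 hα hαN rfl hb hup
  have hbp : ∀ x, p * (|u x| ^ (p - 2) * u x) * inner ℝ (Du x) (X x)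
      = p * ((|u x| ^ (p - 2) * u x) * inner ℝ (Du x) (X x)) := fun x => mul_assoc _ _ _
  have hvir := hsol.grad_u.integral_rieszKernel hN0 hreg.u_L2 hreg.Du_L2 hp hα hαN rfl hX1 hXc hup
    (by simp_rw [hbp]; exact hb.const_mul p) (by simp_rw [hbp]; exact hb1.const_mul p)
  have hQ : Integrable fun x => K x * φ x * (|u x| ^ (q - 2) * u x) * inner ℝ (Du x) (X x) :=
    (hR.sub hI).congr (Eventually.of_forall fun x => by simp only [Pi.sub_apply]; ring)
  refine ⟨hQ, ?_⟩
  have e1 : ∫ x, u x ^ 2 * divergence X x = ∫ x, divergence X x * u x ^ 2 :=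
    integral_congr_ae (Eventually.of_forall fun x => mul_comm _ _)
  have e2 : ∫ x, ((|u x| ^ (p - 2) * u x) * rieszPotential α (fun y => |u y| ^ p) x
            - K x * φ x * (|u x| ^ (q - 2) * u x)) * inner ℝ (Du x) (X x)
      = (∫ x, (|u x| ^ (p - 2) * u x) * inner ℝ (Du x) (X x) *
          rieszPotential α (fun y => |u y| ^ p) x)
        - ∫ x, K x * φ x * (|u x| ^ (q - 2) * u x) * inner ℝ (Du x) (X x) := by
    rw [← integral_sub hR hQ]
    exact integral_congr_ae (Eventually.of_forall fun x => by simp only; ring)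
  rw [e1]
  refine hid.trans (e2.trans ?_)
  rw [hRe]
  congr 1
  have hJ : ∫ z : RN N × RN N, (|u z.1| ^ (p - 2) * u z.1) * inner ℝ (Du z.1) (X z.1) *
      |u z.2| ^ p * (‖z.1 - z.2‖ ^ ((N : ℝ) - α))⁻¹ ∂(volume.prod volume)
      = p⁻¹ * (-(1 / 2) * ∫ z : RN N × RN N, |u z.1| ^ p * |u z.2| ^ p *
        (‖z.1 - z.2‖ ^ ((N : ℝ) - α))⁻¹ * rieszVirial ((N : ℝ) - α) X z ∂(volume.prod volume)) := by
    rw [← hvir, ← integral_const_mul]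
    refine integral_congr_ae (Eventually.of_forall fun z => ?_)
    simp only
    field_simp
  rw [hJ]
  field_simp

end Solution

/-! ### The Pohozaev identity. -/

theorem proposition4p1 (N : ℕ) (hN : 3 ≤ N) (α p q : ℝ) (hα : 0 < α) (hαN : α < N)
    (hp : 1 < p) (hq : 1 < q)
    (K : RN N → ℝ) (hK : ContDiff ℝ 1 K) (hK0 : ∀ x, 0 ≤ K x)
    (u φ : RN N → ℝ) (Du Dφ : RN N → RN N)
    (hsol : IsWeakSolution α p q K u φ Du Dφ)
    (hreg : HasSolutionRegularity α p q K u φ Du Dφ) :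
    Integrable (fun x => ‖Du x‖ ^ 2) volume ∧
    Integrable (fun x => |u x| ^ 2) volume ∧
    Integrable (fun x => K x * φ x * |u x| ^ q) volume ∧
    Integrable (fun x => rieszPotential α (fun y => |u y| ^ p) x * |u x| ^ p) volume ∧
    -- the remaining integral is only required to exist in the extended sense
    ((Integrable (fun x => max (virialDensity q K u φ x) 0) volume ∨
        Integrable (fun x => max (-virialDensity q K u φ x) 0) volume) →
      Integrable (virialDensity q K u φ) volume ∧
      (∫ x, (((N : ℝ) - 2) / 2 * ‖Du x‖ ^ 2 + (N : ℝ) / 2 * |u x| ^ 2))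
          + ((N : ℝ) + 2) / (2 * q) * (∫ x, K x * φ x * |u x| ^ q)
          + 1 / q * (∫ x, virialDensity q K u φ x)
        = ((N : ℝ) + α) / (2 * p)
            * ∫ x, rieszPotential α (fun y => |u y| ^ p) x * |u x| ^ p) := by
  have hN0 : 0 < N := by omega
  have hD2 : Integrable fun x => ‖Du x‖ ^ 2 := hreg.Du_L2.integrable_norm_pow two_ne_zero
  have hu2 : Integrable fun x => |u x| ^ 2 := hreg.u_L2.integrable_norm_pow two_ne_zero
  have hu2' : Integrable fun x => u x ^ 2 := hreg.u_L2.integrable_sq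
  have hup := hreg.memLp_abs_rpow hp
  obtain ⟨hP, hPe⟩ := hsol.energy hN hK0 hreg
  have eP : (fun x => K x * φ x * |u x| ^ q) = fun x => K x * |u x| ^ q * φ x :=
    funext fun x => mul_right_comm _ _ _
  obtain ⟨hR, hRe⟩ := integrable_mul_rieszPotential hN0 hα hαN rfl hup hup
  have eR : (fun x => rieszPotential α (fun y => |u y| ^ p) x * |u x| ^ p)
      = fun x => |u x| ^ p * rieszPotential α (fun y => |u y| ^ p) x :=
    funext fun x => mul_comm _ _
  refine ⟨hD2, hu2, by rw [eP]; exact hP, by rw [eR]; exact hR, fun hV => ?_⟩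
  obtain ⟨θ, hθ⟩ := exists_isCutoff N
  set l : ℕ → ℝ := fun n => 1 / ((n : ℝ) + 1) with hl
  have hl0 : ∀ n, l n ≠ 0 := fun n => by rw [hl]; positivity
  have hlt : Tendsto l atTop (𝓝 0) := tendsto_one_div_add_atTop_nhds_zero_nat
  have hF := integrable_mul_mul_rieszKernel_of_memLp hN0 hα hαN rfl hup hup
  have id1 := fun n => hsol.stress_identity hN hα hαN hp hq hK hK0 hreg
    (hθ.contDiff_cutoffField (l n)) (hθ.hasCompactSupport_cutoffField (hl0 n))
  have id2 := fun n => hsol.grad_u.coupled_virial hN0 hreg.u_L2 hreg.Du_L2 hq hK hK0 hsol.grad_φ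
    hreg.φ_L2 hreg.Dφ_L2 (hθ.contDiff_comp_smul (l n)) (hθ.compact.comp_smul_ne_zero (hl0 n))
    (fun x => hθ.nonneg _) (fun x => hθ.le_one _) (hreg.locallyIntegrable_source hN) hsol.eq_φ hP
    (id1 n).1 hV
  have T1 := hθ.tendsto_stressForm hl0 hlt hreg.Du_L2
  have T2 := hθ.tendsto_integral_divergence_mul hl0 hlt hu2'
  have T3 := hθ.tendsto_integral_rieszVirial hN0 hl0 hlt (sub_nonneg.2 hαN.le) hF
  have T4 := hθ.tendsto_stressForm hl0 hlt hreg.Dφ_L2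
  have T5 := hθ.tendsto_integral_divergence_mul hl0 hlt hP
  -- `id1` is solved for the coupling integral and inserted into `id2`; this is the resulting
  -- expression for the cut-off integral of `virialDensity`, at the limit `l → 0`.
  have T := ((((T1.sub (T2.const_mul (1 / 2))).add
    (T3.const_mul (rieszConst N α / (2 * p)))).const_mul q).sub T4).sub T5
  have T' := T.congr (f₂ := fun n => ∫ x, θ (l n • x) * virialDensity q K u φ x) fun n => by
    rw [(id2 n).2, (id1 n).2]
    simp only [show cutoffField θ (l n) = fun x => θ (l n • x) • x from rfl]
    ring
  have mV : AEStronglyMeasurable (virialDensity q K u φ) volume :=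
    (hreg.φ_L2.aestronglyMeasurable.mul ((continuous_abs_rpow hq).comp_aestronglyMeasurable
      hreg.u_L2.aestronglyMeasurable)).mul
      (continuous_id.inner (continuous_gradient hK)).aestronglyMeasurable
  -- The cutoff takes values in `[0, 1]`, so the one-sided argument removes it. The energy identity
  -- then merges the `∇φ` term into the `Kφ|u|^q` one: `N - (N - 2)/2 = (N + 2)/2`.
  obtain ⟨hVi, hVe⟩ := integrable_of_tendsto_of_one_sided mV (fun n => (id2 n).1)
    (fun n => Eventually.of_forall fun x => by
      simpa using max_mul_le_max_mul (s := virialDensity q K u φ x) (hθ.nonneg (l n • x))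
        (hθ.le_one (l n • x)))
    (fun n => Eventually.of_forall fun x => by
      simpa using max_neg_mul_le_max_neg_mul (s := virialDensity q K u φ x) (hθ.nonneg (l n • x))
        (hθ.le_one (l n • x)))
    (Eventually.of_forall fun x => by simpa using (hθ.tendsto hlt x).mul_const _) T' hV
  refine ⟨hVi, ?_⟩
  rw [integral_add (hD2.const_mul _) (hu2.const_mul _), integral_const_mul, integral_const_mul, eP,
    eR, hRe, hVe, ← hPe]
  simp_rw [sq_abs]
  have hq0 : q ≠ 0 := by linarith
  have hp0 : p ≠ 0 := by linarith
  field_simp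
  ring
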